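/- **Conventions.** Let $(M,g)$ be a Riemannian manifold with Levi-Civita connection $\nabla^g$. A Sasakian structure on it is a triple $\{\xi,\eta,\varphi\}$ with $\xi$ a unit Killing vector field, $\eta=g(\xi,\cdot)$, $\varphi=-\nabla^g\xi$ and $(\nabla^g_X\varphi)(Y)=g(X,Y)\xi-\eta(Y)X$. A 3-Sasakian structure consists of three Sasakian structures $\{\xi_i,\eta_i,\varphi_i\}_{i=1,2,3}$ with $g(\xi_i,\xi_j)=\delta_{ij}$ and $[\xi_i,\xi_{i+1}]=2\xi_{i+2}$ (indices mod 3). It is homogeneous if the group of isometries of $M$ preserving $\xi_1,\xi_2,\xi_3$ is transitive on $M$. Put $Q^\perp=\mathrm{Span}\{\xi_1,\xi_2,\xi_3\}$ (vertical) and let $Q$ (horizontal) be its orthogonal complement; $\Phi_s(X,Y)=g(X,\varphi_sY)$. Tensors $T^o,T^{rs}$ are defined by $$g(T^o(X,Y),Z)=\eta_1\wedge\eta_2\wedge\eta_3(X,Y,Z),\qquad g(T^{rs}(X,Y),Z)=\eta_r\wedge\Phi_s(X,Y,Z),$$ where $\eta_1\wedge\eta_2\wedge\eta_3(X_1,X_2,X_3)=\det(\eta_i(X_j))$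 and $\eta_r\wedge\Phi_s(X_1,X_2,X_3)=\sum_{i}\eta_r(X_i)\Phi_s(X_{i+1},X_{i+2})$ (indices mod 3). If $M=\mathrm{SU}(n+2)/S(\mathrm U(n)\times \mathrm U(1))$, with $\mathrm{SU}(n+2)$ acting by automorphisms of the 3-Sasakian structure and isotropy group at a base point $o$ equal to $\{\mathrm{diag}(A,\lambda I_2)\}\cap \mathrm{SU}(n+2)$, let $\varphi_0$ be the $\mathrm{SU}(n+2)$-invariant endomorphism field which at $o$ is $\mathrm{ad}\,h$, the derivative of the isotropy representation in the direction $h=(1+\tfrac n2)^{-1}\mathrm{diag}(\mathbf i I_n,-\tfrac{n\mathbf i}{2}I_2)$; put $\Phi_0(X,Y)=g(X,\varphi_0Y)$ and define $T^{l0}$ by $g(T^{l0}(X,Y),Z)=\eta_l\wedge\Phi_0(X,Y,Z)$. **Proposition.** Let $M$ be a homogeneous 3-Sasakian manifold of dimension $4n+3\ge 7$. Let $a\in\mathbb R$, $B=(b_{rs})\in\mathcal M_3(\mathbb R)$, $c\in\mathbb R^3$, where $c=0$ unless $M=\mathrm{SU}(n+2)/S(\mathrm U(n)\times\mathrm U(1))$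 as above (terms containing $c$ are then omitted), and let $$\nabla=\nabla^g+\tfrac12\Big(aT^o+\sum_{r,s=1}^3b_{rs}T^{rs}+\sum_{l=1}^3c_lT^{l0}\Big).$$ Let $T^\nabla$ be the torsion of $\nabla$, and, at any point and for any orthonormal basis $\{e_j\}$ there, let $\mathbf S(X,Y)=\sum_jg(T^\nabla(e_j,X),T^\nabla(e_j,Y))$, $\mathrm{Ric}^\nabla(X,Y)=\sum_i g(R^\nabla(e_i,X)Y,e_i)$, with symmetric part $\mathrm{Sym}(\mathrm{Ric}^\nabla)$, and $s^\nabla=\sum_{i,j}g(R^\nabla(e_i,e_j)e_j,e_i)$. Write $\|B\|^2=\sum b_{rs}^2$, $\|c\|^2=\sum c_l^2$. Then, for $i,k\in\{1,2,3\}$ and $X,Y$ horizontal: i) $\mathbf S|_{Q\times Q^\perp}=0$, $$\mathbf S(\xi_i,\xi_k)=2\delta_{ik}(a-\mathrm{tr}B)^2+4n\sum_{s=1}^3b_{is}b_{ks}+4nc_ic_k,$$ $$\mathbf S(X,Y)=2(\|B\|^2+\|c\|^2)g(X,Y)+4\sum_{s,j=1}^3b_{js}c_j\,g(\varphi_0X,\varphi_sY).$$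 ii) $\mathrm{Sym}(\mathrm{Ric}^\nabla)|_{Q\times Q^\perp}=0$, $$\mathrm{Sym}(\mathrm{Ric}^\nabla)(\xi_i,\xi_k)=\Big(4n+2-\tfrac12(a-\mathrm{tr}B)^2\Big)\delta_{ik}-n\sum_{s=1}^3b_{is}b_{ks}-nc_ic_k,$$ $$\mathrm{Sym}(\mathrm{Ric}^\nabla)(X,Y)=\Big(4n+2-\tfrac{\|B\|^2+\|c\|^2}{2}\Big)g(X,Y)-\sum_{s,j=1}^3b_{js}c_j\,g(\varphi_0X,\varphi_sY).$$ iii) $s^\nabla=(4n+2)(4n+3)-\tfrac32(a-\mathrm{tr}B)^2-3n(\|B\|^2+\|c\|^2)$. -/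

import Mathlib

open Bundle Module
open scoped Manifold ContDiff

noncomputable section

namespace ThreeSasakian

/-! ### Linear algebra: from 3-forms to (1,2)-tensors -/

section LinearAlgebra

variable {V : Type*} [NormedAddCommGroup V] [InnerProductSpace ℝ V]

/-- The exterior product `η₁ ∧ η₂ ∧ η₃` (normalised so that its value on three vectors is the
alternating sum over all permutations of the arguments), where `η i = g(ξ i, ·)`. -/
def verticalForm (ξ : Fin 3 → V) (X Y Z : V) : ℝ :=
  Matrix.det (Matrix.of ![fun i => inner ℝ (ξ i) X, fun i => inner ℝ (ξ i) Y,
    fun i => inner ℝ (ξ i) Z])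

/-- The exterior product `η ∧ Φ`, where `η = g(ξ, ·)` and `Φ(X, Y) = g(X, φ Y)`. -/
def wedgeForm (ξ : V) (φ : V →L[ℝ] V) (X Y Z : V) : ℝ :=
  inner ℝ ξ X * inner ℝ Y (φ Z) + inner ℝ ξ Y * inner ℝ Z (φ X) + inner ℝ ξ Z * inner ℝ X (φ Y)

variable [FiniteDimensional ℝ V]

/-- The vector metrically equivalent to a linear form. -/
def sharp (α : V → ℝ) : V := ∑ k, α (stdOrthonormalBasis ℝ V k) • stdOrthonormalBasis ℝ V k

theorem inner_sharp (α : V →ₗ[ℝ] ℝ) (Z : V) : inner ℝ (sharp α) Z = α Z := by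
  conv_rhs => rw [← (stdOrthonormalBasis ℝ V).sum_repr Z]
  simp [sharp, sum_inner, inner_smul_left, OrthonormalBasis.repr_apply_apply, mul_comm]

/-- The tensor `Tᵒ`, determined by `g(Tᵒ(X, Y), Z) = (η₁ ∧ η₂ ∧ η₃)(X, Y, Z)`. -/
def verticalTorsion (ξ : Fin 3 → V) : V →L[ℝ] V →L[ℝ] V :=
  (LinearMap.mk₂ ℝ (fun X Y => sharp (verticalForm ξ X Y))
    (fun X X' Y => by
      simp only [sharp, ← Finset.sum_add_distrib, ← add_smul]
      refine Finset.sum_congr rfl fun k _ => congrArg (· • _) ?_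
      simp [verticalForm, Matrix.det_fin_three, inner_add_right]; ring)
    (fun a X Y => by
      simp only [sharp, Finset.smul_sum, smul_smul]
      refine Finset.sum_congr rfl fun k _ => congrArg (· • _) ?_
      simp [verticalForm, Matrix.det_fin_three, inner_smul_right]; ring)
    (fun X Y Y' => by
      simp only [sharp, ← Finset.sum_add_distrib, ← add_smul]
      refine Finset.sum_congr rfl fun k _ => congrArg (· • _) ?_
      simp [verticalForm, Matrix.det_fin_three, inner_add_right]; ring)
    (fun a X Y => by
      simp only [sharp, Finset.smul_sum, smul_smul]
      refine Finset.sum_congr rfl fun k _ => congrArg (· • _) ?_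
      simp [verticalForm, Matrix.det_fin_three, inner_smul_right]; ring)).toContinuousBilinearMap

theorem inner_verticalTorsion (ξ : Fin 3 → V) (X Y Z : V) :
    inner ℝ (verticalTorsion ξ X Y) Z = verticalForm ξ X Y Z :=
  inner_sharp
    { toFun := verticalForm ξ X Y
      map_add' := fun Z Z' => by
        simp [verticalForm, Matrix.det_fin_three, inner_add_right]; ring
      map_smul' := fun a Z => by
        simp [verticalForm, Matrix.det_fin_three, inner_smul_right]; ring } Z

/-- The tensor `T` determined by `g(T(X, Y), Z) = (η ∧ Φ)(X, Y, Z)`, where `η = g(ξ, ·)` and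
`Φ(X, Y) = g(X, φ Y)`. -/
def wedgeTorsion (ξ : V) (φ : V →L[ℝ] V) : V →L[ℝ] V →L[ℝ] V :=
  (LinearMap.mk₂ ℝ (fun X Y => sharp (wedgeForm ξ φ X Y))
    (fun X X' Y => by
      simp only [sharp, ← Finset.sum_add_distrib, ← add_smul]
      refine Finset.sum_congr rfl fun k _ => congrArg (· • _) ?_
      simp [wedgeForm, inner_add_right, inner_add_left]; ring)
    (fun a X Y => by
      simp only [sharp, Finset.smul_sum, smul_smul]
      refine Finset.sum_congr rfl fun k _ => congrArg (· • _) ?_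
      simp [wedgeForm, inner_smul_right, inner_smul_left]; ring)
    (fun X Y Y' => by
      simp only [sharp, ← Finset.sum_add_distrib, ← add_smul]
      refine Finset.sum_congr rfl fun k _ => congrArg (· • _) ?_
      simp [wedgeForm, inner_add_right, inner_add_left]; ring)
    (fun a X Y => by
      simp only [sharp, Finset.smul_sum, smul_smul]
      refine Finset.sum_congr rfl fun k _ => congrArg (· • _) ?_
      simp [wedgeForm, inner_smul_right, inner_smul_left]; ring)).toContinuousBilinearMap

theorem inner_wedgeTorsion (ξ : V) (φ : V →L[ℝ] V) (X Y Z : V) :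
    inner ℝ (wedgeTorsion ξ φ X Y) Z = wedgeForm ξ φ X Y Z :=
  inner_sharp
    { toFun := wedgeForm ξ φ X Y
      map_add' := fun Z Z' => by
        simp [wedgeForm, inner_add_right, inner_add_left]; ring
      map_smul' := fun a Z => by
        simp [wedgeForm, inner_smul_right, inner_smul_left]; ring } Z

end LinearAlgebra

/-! ### Connections and curvature on a Riemannian manifold -/

section Manifold

variable {E : Type*} [NormedAddCommGroup E] [NormedSpace ℝ E] [FiniteDimensional ℝ E]
  {H : Type*} [TopologicalSpace H] {I : ModelWithCorners ℝ E H}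
  {M : Type*} [TopologicalSpace M] [ChartedSpace H M] [IsManifold I ∞ M]

instance (p : M) : FiniteDimensional ℝ (TangentSpace I p) :=
  inferInstanceAs (FiniteDimensional ℝ E)

/-- `X` is a smooth vector field. -/
def IsSmoothField (X : Π p : M, TangentSpace I p) : Prop :=
  ContMDiff I I.tangent ∞ (fun p => (⟨p, X p⟩ : TangentBundle I M))

/-- The vector field `X` is differentiable at `p`. -/
def DifferentiableFieldAt (X : Π p : M, TangentSpace I p) (p : M) : Prop :=
  MDifferentiableAt I I.tangent (fun q => (⟨q, X q⟩ : TangentBundle I M)) p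

/-- The curvature `R(X, Y)Z = ∇_X ∇_Y Z - ∇_Y ∇_X Z - ∇_[X,Y] Z` on vector fields. Note that
`nabla Z p (X p)` is `(∇_X Z)_p`. -/
def curvature (nabla : CovariantDerivative I E (TangentSpace I : M → Type _))
    (X Y Z : Π p : M, TangentSpace I p) (p : M) : TangentSpace I p :=
  nabla (fun q => nabla Z q (Y q)) p (X p) - nabla (fun q => nabla Z q (X q)) p (Y p)
    - nabla Z p (VectorField.mlieBracket I X Y p)

/-- The curvature tensor `R(x, y)z` at `p` (its value does not depend on the vector fields,
smooth near `p`, that extend the tangent vectors `x, y, z`). -/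
def curvatureAt (nabla : CovariantDerivative I E (TangentSpace I : M → Type _)) (p : M)
    (x y z : TangentSpace I p) : TangentSpace I p :=
  curvature nabla (FiberBundle.extend E x) (FiberBundle.extend E y) (FiberBundle.extend E z) p

variable [RiemannianBundle (fun p : M => TangentSpace I p)]
  [IsContMDiffRiemannianBundle I ∞ E (fun p : M => TangentSpace I p)]

/-- `nabla` is the Levi-Civita connection of the Riemannian metric. -/
structure IsLeviCivita (nabla : CovariantDerivative I E (TangentSpace I : M → Type _)) :
    Prop where
  smooth : CovariantDerivative.ContMDiffCovariantDerivative nabla ∞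
  /-- `v g(X, Y) = g(∇_v X, Y) + g(X, ∇_v Y)`. -/
  metric : ∀ (p : M) (X Y : Π q : M, TangentSpace I q), DifferentiableFieldAt X p →
    DifferentiableFieldAt Y p → ∀ v : TangentSpace I p,
      mfderiv I 𝓘(ℝ, ℝ) (fun q => (inner ℝ (X q) (Y q) : ℝ)) p v
        = (inner ℝ (nabla X p v) (Y p) + inner ℝ (X p) (nabla Y p v) : ℝ)
  torsion_free : nabla.torsion = 0

section Tensors

variable {ι : Type*} [Fintype ι]

/-- `S(x, y) = ∑ⱼ g(T(eⱼ, x), T(eⱼ, y))`, with `T` the torsion of `nabla` and `e` an orthonormal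
basis of the tangent space at `p`. -/
def torsionSquare (nabla : CovariantDerivative I E (TangentSpace I : M → Type _)) {p : M}
    (e : OrthonormalBasis ι ℝ (TangentSpace I p)) (x y : TangentSpace I p) : ℝ :=
  ∑ j, inner ℝ (nabla.torsion p (e j) x) (nabla.torsion p (e j) y)

/-- The Ricci tensor `Ric(y, z) = tr (x ↦ R(x, y)z)`. -/
def ricci (nabla : CovariantDerivative I E (TangentSpace I : M → Type _)) {p : M}
    (e : OrthonormalBasis ι ℝ (TangentSpace I p)) (y z : TangentSpace I p) : ℝ :=
  ∑ i, inner ℝ (curvatureAt nabla p (e i) y z) (e i)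

/-- The symmetric part of the Ricci tensor. -/
def symRicci (nabla : CovariantDerivative I E (TangentSpace I : M → Type _)) {p : M}
    (e : OrthonormalBasis ι ℝ (TangentSpace I p)) (y z : TangentSpace I p) : ℝ :=
  (ricci nabla e y z + ricci nabla e z y) / 2

/-- The scalar curvature `∑ᵢⱼ g(R(eᵢ, eⱼ)eⱼ, eᵢ)`. -/
def scalarCurvature (nabla : CovariantDerivative I E (TangentSpace I : M → Type _)) {p : M}
    (e : OrthonormalBasis ι ℝ (TangentSpace I p)) : ℝ :=
  ∑ i, ∑ j, inner ℝ (curvatureAt nabla p (e i) (e j) (e j)) (e i)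

end Tensors

/-! ### 3-Sasakian structures -/

/-- The endomorphism field `φ(v) = -∇_v ξ`. -/
def reebEndo (nabla : CovariantDerivative I E (TangentSpace I : M → Type _))
    (ξ : Π p : M, TangentSpace I p) (p : M) : TangentSpace I p →L[ℝ] TangentSpace I p :=
  -nabla ξ p

/-- `ξ` is the Reeb vector field of a Sasakian structure `{ξ, η, φ}`, where `η = g(ξ, ·)`,
`φ = -∇ξ`, and `nabla` is the Levi-Civita connection `∇`. -/
structure IsSasakian (nabla : CovariantDerivative I E (TangentSpace I : M → Type _))
    (ξ : Π p : M, TangentSpace I p) : Prop where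
  smooth : IsSmoothField ξ
  unit : ∀ p, inner ℝ (ξ p) (ξ p) = (1 : ℝ)
  /-- Killing's equation. -/
  killing : ∀ p (v w : TangentSpace I p), inner ℝ (nabla ξ p v) w + inner ℝ v (nabla ξ p w) = (0 : ℝ)
  /-- `(∇_v φ)(Y) = g(v, Y) ξ - η(Y) v`. -/
  nabla_phi : ∀ (p : M) (Y : Π q : M, TangentSpace I q), DifferentiableFieldAt Y p →
    ∀ v : TangentSpace I p,
    nabla (fun q => reebEndo nabla ξ q (Y q)) p v - reebEndo nabla ξ p (nabla Y p v)
      = (inner ℝ v (Y p) : ℝ) • ξ p - (inner ℝ (ξ p) (Y p) : ℝ) • v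

/-- Three Sasakian structures with `g(ξᵢ, ξⱼ) = δᵢⱼ` and `[ξᵢ, ξᵢ₊₁] = 2 ξᵢ₊₂` (indices modulo
three). -/
structure IsThreeSasakian (nabla : CovariantDerivative I E (TangentSpace I : M → Type _))
    (ξ : Fin 3 → Π p : M, TangentSpace I p) : Prop where
  leviCivita : IsLeviCivita nabla
  sasakian : ∀ i, IsSasakian nabla (ξ i)
  orthonormal : ∀ p, Orthonormal ℝ (fun i => ξ i p)
  bracket : ∀ i p, VectorField.mlieBracket I (ξ i) (ξ (i + 1)) p = (2 : ℝ) • ξ (i + 2) p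

/-- The smooth map `f` preserves the Riemannian metric, `f^* g = g`, and every Reeb vector field
(hence the whole 3-Sasakian structure). -/
structure PreservesStructure (ξ : Fin 3 → Π p : M, TangentSpace I p) (f : M → M) : Prop where
  isometry : ∀ p (v w : TangentSpace I p),
    inner ℝ (mfderiv I I f p v) (mfderiv I I f p w) = (inner ℝ v w : ℝ)
  reeb : ∀ i p, mfderiv I I f p (ξ i p) = ξ i (f p)

/-- The group of automorphisms of the 3-Sasakian structure (diffeomorphisms which are isometries
and preserve the Reeb vector fields) acts transitively. -/
def IsHomogeneous (ξ : Fin 3 → Π p : M, TangentSpace I p) : Prop :=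
  ∀ p q : M, ∃ f : M ≃ₘ^∞⟮I, I⟯ M, PreservesStructure ξ f ∧ f p = q

/-- The vertical space `Q^⊥`, spanned by the Reeb vector fields; the horizontal space `Q` is its
orthogonal complement. -/
def vertical (ξ : Fin 3 → Π p : M, TangentSpace I p) (p : M) : Submodule ℝ (TangentSpace I p) :=
  Submodule.span ℝ (Set.range fun i => ξ i p)

/-- The horizontal space `Q`. -/
def horizontal (ξ : Fin 3 → Π p : M, TangentSpace I p) (p : M) : Submodule ℝ (TangentSpace I p) :=
  (vertical ξ p)ᗮ

/-- The tensor `a Tᵒ + ∑ b_rs T^{rs} + ∑ c_l T^{l0}`, where `T^{rs}` is metrically equivalent to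
`η_r ∧ Φ_s`, and `Φ_0(X, Y) = g(X, φ₀ Y)`. -/
def skewTensor (nabla : CovariantDerivative I E (TangentSpace I : M → Type _))
    (ξ : Fin 3 → Π p : M, TangentSpace I p)
    (φ₀ : Π p : M, TangentSpace I p →L[ℝ] TangentSpace I p)
    (a : ℝ) (B : Matrix (Fin 3) (Fin 3) ℝ) (c : Fin 3 → ℝ) (p : M) :
    TangentSpace I p →L[ℝ] TangentSpace I p →L[ℝ] TangentSpace I p :=
  a • verticalTorsion (fun i => ξ i p)
    + ∑ r, ∑ s, B r s • wedgeTorsion (ξ r p) (reebEndo nabla (ξ s) p)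
    + ∑ l, c l • wedgeTorsion (ξ l p) (φ₀ p)

/-- The connection `∇_X Y = ∇^g_X Y + ½ T(X, Y)` with
`T = a Tᵒ + ∑ b_rs T^{rs} + ∑ c_l T^{l0}`. -/
def skewConnection (nabla : CovariantDerivative I E (TangentSpace I : M → Type _))
    (ξ : Fin 3 → Π p : M, TangentSpace I p)
    (φ₀ : Π p : M, TangentSpace I p →L[ℝ] TangentSpace I p)
    (a : ℝ) (B : Matrix (Fin 3) (Fin 3) ℝ) (c : Fin 3 → ℝ) :
    CovariantDerivative I E (TangentSpace I : M → Type _) :=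
  nabla.addOneForm fun p => (1 / 2 : ℝ) • (skewTensor nabla ξ φ₀ a B c p).flip

end Manifold

/-! ### The homogeneous space `SU(n+2) / S(U(n) × U(1))`

Coordinates of `ℂ^{n+2}` are indexed by `Fin n ⊕ Fin 2`. -/

section SpecialUnitary

/-- The special unitary group `SU(n+2)`. -/
abbrev SU (n : ℕ) : Type := Matrix.specialUnitaryGroup (Fin n ⊕ Fin 2) ℂ

/-- The subgroup `S(U(n) × U(1))` of the matrices `diag(A, λ I₂)` in `SU(n+2)`. -/
def isotropySet (n : ℕ) : Set (SU n) :=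
  {A | A.1.toBlocks₁₂ = 0 ∧ A.1.toBlocks₂₁ = 0 ∧
    ∃ l : ℂ, A.1.toBlocks₂₂ = l • (1 : Matrix (Fin 2) (Fin 2) ℂ)}

/-- The diagonal entries of `h`. -/
def centralEntry (n : ℕ) : Fin n ⊕ Fin 2 → ℂ :=
  Sum.elim (fun _ => (1 + (n : ℂ) / 2)⁻¹ * Complex.I)
    (fun _ => (1 + (n : ℂ) / 2)⁻¹ * (-((n : ℂ) * Complex.I) / 2))

/-- The central element `h = (1 + n/2)⁻¹ diag(i Iₙ, -(n i / 2) I₂)` of the isotropy algebra. -/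
def centralElement (n : ℕ) : Matrix (Fin n ⊕ Fin 2) (Fin n ⊕ Fin 2) ℂ :=
  Matrix.diagonal (centralEntry n)

theorem exp_centralElement (n : ℕ) (t : ℝ) :
    NormedSpace.exp (t • centralElement n)
      = Matrix.diagonal fun i => Complex.exp (t * centralEntry n i) := by
  have : t • centralElement n = Matrix.diagonal fun i => (t : ℂ) * centralEntry n i := by
    ext i j
    by_cases h : i = j
    · subst h; simp [centralElement]
    · simp [centralElement, h]
  rw [this, Matrix.exp_diagonal]
  congr 1
  ext i
  rw [Pi.coe_exp, Complex.exp_eq_exp_ℂ]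

theorem exp_centralElement_mem (n : ℕ) (t : ℝ) :
    NormedSpace.exp (t • centralElement n) ∈ Matrix.specialUnitaryGroup (Fin n ⊕ Fin 2) ℂ := by
  have hr : ∀ i, (starRingEnd ℂ) (centralEntry n i) = -centralEntry n i := by
    rintro (i | i)
    · simp [centralEntry, Complex.conj_ofNat]
    · simp [centralEntry, Complex.conj_ofNat]
      ring
  have h0 : (1 + (n : ℂ) / 2) ≠ 0 := by
    have h : ((1 + (n : ℝ) / 2 : ℝ) : ℂ) ≠ 0 := Complex.ofReal_ne_zero.2 (by positivity)
    simpa using h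
  rw [exp_centralElement, Matrix.mem_specialUnitaryGroup_iff, Matrix.mem_unitaryGroup_iff,
    Matrix.star_eq_conjTranspose, Matrix.diagonal_conjTranspose, Matrix.diagonal_mul_diagonal,
    Matrix.det_diagonal]
  constructor
  · rw [← Matrix.diagonal_one]
    congr 1
    ext i
    rw [Pi.star_apply, Complex.star_def, ← Complex.exp_conj, map_mul, hr, Complex.conj_ofReal,
      ← Complex.exp_add]
    simp
  · rw [← Complex.exp_sum, Fintype.sum_sum_type]
    simp [centralEntry]
    ring_nf
    simp

/-- The one-parameter subgroup `exp(t h)` of `SU(n+2)`. -/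
def centralFlow (n : ℕ) (t : ℝ) : SU n :=
  ⟨NormedSpace.exp (t • centralElement n), exp_centralElement_mem n t⟩

variable {n : ℕ} {E : Type*} [NormedAddCommGroup E] [NormedSpace ℝ E] [FiniteDimensional ℝ E]
  {H : Type*} [TopologicalSpace H] {I : ModelWithCorners ℝ E H}
  {M : Type*} [TopologicalSpace M] [ChartedSpace H M] [IsManifold I ∞ M]
  [RiemannianBundle (fun p : M => TangentSpace I p)]

/-- A presentation of `M` as the homogeneous space `SU(n+2) / S(U(n) × U(1))`: a smooth transitive
action of `SU(n+2)` on `M` by automorphisms of the 3-Sasakian structure, for which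
`S(U(n) × U(1))` is the isotropy group of a base point. -/
structure SUPresentation (n : ℕ) (ξ : Fin 3 → Π p : M, TangentSpace I p) where
  /-- The action. -/
  action : MulAction (SU n) M
  /-- The action map `SU(n+2) × M → M` is smooth: it is so along every smooth map
  `f : ℝᵏ → SU(n+2)`. -/
  smooth : ∀ (k : ℕ) (f : EuclideanSpace ℝ (Fin k) → SU n),
    (∀ i j, ContDiff ℝ ∞ fun t => (f t).1 i j) →
    ContMDiff ((𝓡 k).prod I) I ∞ fun tp : EuclideanSpace ℝ (Fin k) × M => f tp.1 • tp.2
  preserves : ∀ A : SU n, PreservesStructure ξ fun p => A • p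
  /-- The base point `o`. -/
  base : M
  transitive : ∀ p : M, ∃ A : SU n, A • base = p
  isotropy : ∀ A : SU n, A • base = base ↔ A ∈ isotropySet n

namespace SUPresentation

variable {ξ : Fin 3 → Π p : M, TangentSpace I p} (P : SUPresentation n ξ)

/-- The differential at `p` of the action of `A`, all tangent spaces being copies of the model
space `E`. -/
def translation (A : SU n) (p : M) : E →L[ℝ] E :=
  letI := P.action
  mfderiv I I (fun q : M => A • q) p

/-- The endomorphism `φ₀ = ad h` of the tangent space at the base point: the derivative at `t = 0`
of the isotropy representation along `exp(t h)`. -/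
def phiBase : E →L[ℝ] E :=
  deriv (fun t : ℝ => P.translation (centralFlow n t) P.base) 0

/-- The `SU(n+2)`-invariant endomorphism field `φ₀` equal to `ad h` at the base point. -/
def phiZero (p : M) : TangentSpace I p →L[ℝ] TangentSpace I p :=
  let A := (P.transitive p).choose
  (P.translation A P.base ∘L P.phiBase ∘L P.translation A⁻¹ p : E →L[ℝ] E)

end SUPresentation

end SpecialUnitary

end ThreeSasakian

end

/-!
The connection is `∇ = ∇ᵍ + ½ T` with `T` totally skew-symmetric, so its torsion is `T`, and the
formulas follow from three facts.

* *Curvature of a connection with skew torsion.* Symmetrising the curvature of `∇ᵍ + ½ T` in the last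
  two slots removes the covariant derivative of `T` and leaves `Sym(Ric^∇) = Ricᵍ - ¼ S`
  (`IsSmoothSkewTensor.symRicci_addTorsion`). Hence ii) and iii) follow from i) and from `Ricᵍ`.

* *A 3-Sasakian manifold is Einstein*, `Ricᵍ = (4n+2) g` (`IsThreeSasakian.ricci_eq`). The defining
  equation of a Sasakian structure gives `R(X, Y)ξ = η(Y)X - η(X)Y` and a formula for
  `[R(X, Y), φ]`; the difference `R'` between the curvature and that of the unit sphere then kills
  every `ξᵢ` and commutes with every `φᵢ`. By the Bianchi identity the contraction of `R'` with `φᵢ` is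
  the trace of `R'(X, Y) ∘ φᵢ`, which vanishes because it is the trace of an operator commuting
  with the `φⱼ`, composed with `φᵢ`; so the Ricci operator of `R'` anticommutes with `φ₁`, `φ₂`
  and `φ₃ = ±φ₁φ₂` on the horizontal space, and is zero (`QuaternionicRelations.ricci_eq_zero`).

* *The tensor `S` is linear algebra at a point.* The 3-form of `T` is
  `a η₁ ∧ η₂ ∧ η₃ + ∑ᵣ ηᵣ ∧ g(·, ωᵣ ·)` with `ωᵣ = ∑ₛ b_rs φₛ + c_r φ₀`. For horizontal `X` one has
  `T(X, ξᵣ) = ωᵣ X`, and the sums over an orthonormal basis become traces, for which only the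
  quaternionic relations of the `φₛ` and the following properties of `φ₀` are needed: it is skew,
  kills `ξᵢ`, commutes with `φₛ` and satisfies `φ₀² = -1` on the horizontal space
  (`IsTorsionOf.sum_inner_horizontal`, `IsTorsionOf.sum_inner_reeb`).

When `c ≠ 0`, these properties of `φ₀` come from the action of `SU(n+2)`. The map
`x ↦ exp(x) o`, on a complement of the isotropy algebra isomorphic to `ℂ^{n×2} ⊕ 𝔰𝔲(2)`, has
invertible derivative at the origin, because an element `x` of the kernel generates a one-parameter
group fixing `o`. It turns the isotropy representation of `exp(t h)` into multiplication by `e^{it}`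
on `ℂ^{n×2}`. As the Reeb vectors are fixed, they span the image of `𝔰𝔲(2)`, and `φ₀` is
multiplication by `i` on the horizontal space. Automorphisms commute with `φₛ` since they preserve
`dηₛ` (`IsSasakian.mfderiv_reebEndo`), and local sections of the orbit map show that `φ₀` is smooth
(`SUPresentation.isSmoothField_phiZero`).
-/

set_option linter.unusedSectionVars false

noncomputable section

namespace ThreeSasakian

open VectorField Topology

/-! ### Smooth vector fields -/

section SmoothFields

variable {E : Type*} [NormedAddCommGroup E] [NormedSpace ℝ E]
  {H : Type*} [TopologicalSpace H] {I : ModelWithCorners ℝ E H}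
  {M : Type*} [TopologicalSpace M] [ChartedSpace H M] [IsManifold I ∞ M]
  {X Y Z : Π p : M, TangentSpace I p}

theorem IsSmoothField.add (hX : IsSmoothField X) (hY : IsSmoothField Y) :
    IsSmoothField (X + Y) :=
  ContMDiff.add_section hX hY

theorem IsSmoothField.sub (hX : IsSmoothField X) (hY : IsSmoothField Y) :
    IsSmoothField (X - Y) :=
  ContMDiff.sub_section hX hY

theorem IsSmoothField.neg (hX : IsSmoothField X) : IsSmoothField (-X) :=
  ContMDiff.neg_section hX

theorem IsSmoothField.smul {f : M → ℝ} (hf : ContMDiff I 𝓘(ℝ, ℝ) ∞ f) (hX : IsSmoothField X) :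
    IsSmoothField (f • X) :=
  ContMDiff.smul_section hf hX

theorem IsSmoothField.const_smul (a : ℝ) (hX : IsSmoothField X) : IsSmoothField (a • X) :=
  ContMDiff.const_smul_section hX

theorem IsSmoothField.sum {ι : Type*} {s : Finset ι} {X : ι → Π p : M, TangentSpace I p}
    (hX : ∀ i ∈ s, IsSmoothField (X i)) : IsSmoothField (fun p => ∑ i ∈ s, X i p) :=
  ContMDiff.sum_section hX

theorem IsSmoothField.differentiableAt (hX : IsSmoothField X) (p : M) :
    DifferentiableFieldAt X p :=
  (hX p).mdifferentiableAt (by simp)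

theorem IsSmoothField.mlieBracket [FiniteDimensional ℝ E] (hX : IsSmoothField X)
    (hY : IsSmoothField Y) :
    IsSmoothField (mlieBracket I X Y) := by
  have := FiniteDimensional.complete ℝ E
  have : IsManifold I (minSmoothness ℝ 2) M := by
    rw [minSmoothness_of_isRCLikeNormedField]; infer_instance
  have : IsManifold I (((⊤ : ℕ∞) : ℕ∞ω) + 1) M := by
    exact inferInstanceAs (IsManifold I ∞ M)
  exact ContDiff.mlieBracket_vectorField (m := ⊤) (n := ⊤) hX hY
    (by rw [minSmoothness_of_isRCLikeNormedField]; exact le_rfl)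

/-- Every tangent vector is the value of a smooth vector field that agrees, near the base point,
with the local extension `FiberBundle.extend`. -/
theorem exists_isSmoothField_eventuallyEq_extend [FiniteDimensional ℝ E] [T2Space M] {p : M}
    (v : TangentSpace I p) :
    ∃ X : Π q : M, TangentSpace I q, IsSmoothField X ∧
      ∀ᶠ q in 𝓝 p, X q = FiberBundle.extend E v q := by
  obtain ⟨s, hs, hsm⟩ := FiberBundle.exists_contMDiffOn_extend (k := ∞) I E v
  obtain ⟨u, hus, huo, hpu⟩ := mem_nhds_iff.1 hs
  obtain ⟨f, -, hf⟩ :=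
    (SmoothBumpFunction.nhds_basis_tsupport (I := I) p).mem_iff.1 (huo.mem_nhds hpu)
  refine ⟨(f : M → ℝ) • (fun q => FiberBundle.extend E v q), ?_, ?_⟩
  · exact ContMDiffOn.smul_section_of_tsupport f.contMDiff.contMDiffOn huo hf (hsm.mono hus)
  · filter_upwards [f.eventuallyEq_one] with q hq
    simp [hq]

theorem exists_isSmoothField_eq [FiniteDimensional ℝ E] [T2Space M] {p : M}
    (v : TangentSpace I p) :
    ∃ X : Π q : M, TangentSpace I q, IsSmoothField X ∧ X p = v := by
  obtain ⟨X, hX, h⟩ := exists_isSmoothField_eventuallyEq_extend v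
  exact ⟨X, hX, by rw [h.self_of_nhds, FiberBundle.extend_apply_self]⟩

/-- On functions, `X(Yf) - Y(Xf) = [X, Y]f`. This is the Jacobi identity for `X`, `Y` and `f U`,
where `U` is a vector field that does not vanish at the point. -/
theorem mvfderiv_mlieBracket [FiniteDimensional ℝ E] [T2Space M] {f : M → ℝ}
    (hf : ContMDiff I 𝓘(ℝ, ℝ) ∞ f) (hX : IsSmoothField X) (hY : IsSmoothField Y)
    (hXf : ContMDiff I 𝓘(ℝ, ℝ) ∞ fun q => mvfderiv I f q (X q))
    (hYf : ContMDiff I 𝓘(ℝ, ℝ) ∞ fun q => mvfderiv I f q (Y q)) (p : M) :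
    mvfderiv I (fun q => mvfderiv I f q (Y q)) p (X p)
      - mvfderiv I (fun q => mvfderiv I f q (X q)) p (Y p)
      = mvfderiv I f p (mlieBracket I X Y p) := by
  have := FiniteDimensional.complete ℝ E
  have : IsManifold I (minSmoothness ℝ 3) M := by
    rw [minSmoothness_of_isRCLikeNormedField]; infer_instance
  have h2 : minSmoothness ℝ 2 ≤ (∞ : ℕ∞ω) := by
    rw [minSmoothness_of_isRCLikeNormedField]
    exact WithTop.coe_le_coe.2 le_top
  by_cases hp : ∀ v : TangentSpace I p, v = 0
  · rw [hp (X p), hp (Y p), hp (mlieBracket I X Y p)]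
    simp
  push Not at hp
  obtain ⟨u, hu⟩ := hp
  obtain ⟨U, hU, rfl⟩ := exists_isSmoothField_eq u
  have hd : ∀ {g : M → ℝ}, ContMDiff I 𝓘(ℝ, ℝ) ∞ g → ∀ q, MDifferentiableAt I 𝓘(ℝ, ℝ) g q :=
    fun hg q => (hg q).mdifferentiableAt (by simp)
  have key : ∀ (V : Π q : M, TangentSpace I q), IsSmoothField V →
      mlieBracket I V (f • U) = (fun q => mvfderiv I f q (V q)) • U + f • mlieBracket I V U := by
    intro V hV
    ext1 q
    exact mlieBracket_smul_right (hd hf q) (hU.differentiableAt q)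
  have key2 : ∀ {V W : Π q : M, TangentSpace I q}, IsSmoothField V → IsSmoothField W →
      (ContMDiff I 𝓘(ℝ, ℝ) ∞ fun q => mvfderiv I f q (W q)) →
      mlieBracket I V (mlieBracket I W (f • U)) p
        = (mvfderiv I (fun q => mvfderiv I f q (W q)) p (V p) • U p
            + mvfderiv I f p (W p) • mlieBracket I V U p)
          + (mvfderiv I f p (V p) • mlieBracket I W U p
            + f p • mlieBracket I V (mlieBracket I W U) p) := by
    intro V W hV hW hWf
    have hWU := hW.mlieBracket hU
    rw [key W hW, mlieBracket_add_right ((hU.smul hWf).differentiableAt p)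
      ((hWU.smul hf).differentiableAt p),
      mlieBracket_smul_right (hd hWf p) (hU.differentiableAt p),
      mlieBracket_smul_right (hd hf p) (hWU.differentiableAt p)]
  have hle : ∀ {V : Π q : M, TangentSpace I q}, IsSmoothField V →
      ContMDiffAt I I.tangent (minSmoothness ℝ 2) (fun q => (⟨q, V q⟩ : TangentBundle I M)) p :=
    fun hV => (hV p).of_le h2
  have J := leibniz_identity_mlieBracket_apply (hle hX) (hle hY) (hle hU)
  have Jf := leibniz_identity_mlieBracket_apply (hle hX) (hle hY) (hle (hU.smul hf))
  rw [key2 hX hY hYf, key2 hY hX hXf, key _ (hX.mlieBracket hY)] at Jf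
  simp only [Pi.add_apply, Pi.smul_apply', J, smul_add] at Jf
  have : (mvfderiv I (fun q => mvfderiv I f q (Y q)) p (X p)
      - mvfderiv I (fun q => mvfderiv I f q (X q)) p (Y p)
      - mvfderiv I f p (mlieBracket I X Y p)) • U p = 0 := by
    rw [sub_smul, sub_smul, sub_eq_zero, sub_eq_iff_eq_add, ← sub_eq_zero, ← sub_eq_zero.2 Jf]
    abel
  have := (smul_eq_zero.1 this).resolve_right hu
  linarith

end SmoothFields

/-! ### Curvature of smooth connections -/

section Curvature

variable {E : Type*} [NormedAddCommGroup E] [NormedSpace ℝ E] [FiniteDimensional ℝ E]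
  {H : Type*} [TopologicalSpace H] {I : ModelWithCorners ℝ E H}
  {M : Type*} [TopologicalSpace M] [ChartedSpace H M] [IsManifold I ∞ M]

/-- The connection maps pairs of smooth vector fields `X, Y` to smooth vector fields `∇_X Y`. -/
def IsSmoothConnection (nabla : CovariantDerivative I E (TangentSpace I : M → Type _)) : Prop :=
  ∀ X Y : Π p : M, TangentSpace I p, IsSmoothField X → IsSmoothField Y →
    IsSmoothField fun q => nabla Y q (X q)

variable {nabla : CovariantDerivative I E (TangentSpace I : M → Type _)}
  {X Y Z W : Π p : M, TangentSpace I p}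

theorem nabla_add (hX : IsSmoothField X) (hY : IsSmoothField Y) (p : M) :
    nabla (X + Y) p = nabla X p + nabla Y p :=
  nabla.isCovariantDerivativeOnUniv.add (hX.differentiableAt p) (hY.differentiableAt p)

theorem nabla_neg (hX : IsSmoothField X) (p : M) : nabla (-X) p = -nabla X p := by
  have h := nabla_add (nabla := nabla) hX hX.neg p
  rw [add_neg_cancel, CovariantDerivative.zero] at h
  exact eq_neg_of_add_eq_zero_right h.symm

theorem nabla_sub (hX : IsSmoothField X) (hY : IsSmoothField Y) (p : M) :
    nabla (X - Y) p = nabla X p - nabla Y p := by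
  rw [sub_eq_add_neg, nabla_add hX hY.neg, nabla_neg hY, sub_eq_add_neg]

theorem nabla_smul {f : M → ℝ} (hf : ContMDiff I 𝓘(ℝ, ℝ) ∞ f) (hX : IsSmoothField X) (p : M)
    (v : TangentSpace I p) :
    nabla (f • X) p v = f p • nabla X p v + mvfderiv I f p v • X p := by
  have h := nabla.isCovariantDerivativeOnUniv.leibniz (hX.differentiableAt p)
    ((hf p).mdifferentiableAt (by simp))
  rw [h]
  rfl

/-- The curvature tensor at a point can be computed with global smooth vector fields that agree
near the point with the local extensions. -/
theorem curvatureAt_eq_of_eventuallyEq (hn : IsSmoothConnection nabla) {p : M}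
    {x y z : TangentSpace I p} (hX : IsSmoothField X) (hY : IsSmoothField Y) (hZ : IsSmoothField Z)
    (hXx : ∀ᶠ q in 𝓝 p, X q = FiberBundle.extend E x q)
    (hYy : ∀ᶠ q in 𝓝 p, Y q = FiberBundle.extend E y q)
    (hZz : ∀ᶠ q in 𝓝 p, Z q = FiberBundle.extend E z q) :
    curvatureAt nabla p x y z = curvature nabla X Y Z p := by
  have := FiniteDimensional.complete ℝ E
  have hXp : X p = x := by rw [hXx.self_of_nhds, FiberBundle.extend_apply_self]
  have hYp : Y p = y := by rw [hYy.self_of_nhds, FiberBundle.extend_apply_self]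
  -- `∇` only depends on germs, for fields differentiable at the point
  have congr_nabla : ∀ {A B : Π q : M, TangentSpace I q} {q : M}, IsSmoothField A →
      (∀ᶠ r in 𝓝 q, A r = B r) → nabla B q = nabla A q := by
    intro A B q hA hAB
    have hB : DifferentiableFieldAt B q := by
      refine (hA.differentiableAt q).congr_of_eventuallyEq ?_
      filter_upwards [hAB] with r hr
      rw [hr]
    exact (nabla.isCovariantDerivativeOnUniv.congr_of_eventuallyEq (hA.differentiableAt q) hB
      Filter.univ_mem hAB).symm
  have h2 : ∀ {A : Π q : M, TangentSpace I q} {a : TangentSpace I p}, IsSmoothField A →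
      (∀ᶠ q in 𝓝 p, A q = FiberBundle.extend E a q) →
      nabla (fun q => nabla (FiberBundle.extend E z) q (FiberBundle.extend E a q)) p
        = nabla (fun q => nabla Z q (A q)) p := by
    intro A a hA hAa
    refine congr_nabla (hn A Z hA hZ) ?_
    filter_upwards [hAa, hZz.eventually_nhds] with q hq hq'
    rw [← hq, congr_nabla hZ hq']
  have hbr : mlieBracket I (FiberBundle.extend E x) (FiberBundle.extend E y) p
      = mlieBracket I X Y p :=
    Filter.EventuallyEq.mlieBracket_vectorField_eq
      (hXx.mono fun _ h => h.symm) (hYy.mono fun _ h => h.symm)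
  unfold curvatureAt curvature
  rw [h2 hX hXx, h2 hY hYy, hbr, congr_nabla hZ hZz, FiberBundle.extend_apply_self,
    FiberBundle.extend_apply_self, hXp, hYp]

end Curvature

/-! ### The Levi-Civita connection -/

section LeviCivita

variable {E : Type*} [NormedAddCommGroup E] [NormedSpace ℝ E] [FiniteDimensional ℝ E]
  {H : Type*} [TopologicalSpace H] {I : ModelWithCorners ℝ E H}
  {M : Type*} [TopologicalSpace M] [ChartedSpace H M] [IsManifold I ∞ M]
  [RiemannianBundle (fun p : M => TangentSpace I p)]
  [IsContMDiffRiemannianBundle I ∞ E (fun p : M => TangentSpace I p)]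
  {nabla : CovariantDerivative I E (TangentSpace I : M → Type _)}
  {X Y Z W : Π p : M, TangentSpace I p}

theorem IsSmoothField.inner (hX : IsSmoothField X) (hY : IsSmoothField Y) :
    ContMDiff I 𝓘(ℝ, ℝ) ∞ fun q => (inner ℝ (X q) (Y q) : ℝ) :=
  ContMDiff.inner_bundle hX hY

namespace IsLeviCivita

theorem isSmoothConnection (h : IsLeviCivita nabla) : IsSmoothConnection nabla := by
  intro X Y hX hY
  have h1 := h.smooth.contMDiff.contMDiff (σ := Y) (hY.contMDiffOn)
  rw [contMDiffOn_univ] at h1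
  exact ContMDiff.clm_bundle_apply h1 hX

theorem mvfderiv_inner (h : IsLeviCivita nabla) (hX : IsSmoothField X) (hY : IsSmoothField Y)
    (p : M) (v : TangentSpace I p) :
    mvfderiv I (fun q => (inner ℝ (X q) (Y q) : ℝ)) p v
      = (inner ℝ (nabla X p v) (Y p) + inner ℝ (X p) (nabla Y p v) : ℝ) :=
  h.metric p X Y (hX.differentiableAt p) (hY.differentiableAt p) v

theorem mlieBracket_eq (h : IsLeviCivita nabla) (hX : IsSmoothField X) (hY : IsSmoothField Y)
    (p : M) : mlieBracket I X Y p = nabla Y p (X p) - nabla X p (Y p) :=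
  have := FiniteDimensional.complete ℝ E
  (((CovariantDerivative.torsion_eq_zero_iff nabla).1 h.torsion_free)
    (hX.differentiableAt p) (hY.differentiableAt p)).symm

theorem contMDiff_mvfderiv_inner (h : IsLeviCivita nabla) (hX : IsSmoothField X)
    (hY : IsSmoothField Y) (hZ : IsSmoothField Z) :
    ContMDiff I 𝓘(ℝ, ℝ) ∞ fun p => mvfderiv I (fun q => (inner ℝ (X q) (Y q) : ℝ)) p (Z p) := by
  have h1 := (h.isSmoothConnection Z X hZ hX).inner hY
  have h2 := hX.inner (h.isSmoothConnection Z Y hZ hY)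
  refine (h1.add h2).congr fun p => ?_
  exact h.mvfderiv_inner hX hY p (Z p)

theorem curvature_swap (X Y Z : Π p : M, TangentSpace I p) (p : M) :
    curvature nabla X Y Z p = -curvature nabla Y X Z p := by
  simp only [curvature, mlieBracket_swap_apply (V := X) (W := Y), map_neg]
  abel

/-- The curvature of a metric connection is skew-symmetric in the last pair of arguments. -/
theorem inner_curvature_skew [T2Space M] (h : IsLeviCivita nabla) (hX : IsSmoothField X)
    (hY : IsSmoothField Y) (hZ : IsSmoothField Z) (hW : IsSmoothField W) (p : M) :
    (inner ℝ (curvature nabla X Y Z p) (W p) : ℝ)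
      = -inner ℝ (curvature nabla X Y W p) (Z p) := by
  have key := mvfderiv_mlieBracket (hZ.inner hW) hX hY
    (h.contMDiff_mvfderiv_inner hZ hW hX) (h.contMDiff_mvfderiv_inner hZ hW hY) p
  have D : ∀ {V U : Π q : M, TangentSpace I q}, IsSmoothField V → IsSmoothField U →
      mvfderiv I (fun q => mvfderiv I (fun q => (inner ℝ (Z q) (W q) : ℝ)) q (U q)) p (V p)
      = (inner ℝ (nabla (fun q => nabla Z q (U q)) p (V p)) (W p)
          + inner ℝ (nabla Z p (U p)) (nabla W p (V p)))
        + (inner ℝ (nabla Z p (V p)) (nabla W p (U p))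
          + inner ℝ (Z p) (nabla (fun q => nabla W q (U q)) p (V p)) : ℝ) := by
    intro V U hV hU
    have hZU := h.isSmoothConnection U Z hU hZ
    have hWU := h.isSmoothConnection U W hU hW
    rw [← h.mvfderiv_inner hZU hW, ← h.mvfderiv_inner hZ hWU]
    have e : (fun q => mvfderiv I (fun q => (inner ℝ (Z q) (W q) : ℝ)) q (U q))
        = fun q => (inner ℝ (nabla Z q (U q)) (W q) + inner ℝ (Z q) (nabla W q (U q)) : ℝ) :=
      funext fun q => h.mvfderiv_inner hZ hW q (U q)
    have h1 := mvfderiv_add (x := p) (((hZU.inner hW) p).mdifferentiableAt (by simp))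
      (((hZ.inner hWU) p).mdifferentiableAt (by simp))
    rw [e]
    exact congr($h1 (V p))
  rw [D hX hY, D hY hX, h.mvfderiv_inner hZ hW] at key
  rw [real_inner_comm (Z p)]
  simp only [curvature, inner_sub_left, inner_sub_right]
  linarith

/-- The first Bianchi identity. -/
theorem curvature_bianchi (h : IsLeviCivita nabla) (hX : IsSmoothField X)
    (hY : IsSmoothField Y) (hZ : IsSmoothField Z) (p : M) :
    curvature nabla X Y Z p + curvature nabla Y Z X p + curvature nabla Z X Y p = 0 := by
  have := FiniteDimensional.complete ℝ E
  have : IsManifold I (minSmoothness ℝ 3) M := by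
    rw [minSmoothness_of_isRCLikeNormedField]; infer_instance
  have h2 : minSmoothness ℝ 2 ≤ (∞ : ℕ∞ω) := by
    rw [minSmoothness_of_isRCLikeNormedField]
    exact WithTop.coe_le_coe.2 le_top
  have hle : ∀ {V : Π q : M, TangentSpace I q}, IsSmoothField V →
      ContMDiffAt I I.tangent (minSmoothness ℝ 2) (fun q => (⟨q, V q⟩ : TangentBundle I M)) p :=
    fun hV => (hV p).of_le h2
  have J := leibniz_identity_mlieBracket_apply (hle hX) (hle hY) (hle hZ)
  have D : ∀ {U V W : Π q : M, TangentSpace I q}, IsSmoothField U → IsSmoothField V →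
      IsSmoothField W → mlieBracket I U (mlieBracket I V W) p
        = nabla (fun q => nabla W q (V q)) p (U p) - nabla (fun q => nabla V q (W q)) p (U p)
          - nabla U p (mlieBracket I V W p) := by
    intro U V W hU hV hW
    have e : mlieBracket I V W = (fun q => nabla W q (V q)) - fun q => nabla V q (W q) :=
      funext fun q => h.mlieBracket_eq hV hW q
    rw [h.mlieBracket_eq hU (hV.mlieBracket hW) p]
    congr 1
    rw [e, nabla_sub (h.isSmoothConnection V W hV hW) (h.isSmoothConnection W V hW hV)]
    rfl
  rw [mlieBracket_swap_apply (V := mlieBracket I X Y), D hX hY hZ, D hZ hX hY, D hY hX hZ] at J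
  have hXZ : mlieBracket I X Z p = -mlieBracket I Z X p := mlieBracket_swap_apply
  rw [hXZ, map_neg] at J
  rw [← sub_eq_zero] at J
  rw [← J]
  simp only [curvature]
  abel

end IsLeviCivita

end LeviCivita

/-! ### Algebraic curvature tensors -/

section AlgebraicCurvature

variable {V : Type*} [NormedAddCommGroup V] [InnerProductSpace ℝ V]

/-- The symmetries of a Riemannian curvature tensor `R(x, y)z`. Linearity follows from them. -/
structure IsAlgebraicCurvature (R : V → V → V → V) : Prop where
  swap : ∀ x y z, R x y z = -R y x z
  skew : ∀ x y z w, (inner ℝ (R x y z) w : ℝ) = -inner ℝ (R x y w) z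
  bianchi : ∀ x y z, R x y z + R y z x + R z x y = 0

/-- A function of four variables with the symmetries of a curvature tensor is invariant under the
exchange of the two pairs of arguments. -/
theorem pair_symm_of_symmetries {α : Type*} {r : α → α → α → α → ℝ}
    (h1 : ∀ x y z w, r x y z w = -r y x z w) (h2 : ∀ x y z w, r x y z w = -r x y w z)
    (h3 : ∀ x y z w, r x y z w + r y z x w + r z x y w = 0) (x y z w : α) :
    r x y z w = r z w x y := by
  have a1 := h3 x y z w
  have a2 := h3 y z w x
  have a3 := h3 z w x y
  have a4 := h3 w x y z
  linarith [h1 x y z w, h1 y z x w, h1 z x y w, h1 y z w x, h1 z w y x, h1 w y z x,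
    h1 z w x y, h1 w x z y, h1 x z w y, h1 w x y z, h1 x y w z, h1 y w x z,
    h2 x y z w, h2 y z x w, h2 z x y w, h2 y z w x, h2 z w y x, h2 w y z x,
    h2 z w x y, h2 w x z y, h2 x z w y, h2 w x y z, h2 x y w z, h2 y w x z]

namespace IsAlgebraicCurvature

variable {R : V → V → V → V}

theorem pair_symm (h : IsAlgebraicCurvature R) (x y z w : V) :
    (inner ℝ (R x y z) w : ℝ) = inner ℝ (R z w x) y :=
  pair_symm_of_symmetries (r := fun x y z w => (inner ℝ (R x y z) w : ℝ))
    (fun x y z w => by rw [h.swap x y, inner_neg_left]) h.skew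
    (fun x y z w => by rw [← inner_add_left, ← inner_add_left, h.bianchi, inner_zero_left]) x y z w

theorem add_right (h : IsAlgebraicCurvature R) (x y z z' : V) :
    R x y (z + z') = R x y z + R x y z' := by
  refine ext_inner_right ℝ fun w => ?_
  rw [h.skew, inner_add_right, inner_add_left, h.skew x y z, h.skew x y z']
  ring

theorem smul_right (h : IsAlgebraicCurvature R) (a : ℝ) (x y z : V) :
    R x y (a • z) = a • R x y z := by
  refine ext_inner_right ℝ fun w => ?_
  rw [h.skew, real_inner_smul_right, real_inner_smul_left, h.skew x y z]
  ring

theorem sub {R' : V → V → V → V} (h : IsAlgebraicCurvature R) (h' : IsAlgebraicCurvature R') :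
    IsAlgebraicCurvature fun x y z => R x y z - R' x y z where
  swap x y z := by rw [h.swap, h'.swap]; abel
  skew x y z w := by rw [inner_sub_left, inner_sub_left, h.skew, h'.skew]; ring
  bianchi x y z := by
    have := congr($(h.bianchi x y z) - $(h'.bianchi x y z))
    rw [sub_zero] at this
    rw [← this]
    abel

/-- The curvature operator `R(x, y)` as a linear map. -/
def toLinearMap (h : IsAlgebraicCurvature R) (x y : V) : V →ₗ[ℝ] V where
  toFun := R x y
  map_add' := h.add_right x y
  map_smul' a z := h.smul_right a x y z

end IsAlgebraicCurvature

/-- The curvature tensor of the unit sphere. -/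
def sphereCurvature (x y z : V) : V := (inner ℝ y z : ℝ) • x - (inner ℝ x z : ℝ) • y

theorem isAlgebraicCurvature_sphereCurvature :
    IsAlgebraicCurvature (sphereCurvature : V → V → V → V) where
  swap x y z := by simp [sphereCurvature]
  skew x y z w := by
    simp only [sphereCurvature, inner_sub_left, real_inner_smul_left]
    ring
  bianchi x y z := by
    simp only [sphereCurvature, real_inner_comm x y, real_inner_comm x z, real_inner_comm y z]
    abel

end AlgebraicCurvature

/-! ### The quaternionic relations of a 3-Sasakian structure -/

section Quaternionic

variable {V : Type*} [NormedAddCommGroup V] [InnerProductSpace ℝ V]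

/-- The algebraic relations between the Reeb vectors `ξ i` and the endomorphisms `φ i` of a
3-Sasakian structure at a point. -/
structure QuaternionicRelations (ξ : Fin 3 → V) (φ : Fin 3 → V →L[ℝ] V) : Prop where
  orthonormal : Orthonormal ℝ ξ
  skew : ∀ i v w, (inner ℝ (φ i v) w : ℝ) = -inner ℝ v (φ i w)
  sq : ∀ i v, φ i (φ i v) = -v + (inner ℝ (ξ i) v : ℝ) • ξ i
  mul : ∀ i v, φ (i + 1) (φ i v) = -φ (i + 2) v + (inner ℝ (ξ i) v : ℝ) • ξ (i + 1)

namespace QuaternionicRelations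

variable {ξ : Fin 3 → V} {φ : Fin 3 → V →L[ℝ] V} (h : QuaternionicRelations ξ φ)

include h

theorem inner_reeb (i j : Fin 3) : (inner ℝ (ξ i) (ξ j) : ℝ) = if i = j then 1 else 0 :=
  orthonormal_iff_ite.1 h.orthonormal i j

theorem apply_reeb_self (i : Fin 3) : φ i (ξ i) = 0 := by
  have h1 := h.skew i (ξ i) (φ i (ξ i))
  rw [h.sq, h.inner_reeb, if_pos rfl, one_smul, neg_add_cancel, inner_zero_right, neg_zero] at h1
  exact inner_self_eq_zero.1 h1

theorem apply_reeb_succ (i : Fin 3) : φ i (ξ (i + 1)) = ξ (i + 2) := by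
  have h1 := h.mul (i + 1) (ξ (i + 1))
  rw [h.apply_reeb_self, map_zero, h.inner_reeb, if_pos rfl, one_smul, add_assoc, add_assoc] at h1
  have e : (1 + 2 : Fin 3) = 0 := rfl
  have e' : (1 + 1 : Fin 3) = 2 := rfl
  rw [e, e', add_zero] at h1
  exact (neg_add_eq_zero.1 h1.symm)

theorem apply_reeb_pred (i : Fin 3) : φ i (ξ (i + 2)) = -ξ (i + 1) := by
  rw [← h.apply_reeb_succ, h.sq, h.inner_reeb]
  have : i ≠ i + 1 := by revert i; decide
  rw [if_neg this, zero_smul, add_zero]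

theorem mul' (i : Fin 3) (v : V) :
    φ i (φ (i + 1) v) = φ (i + 2) v + (inner ℝ (ξ (i + 1)) v : ℝ) • ξ i := by
  refine ext_inner_right ℝ fun w => ?_
  rw [h.skew, h.skew, h.mul, inner_add_left, inner_add_right, inner_neg_right, h.skew (i + 2),
    real_inner_smul_left, real_inner_smul_right, real_inner_comm v]
  ring

theorem inner_reeb_apply (i j : Fin 3) (v : V) :
    (inner ℝ (ξ j) (φ i v) : ℝ) = -inner ℝ (φ i (ξ j)) v := by
  rw [h.skew, neg_neg]

end QuaternionicRelations

/-- An operator `S` with horizontal values that commutes with every `φ i` satisfies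
`tr (φ i ∘ S) = 0`, since `φ (i + 2) ∘ S` is both `φ i ∘ (φ (i + 1) ∘ S)` and
`-(φ (i + 1) ∘ S) ∘ φ i`. -/
theorem QuaternionicRelations.trace_comp_eq_zero [FiniteDimensional ℝ V] {ξ : Fin 3 → V}
    {φ : Fin 3 → V →L[ℝ] V} (h : QuaternionicRelations ξ φ) (S : V →ₗ[ℝ] V)
    (hξ : ∀ i v, (inner ℝ (ξ i) (S v) : ℝ) = 0) (hS : ∀ i v, S (φ i v) = φ i (S v)) (i : Fin 3) :
    LinearMap.trace ℝ V ((φ i : V →ₗ[ℝ] V) ∘ₗ S) = 0 := by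
  obtain ⟨j, rfl⟩ : ∃ j : Fin 3, i = j + 2 := ⟨i + 1, by revert i; decide⟩
  have h1 : (φ (j + 2) : V →ₗ[ℝ] V) ∘ₗ S = (φ j : V →ₗ[ℝ] V) ∘ₗ ((φ (j + 1) : V →ₗ[ℝ] V) ∘ₗ S) := by
    ext v
    simp [h.mul', hξ]
  have h2 : (φ (j + 2) : V →ₗ[ℝ] V) ∘ₗ S
      = -(((φ (j + 1) : V →ₗ[ℝ] V) ∘ₗ S) ∘ₗ (φ j : V →ₗ[ℝ] V)) := by
    ext v
    simp [hS, h.mul, hξ]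
  have h3 := congrArg (LinearMap.trace ℝ V) h2
  have h4 := LinearMap.trace_comp_comm' ((φ (j + 1) : V →ₗ[ℝ] V) ∘ₗ S) (φ j : V →ₗ[ℝ] V)
  rw [map_neg, ← h4, ← h1] at h3
  linarith

/-- An algebraic curvature tensor that kills the Reeb vectors and commutes with every `φ i` is
Ricci-flat. This is the algebraic form of the Ricci-flatness of hyperkähler metrics. -/
theorem QuaternionicRelations.ricci_eq_zero [FiniteDimensional ℝ V] {ξ : Fin 3 → V}
    {φ : Fin 3 → V →L[ℝ] V} (h : QuaternionicRelations ξ φ) {R : V → V → V → V}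
    (hR : IsAlgebraicCurvature R) (hξ : ∀ i x y, R x y (ξ i) = 0)
    (hφ : ∀ i x y z, R x y (φ i z) = φ i (R x y z)) {ι : Type*} [Fintype ι]
    (e : OrthonormalBasis ι ℝ V) (y z : V) : ∑ i, (inner ℝ (R (e i) y z) (e i) : ℝ) = 0 := by
  set ric : V → V → ℝ := fun y z => ∑ i, inner ℝ (R (e i) y z) (e i) with hric
  have symm : ∀ y z, ric y z = ric z y := fun y z =>
    Finset.sum_congr rfl fun i _ => by
      rw [hR.pair_symm, hR.swap, inner_neg_left, hR.skew, neg_neg]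
  have add : ∀ y z z', ric y (z + z') = ric y z + ric y z' := fun y z z' => by
    simp only [hric, hR.add_right, inner_add_left, Finset.sum_add_distrib]
  have smul : ∀ (a : ℝ) y z, ric y (a • z) = a * ric y z := fun a y z => by
    simp only [hric, hR.smul_right, real_inner_smul_left, Finset.mul_sum]
  have reeb : ∀ j y, ric y (ξ j) = 0 := fun j y => by simp [hric, hξ]
  -- the Bianchi identity contracted with `φ j`
  have comm : ∀ j y z, ric y (φ j z) = ric (φ j y) z := by
    intro j y z
    have t : ∑ i, (inner ℝ (R y z (e i)) (φ j (e i)) : ℝ) = 0 := by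
      have := h.trace_comp_eq_zero (hR.toLinearMap y z)
        (fun i v => by
          rw [real_inner_comm]
          change inner ℝ (R y z v) (ξ i) = _
          rw [hR.skew, hξ, inner_zero_left, neg_zero])
        (fun i v => hφ i y z v) j
      rw [LinearMap.trace_eq_sum_inner _ e] at this
      rw [← neg_eq_zero, ← this, ← Finset.sum_neg_distrib]
      refine Finset.sum_congr rfl fun i _ => ?_
      rw [← h.skew, real_inner_comm]
      rfl
    rw [symm (φ j y)]
    have b : ∀ i, (inner ℝ (R y z (e i)) (φ j (e i)) : ℝ) + inner ℝ (R (e i) z (φ j y)) (e i)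
        - inner ℝ (R (e i) y (φ j z)) (e i) = 0 := by
      intro i
      have := congr(inner ℝ $(hR.bianchi y z (e i)) (φ j (e i)))
      rw [inner_add_left, inner_add_left, inner_zero_left, hR.swap z (e i), inner_neg_left] at this
      rw [hφ, hφ, h.skew, h.skew]
      linarith
    have s := Finset.sum_congr rfl (fun i (_ : i ∈ Finset.univ) => b i)
    rw [Finset.sum_sub_distrib, Finset.sum_add_distrib, t, Finset.sum_const_zero] at s
    simp only [hric]
    linarith
  have zero : ∀ y z, ric y (φ 2 z) = 0 := by
    intro y z
    have h1 : ric y (φ 0 (φ 1 z)) = ric y (φ 2 z) := by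
      have := h.mul' 0 z
      simp only [zero_add] at this
      rw [this, add, smul, reeb, mul_zero, add_zero]
    have h2 : ric z (φ 1 (φ 0 y)) = -ric z (φ 2 y) := by
      have := h.mul 0 y
      simp only [zero_add] at this
      rw [this, add, smul, reeb, mul_zero, add_zero, ← neg_one_smul ℝ, smul]
      ring
    rw [comm, comm, symm, h2, symm, ← comm] at h1
    linarith
  have := h.sq 2 z
  have : z = (-1 : ℝ) • φ 2 (φ 2 z) + (inner ℝ (ξ 2) z : ℝ) • ξ 2 := by
    rw [this]; module
  change ric y z = 0
  rw [this, add, smul, smul, zero, reeb]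
  ring

/-- The curvature identities of a 3-Sasakian structure force the Ricci tensor to be that of the
unit sphere. -/
theorem QuaternionicRelations.ricci_eq [FiniteDimensional ℝ V] {ξ : Fin 3 → V}
    {φ : Fin 3 → V →L[ℝ] V} (h : QuaternionicRelations ξ φ) {R : V → V → V → V}
    (hR : IsAlgebraicCurvature R) (hξ : ∀ i x y, R x y (ξ i) = sphereCurvature x y (ξ i))
    (hφ : ∀ i x y z, R x y (φ i z) - φ i (R x y z)
      = sphereCurvature x y (φ i z) - φ i (sphereCurvature x y z))
    {ι : Type*} [Fintype ι] (e : OrthonormalBasis ι ℝ V) (y z : V) :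
    ∑ i, (inner ℝ (R (e i) y z) (e i) : ℝ) = (Fintype.card ι - 1) * inner ℝ y z := by
  have h0 := h.ricci_eq_zero (hR.sub isAlgebraicCurvature_sphereCurvature)
    (fun i x y => by rw [hξ, sub_self])
    (fun i x y z => by
      rw [map_sub, sub_eq_sub_iff_add_eq_add, sub_eq_sub_iff_add_eq_add.1 (hφ i x y z),
        add_comm]) e y z
  simp only [inner_sub_left, Finset.sum_sub_distrib] at h0
  rw [sub_eq_zero.1 h0]
  simp only [sphereCurvature, inner_sub_left, real_inner_smul_left, Finset.sum_sub_distrib,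
    real_inner_self_eq_norm_sq, e.norm_eq_one, one_pow, mul_one, Finset.sum_const,
    Finset.card_univ, nsmul_eq_mul]
  have := e.sum_inner_mul_inner y z
  rw [sub_mul, one_mul, ← this]
  congr 1
  exact Finset.sum_congr rfl fun i _ => mul_comm _ _

end Quaternionic

/-! ### The torsion tensor at a point -/

section PointTorsion

variable {V : Type*} [NormedAddCommGroup V] [InnerProductSpace ℝ V]

theorem fin_three_cases : ∀ i : Fin 3, i = 0 ∨ i = 1 ∨ i = 2 := by decide

/-- The orthogonal projection onto the orthogonal complement of the Reeb vectors. -/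
def horizontalProj (ξ : Fin 3 → V) : V →ₗ[ℝ] V :=
  LinearMap.id - ∑ i, (innerₛₗ ℝ (ξ i)).smulRight (ξ i)

theorem horizontalProj_apply (ξ : Fin 3 → V) (v : V) :
    horizontalProj ξ v = v - ∑ i, (inner ℝ (ξ i) v : ℝ) • ξ i := by
  simp [horizontalProj]

/-- A family of skew-symmetric operators `ψ l` which kill the Reeb vectors, commute with every
`φ i` and satisfy `ψ k ∘ ψ l = -c k c l` on the horizontal space. The operators `c l • φ₀` have
these properties, both when `c = 0` and when `φ₀` is a complex structure of the horizontal space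
that commutes with every `φ i`. -/
structure IsCommutingFamily (ξ : Fin 3 → V) (φ ψ : Fin 3 → V →L[ℝ] V) (c : Fin 3 → ℝ) :
    Prop where
  skew : ∀ l v w, (inner ℝ (ψ l v) w : ℝ) = -inner ℝ v (ψ l w)
  reeb : ∀ l i, ψ l (ξ i) = 0
  comm : ∀ l i v, ψ l (φ i v) = φ i (ψ l v)
  mul : ∀ k l v, ψ k (ψ l v) = -(c k * c l) • horizontalProj ξ v

variable {ξ : Fin 3 → V} {φ ψ : Fin 3 → V →L[ℝ] V} {c : Fin 3 → ℝ}

theorem QuaternionicRelations.horizontalProj_reeb (h : QuaternionicRelations ξ φ) (i : Fin 3) :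
    horizontalProj ξ (ξ i) = 0 := by
  simp [horizontalProj_apply, h.inner_reeb]

theorem QuaternionicRelations.inner_reeb_horizontalProj (h : QuaternionicRelations ξ φ)
    (i : Fin 3) (v : V) : (inner ℝ (ξ i) (horizontalProj ξ v) : ℝ) = 0 := by
  simp [horizontalProj_apply, inner_sub_right, inner_sum, real_inner_smul_right, h.inner_reeb]

theorem horizontalProj_eq_self {v : V} (hv : ∀ i, (inner ℝ (ξ i) v : ℝ) = 0) :
    horizontalProj ξ v = v := by
  simp [horizontalProj_apply, hv]

theorem QuaternionicRelations.inner_reeb_apply_eq_zero (h : QuaternionicRelations ξ φ)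
    {v : V} (hv : ∀ i, (inner ℝ (ξ i) v : ℝ) = 0) (i j : Fin 3) :
    (inner ℝ (ξ j) (φ i v) : ℝ) = 0 := by
  rw [h.inner_reeb_apply]
  have hj : j = i ∨ j = i + 1 ∨ j = i + 2 := by revert i j; decide
  rcases hj with rfl | rfl | rfl
  · rw [h.apply_reeb_self, inner_zero_left, neg_zero]
  · rw [h.apply_reeb_succ, hv, neg_zero]
  · rw [h.apply_reeb_pred, inner_neg_left, hv, neg_zero, neg_zero]

theorem QuaternionicRelations.horizontalProj_comm (h : QuaternionicRelations ξ φ) (i : Fin 3)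
    (v : V) : horizontalProj ξ (φ i v) = φ i (horizontalProj ξ v) := by
  have key : ∀ j, (inner ℝ (ξ j) (φ i v) : ℝ) = -inner ℝ (φ i (ξ j)) v :=
    fun j => h.inner_reeb_apply i j v
  simp only [horizontalProj_apply, map_sub, map_sum, map_smul, key]
  congr 1
  have e : ∀ f : Fin 3 → V, ∑ j, f j = f i + f (i + 1) + f (i + 2) := by
    intro f
    rw [Fin.sum_univ_three]
    have hi := fin_three_cases i
    rcases hi with rfl | rfl | rfl
    · rfl
    · change f 0 + f 1 + f 2 = f 1 + f 2 + f 0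
      abel
    · change f 0 + f 1 + f 2 = f 2 + f 0 + f 1
      abel
  rw [e, e, h.apply_reeb_self, h.apply_reeb_succ, h.apply_reeb_pred]
  simp [add_comm]

/-- The trace of `φ s ∘ φ t` on the horizontal space. -/
theorem QuaternionicRelations.trace_comp [FiniteDimensional ℝ V] (h : QuaternionicRelations ξ φ)
    (s t : Fin 3) :
    LinearMap.trace ℝ V ((φ s : V →ₗ[ℝ] V) ∘ₗ (φ t : V →ₗ[ℝ] V) ∘ₗ horizontalProj ξ)
      = if s = t then -LinearMap.trace ℝ V (horizontalProj ξ) else 0 := by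
  have hz : ∀ i, LinearMap.trace ℝ V ((φ i : V →ₗ[ℝ] V) ∘ₗ horizontalProj ξ) = 0 := fun i =>
    h.trace_comp_eq_zero _ (fun i v => h.inner_reeb_horizontalProj i v)
      (fun i v => h.horizontalProj_comm i v) i
  have ht : t = s ∨ t = s + 1 ∨ s = t + 1 := by revert s t; decide
  rcases ht with rfl | rfl | rfl
  · rw [if_pos rfl, ← map_neg]
    congr 1
    ext v
    simp [h.sq, h.inner_reeb_horizontalProj]
  · rw [if_neg (by revert s; decide), ← hz (s + 2)]
    congr 1
    ext v
    simp [h.mul', h.inner_reeb_horizontalProj]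
  · rw [if_neg (by revert t; decide), ← neg_eq_zero, ← hz (t + 2), ← map_neg]
    congr 1
    ext v
    simp [h.mul, h.inner_reeb_horizontalProj]

theorem QuaternionicRelations.trace_horizontalProj [FiniteDimensional ℝ V]
    (h : QuaternionicRelations ξ φ) :
    LinearMap.trace ℝ V (horizontalProj ξ) = finrank ℝ V - 3 := by
  have : ∀ i, LinearMap.trace ℝ V ((innerₛₗ ℝ (ξ i)).smulRight (ξ i)) = 1 := fun i => by
    rw [LinearMap.trace_smulRight]
    simpa using h.inner_reeb i i
  rw [horizontalProj, map_sub, map_sum, LinearMap.trace_id]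
  simp [this]

namespace IsCommutingFamily

theorem horizontal (hψ : IsCommutingFamily ξ φ ψ c) (l i : Fin 3) (v : V) :
    (inner ℝ (ξ i) (ψ l v) : ℝ) = 0 := by
  rw [← neg_eq_zero, ← hψ.skew, hψ.reeb, inner_zero_left]

theorem apply_horizontalProj (hψ : IsCommutingFamily ξ φ ψ c) (l : Fin 3) (v : V) :
    ψ l (horizontalProj ξ v) = ψ l v := by
  simp [horizontalProj_apply, hψ.reeb]

theorem trace_comp_eq_zero [FiniteDimensional ℝ V] (h : QuaternionicRelations ξ φ)
    (hψ : IsCommutingFamily ξ φ ψ c) (s l : Fin 3) :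
    LinearMap.trace ℝ V ((φ s : V →ₗ[ℝ] V) ∘ₗ (ψ l : V →ₗ[ℝ] V)) = 0 :=
  h.trace_comp_eq_zero _ (fun i v => hψ.horizontal l i v) (fun i v => hψ.comm l i v) s

end IsCommutingFamily

/-- The operator `ω r = ∑ s, b r s φ s + ψ r` with which the torsion 3-form is
`a η₁ ∧ η₂ ∧ η₃ + ∑ r, η r ∧ g(·, ω r ·)`. -/
def mixedEndo (φ ψ : Fin 3 → V →L[ℝ] V) (B : Matrix (Fin 3) (Fin 3) ℝ) (r : Fin 3) : V →L[ℝ] V :=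
  ∑ s, B r s • φ s + ψ r

theorem mixedEndo_apply (φ ψ : Fin 3 → V →L[ℝ] V) (B : Matrix (Fin 3) (Fin 3) ℝ) (r : Fin 3)
    (v : V) : mixedEndo φ ψ B r v = ∑ s, B r s • φ s v + ψ r v := by
  simp [mixedEndo]

/-- The tensor `T` is metrically equivalent to `a η₁ ∧ η₂ ∧ η₃ + ∑ r, η r ∧ g(·, ω r ·)`. -/
def IsTorsionOf (T : V →L[ℝ] V →L[ℝ] V) (ξ : Fin 3 → V) (φ ψ : Fin 3 → V →L[ℝ] V) (a : ℝ)
    (B : Matrix (Fin 3) (Fin 3) ℝ) : Prop :=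
  ∀ X Y Z, (inner ℝ (T X Y) Z : ℝ)
    = a * verticalForm ξ X Y Z + ∑ r, wedgeForm (ξ r) (mixedEndo φ ψ B r) X Y Z

variable {T : V →L[ℝ] V →L[ℝ] V} {a : ℝ} {B : Matrix (Fin 3) (Fin 3) ℝ}

theorem mixedEndo_skew (h : QuaternionicRelations ξ φ) (hψ : IsCommutingFamily ξ φ ψ c)
    (r : Fin 3) (v w : V) :
    (inner ℝ (mixedEndo φ ψ B r v) w : ℝ) = -inner ℝ v (mixedEndo φ ψ B r w) := by
  simp only [mixedEndo_apply, inner_add_left, inner_add_right, sum_inner, inner_sum,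
    real_inner_smul_left, real_inner_smul_right, h.skew, hψ.skew, neg_add, mul_neg,
    Finset.sum_neg_distrib]

theorem mixedEndo_horizontal (h : QuaternionicRelations ξ φ) (hψ : IsCommutingFamily ξ φ ψ c)
    {v : V} (hv : ∀ i, (inner ℝ (ξ i) v : ℝ) = 0) (r i : Fin 3) :
    (inner ℝ (ξ i) (mixedEndo φ ψ B r v) : ℝ) = 0 := by
  simp [mixedEndo_apply, inner_add_right, inner_sum, real_inner_smul_right,
    h.inner_reeb_apply_eq_zero hv, hψ.horizontal]

namespace IsTorsionOf

theorem skew_left (h : QuaternionicRelations ξ φ) (hψ : IsCommutingFamily ξ φ ψ c)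
    (hT : IsTorsionOf T ξ φ ψ a B) (X Y : V) : T X Y = -T Y X := by
  refine ext_inner_right ℝ fun Z => ?_
  have hω : ∀ r v w, (inner ℝ v (mixedEndo φ ψ B r w) : ℝ) = -inner ℝ w (mixedEndo φ ψ B r v) :=
    fun r v w => by rw [real_inner_comm, mixedEndo_skew h hψ]
  rw [inner_neg_left, hT, hT, neg_add, ← Finset.sum_neg_distrib]
  congr 1
  · simp only [verticalForm, Matrix.det_fin_three, Matrix.of_apply, Matrix.cons_val]
    ring
  · refine Finset.sum_congr rfl fun r _ => ?_
    rw [wedgeForm, wedgeForm, hω r Y Z, hω r Z X, hω r X Y]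
    ring

theorem skew_right (h : QuaternionicRelations ξ φ) (hψ : IsCommutingFamily ξ φ ψ c)
    (hT : IsTorsionOf T ξ φ ψ a B) (X Y Z : V) :
    (inner ℝ (T X Y) Z : ℝ) = -inner ℝ (T X Z) Y := by
  have hω : ∀ r v w, (inner ℝ v (mixedEndo φ ψ B r w) : ℝ) = -inner ℝ w (mixedEndo φ ψ B r v) :=
    fun r v w => by rw [real_inner_comm, mixedEndo_skew h hψ]
  rw [hT, hT, neg_add, ← Finset.sum_neg_distrib]
  congr 1
  · simp only [verticalForm, Matrix.det_fin_three, Matrix.of_apply, Matrix.cons_val]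
    ring
  · refine Finset.sum_congr rfl fun r _ => ?_
    rw [wedgeForm, wedgeForm, hω r Y Z, hω r Z X, hω r X Y]
    ring

theorem apply_horizontal (h : QuaternionicRelations ξ φ) (hψ : IsCommutingFamily ξ φ ψ c)
    (hT : IsTorsionOf T ξ φ ψ a B) {X : V} (hX : ∀ i, (inner ℝ (ξ i) X : ℝ) = 0) (Y : V) :
    T X Y = ∑ r, (inner ℝ (ξ r) Y : ℝ) • mixedEndo φ ψ B r X
      - ∑ r, (inner ℝ (mixedEndo φ ψ B r X) Y : ℝ) • ξ r := by
  refine ext_inner_right ℝ fun Z => ?_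
  rw [hT, inner_sub_left, sum_inner, sum_inner, ← Finset.sum_sub_distrib]
  have : verticalForm ξ X Y Z = 0 := by
    simp [verticalForm, Matrix.det_fin_three, hX]
  rw [this, mul_zero, zero_add]
  refine Finset.sum_congr rfl fun r _ => ?_
  rw [wedgeForm, hX, real_inner_smul_left, real_inner_smul_left, mixedEndo_skew h hψ r X Y,
    real_inner_comm (mixedEndo φ ψ B r X) Z]
  ring

theorem apply_horizontal_reeb (h : QuaternionicRelations ξ φ) (hψ : IsCommutingFamily ξ φ ψ c)
    (hT : IsTorsionOf T ξ φ ψ a B) {X : V} (hX : ∀ i, (inner ℝ (ξ i) X : ℝ) = 0) (i : Fin 3) :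
    T X (ξ i) = mixedEndo φ ψ B i X := by
  rw [hT.apply_horizontal h hψ hX]
  simp [h.inner_reeb, real_inner_comm (ξ i), mixedEndo_horizontal h hψ hX]

theorem apply_reeb (h : QuaternionicRelations ξ φ) (hψ : IsCommutingFamily ξ φ ψ c)
    (hT : IsTorsionOf T ξ φ ψ a B) (i : Fin 3) (Y : V) :
    T (ξ i) Y = (a - B.trace) • ((inner ℝ (ξ (i + 1)) Y : ℝ) • ξ (i + 2)
        - (inner ℝ (ξ (i + 2)) Y : ℝ) • ξ (i + 1))
      - mixedEndo φ ψ B i (horizontalProj ξ Y) := by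
  refine ext_inner_right ℝ fun Z => ?_
  have t01 : φ 0 (ξ 1) = ξ 2 := h.apply_reeb_succ 0
  have t12 : φ 1 (ξ 2) = ξ 0 := h.apply_reeb_succ 1
  have t20 : φ 2 (ξ 0) = ξ 1 := h.apply_reeb_succ 2
  have t02 : φ 0 (ξ 2) = -ξ 1 := h.apply_reeb_pred 0
  have t10 : φ 1 (ξ 0) = -ξ 2 := h.apply_reeb_pred 1
  have t21 : φ 2 (ξ 1) = -ξ 0 := h.apply_reeb_pred 2
  have t00 := h.apply_reeb_self 0
  have t11 := h.apply_reeb_self 1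
  have t22 := h.apply_reeb_self 2
  have e : ∀ r v, (inner ℝ (ξ i) (mixedEndo φ ψ B r v) : ℝ)
      = -inner ℝ (mixedEndo φ ψ B r (ξ i)) v := fun r v => by
    rw [mixedEndo_skew h hψ, neg_neg]
  have e' : (inner ℝ Y (mixedEndo φ ψ B i Z) : ℝ) = -inner ℝ (mixedEndo φ ψ B i Y) Z := by
    rw [mixedEndo_skew h hψ, neg_neg]
  have e'' : ∀ r v, (inner ℝ v (mixedEndo φ ψ B r (ξ i)) : ℝ)
      = inner ℝ (mixedEndo φ ψ B r (ξ i)) v := fun r v => real_inner_comm _ _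
  have hs : ∑ r, wedgeForm (ξ r) (mixedEndo φ ψ B r) (ξ i) Y Z
      = -inner ℝ (mixedEndo φ ψ B i Y) Z
        + ∑ r, (inner ℝ (ξ r) Y * inner ℝ (mixedEndo φ ψ B r (ξ i)) Z
          - inner ℝ (ξ r) Z * inner ℝ (mixedEndo φ ψ B r (ξ i)) Y) := by
    simp only [wedgeForm, e, e'', h.inner_reeb, Finset.sum_add_distrib, ite_mul, one_mul, zero_mul,
      Finset.sum_ite_eq', Finset.mem_univ, if_true, e', Finset.sum_sub_distrib, mul_neg,
      Finset.sum_neg_distrib]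
    ring
  rw [hT, hs, horizontalProj_apply]
  simp only [map_sub, inner_sub_left, real_inner_smul_left,
    verticalForm, Matrix.det_fin_three, Matrix.of_apply, Matrix.cons_val, h.inner_reeb,
    Fin.sum_univ_three, Matrix.trace, Matrix.diag_apply]
  have hi := fin_three_cases i
  have f1 : (1 + 1 : Fin 3) = 2 := rfl
  have f2 : (1 + 2 : Fin 3) = 0 := rfl
  have f3 : (2 + 1 : Fin 3) = 0 := rfl
  have f4 : (2 + 2 : Fin 3) = 1 := rfl
  rcases hi with rfl | rfl | rfl <;>
  · simp [mixedEndo_apply, Fin.sum_univ_three, hψ.reeb, t00, t01, t02, t10, t11, t12, t20, t21,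
      t22, inner_add_left, real_inner_smul_left, f1, f2, f3, f4]
    ring

variable {ι : Type*} [Fintype ι]

/-- The sum `∑ⱼ g(T(eⱼ, X), T(eⱼ, Y))` for a horizontal vector `X`. -/
theorem sum_inner_of_horizontal (h : QuaternionicRelations ξ φ) (hψ : IsCommutingFamily ξ φ ψ c)
    (hT : IsTorsionOf T ξ φ ψ a B) {X : V} (hX : ∀ i, (inner ℝ (ξ i) X : ℝ) = 0) (Y : V)
    (e : OrthonormalBasis ι ℝ V) :
    ∑ j, (inner ℝ (T (e j) X) (T (e j) Y) : ℝ)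
      = 2 * ∑ r, inner ℝ (mixedEndo φ ψ B r X) (T Y (ξ r)) := by
  have h1 : ∀ j, (inner ℝ (T (e j) X) (T (e j) Y) : ℝ)
      = ∑ r, (inner ℝ (mixedEndo φ ψ B r X) (e j) * inner ℝ (e j) (T Y (ξ r))
        - inner ℝ (ξ r) (e j) * inner ℝ (e j) (T Y (mixedEndo φ ψ B r X))) := by
    intro j
    have g : ∀ u, (inner ℝ u (T Y (e j)) : ℝ) = -inner ℝ (e j) (T Y u) := fun u => by
      rw [real_inner_comm, hT.skew_right h hψ, real_inner_comm]
    rw [hT.skew_left h hψ _ X, hT.skew_left h hψ _ Y, inner_neg_neg, hT.apply_horizontal h hψ hX,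
      inner_sub_left, sum_inner, sum_inner, ← Finset.sum_sub_distrib]
    refine Finset.sum_congr rfl fun r _ => ?_
    rw [real_inner_smul_left, real_inner_smul_left, g, g]
    ring
  simp only [h1]
  rw [Finset.sum_comm, Finset.mul_sum]
  refine Finset.sum_congr rfl fun r _ => ?_
  rw [Finset.sum_sub_distrib, e.sum_inner_mul_inner, e.sum_inner_mul_inner,
    real_inner_comm (T Y (mixedEndo φ ψ B r X)), hT.skew_right h hψ Y _ (ξ r),
    real_inner_comm (T Y (ξ r))]
  ring

theorem sum_inner_horizontal_reeb (h : QuaternionicRelations ξ φ)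
    (hψ : IsCommutingFamily ξ φ ψ c) (hT : IsTorsionOf T ξ φ ψ a B) {X : V}
    (hX : ∀ i, (inner ℝ (ξ i) X : ℝ) = 0) (i : Fin 3) (e : OrthonormalBasis ι ℝ V) :
    ∑ j, (inner ℝ (T (e j) X) (T (e j) (ξ i)) : ℝ) = 0 := by
  rw [hT.sum_inner_of_horizontal h hψ hX]
  have hω : ∀ r m, (inner ℝ (mixedEndo φ ψ B r X) (ξ m) : ℝ) = 0 := fun r m => by
    rw [real_inner_comm, mixedEndo_horizontal h hψ hX]
  simp [hT.apply_reeb h hψ, h.horizontalProj_reeb, inner_sub_right, real_inner_smul_right, hω]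

/-- For horizontal `X`, `Y` the mixed terms `g(φ s X, φ t Y)`, `s ≠ t`, cancel in pairs, and the terms
in `φ s` and `ψ j` are symmetric. -/
theorem sum_inner_horizontal (h : QuaternionicRelations ξ φ)
    (hψ : IsCommutingFamily ξ φ ψ c) (hT : IsTorsionOf T ξ φ ψ a B) {X Y : V}
    (hX : ∀ i, (inner ℝ (ξ i) X : ℝ) = 0) (hY : ∀ i, (inner ℝ (ξ i) Y : ℝ) = 0)
    (e : OrthonormalBasis ι ℝ V) :
    ∑ j, (inner ℝ (T (e j) X) (T (e j) Y) : ℝ)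
      = 2 * ((∑ r, ∑ s, B r s ^ 2) + ∑ l, c l ^ 2) * inner ℝ X Y
        + 4 * ∑ s, ∑ j, B j s * inner ℝ (ψ j X) (φ s Y) := by
  have hXY : ∀ s, (inner ℝ (φ s X) (φ s Y) : ℝ) = inner ℝ X Y := fun s => by
    rw [h.skew, h.sq, hY, zero_smul, add_zero, inner_neg_right, neg_neg]
  have hst : ∀ s t, s ≠ t → (inner ℝ (φ s X) (φ t Y) : ℝ) = -inner ℝ (φ t X) (φ s Y) := by
    intro s t hne
    have : t = s + 1 ∨ s = t + 1 := by revert s t; decide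
    rcases this with rfl | rfl <;>
    simp [h.skew, h.mul, h.mul', hY]
  have hψψ : ∀ l, (inner ℝ (ψ l X) (ψ l Y) : ℝ) = c l ^ 2 * inner ℝ X Y := fun l => by
    rw [hψ.skew, hψ.mul, horizontalProj_eq_self hY, real_inner_smul_right]
    ring
  have hφψ : ∀ s l, (inner ℝ (φ s X) (ψ l Y) : ℝ) = inner ℝ (ψ l X) (φ s Y) := fun s l => by
    rw [h.skew, hψ.skew, hψ.comm]
  rw [hT.sum_inner_of_horizontal h hψ hX]
  simp only [hT.apply_horizontal_reeb h hψ hY, mixedEndo_apply, inner_add_left, inner_add_right,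
    Fin.sum_univ_three, real_inner_smul_left, real_inner_smul_right, hXY, hψψ, hφψ,
    hst 1 0 (by decide), hst 2 0 (by decide), hst 2 1 (by decide)]
  ring

/-- The vertical part of `T(ξ i, ·)` is `a - tr B` times a cross product, the horizontal part is
`-ω i`. -/
theorem sum_inner_reeb (h : QuaternionicRelations ξ φ)
    (hψ : IsCommutingFamily ξ φ ψ c) (hT : IsTorsionOf T ξ φ ψ a B) (i k : Fin 3)
    (e : OrthonormalBasis ι ℝ V) :
    ∑ j, (inner ℝ (T (e j) (ξ i)) (T (e j) (ξ k)) : ℝ)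
      = 2 * (if i = k then 1 else 0) * (a - B.trace) ^ 2
        + (Fintype.card ι - 3) * (∑ s, B i s * B k s) + (Fintype.card ι - 3) * (c i * c k) := by
  have : FiniteDimensional ℝ V := e.toBasis.finiteDimensional_of_finite
  have hd : (finrank ℝ V : ℝ) = Fintype.card ι := by rw [finrank_eq_card_basis e.toBasis]
  -- the horizontal part is a trace
  have tr : ∑ j, (inner ℝ (mixedEndo φ ψ B i (horizontalProj ξ (e j)))
        (mixedEndo φ ψ B k (horizontalProj ξ (e j))) : ℝ)
      = (Fintype.card ι - 3) * (∑ s, B i s * B k s) + (Fintype.card ι - 3) * (c i * c k) := by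
    have hω : (mixedEndo φ ψ B i : V →ₗ[ℝ] V) ∘ₗ (mixedEndo φ ψ B k : V →ₗ[ℝ] V) ∘ₗ horizontalProj ξ
        = ∑ s, ∑ t, (B i s * B k t) •
            ((φ s : V →ₗ[ℝ] V) ∘ₗ (φ t : V →ₗ[ℝ] V) ∘ₗ horizontalProj ξ)
          + ∑ s, B i s • ((φ s : V →ₗ[ℝ] V) ∘ₗ (ψ k : V →ₗ[ℝ] V))
          + ∑ t, B k t • ((φ t : V →ₗ[ℝ] V) ∘ₗ (ψ i : V →ₗ[ℝ] V))
          + (-(c i * c k)) • horizontalProj ξ := by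
      ext v
      simp only [LinearMap.comp_apply, ContinuousLinearMap.coe_coe, mixedEndo_apply, map_add,
        map_sum, map_smul, LinearMap.add_apply, LinearMap.sum_apply, LinearMap.smul_apply,
        hψ.comm, hψ.apply_horizontalProj, hψ.mul, Finset.smul_sum, smul_smul, smul_add,
        Finset.sum_add_distrib]
      rw [Finset.sum_comm]
      simp only [mul_comm (B k _) (B i _)]
      abel
    have ht := congrArg (LinearMap.trace ℝ V) hω
    simp only [map_add, map_sum, map_smul, h.trace_comp, hψ.trace_comp_eq_zero h, smul_eq_mul,
      mul_zero, Finset.sum_const_zero, add_zero, mul_ite, Finset.sum_ite_eq, Finset.mem_univ,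
      if_true, h.trace_horizontalProj, hd] at ht
    rw [LinearMap.trace_eq_sum_inner _ e] at ht
    have : ∀ j, (inner ℝ (mixedEndo φ ψ B i (horizontalProj ξ (e j)))
        (mixedEndo φ ψ B k (horizontalProj ξ (e j))) : ℝ)
        = -inner ℝ (e j) (((mixedEndo φ ψ B i : V →ₗ[ℝ] V) ∘ₗ
          (mixedEndo φ ψ B k : V →ₗ[ℝ] V) ∘ₗ horizontalProj ξ) (e j)) := by
      intro j
      have hz := mixedEndo_horizontal (B := B) h hψ (mixedEndo_horizontal (B := B) h hψ
        (fun i => h.inner_reeb_horizontalProj i (e j)) k) i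
      rw [mixedEndo_skew h hψ]
      conv_lhs => rw [horizontalProj_apply ξ (e j), inner_sub_left, sum_inner]
      rw [← horizontalProj_apply]
      simp [real_inner_smul_left, hz]
    rw [Finset.sum_congr rfl fun j _ => this j, Finset.sum_neg_distrib, ht,
      ← Finset.sum_mul]
    ring
  have vert : ∀ u v : V, ∑ j, ((inner ℝ u (e j) : ℝ) * inner ℝ v (e j)) = inner ℝ u v := by
    intro u v
    rw [← e.sum_inner_mul_inner u v]
    exact Finset.sum_congr rfl fun j _ => by rw [real_inner_comm v]
  have hz : ∀ r m v, (inner ℝ (ξ m) (mixedEndo φ ψ B r (horizontalProj ξ v)) : ℝ) = 0 :=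
    fun r m v => mixedEndo_horizontal h hψ (fun i => h.inner_reeb_horizontalProj i v) r m
  have hz' : ∀ r m v, (inner ℝ (mixedEndo φ ψ B r (horizontalProj ξ v)) (ξ m) : ℝ) = 0 :=
    fun r m v => by rw [real_inner_comm, hz]
  have key : ∀ j, (inner ℝ (T (e j) (ξ i)) (T (e j) (ξ k)) : ℝ)
      = (a - B.trace) ^ 2 * ((if i = k then 1 else 0) *
          (inner ℝ (ξ (i + 1)) (e j) * inner ℝ (ξ (k + 1)) (e j)
          + inner ℝ (ξ (i + 2)) (e j) * inner ℝ (ξ (k + 2)) (e j))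
        - (if i + 2 = k + 1 then 1 else 0) *
          (inner ℝ (ξ (i + 1)) (e j) * inner ℝ (ξ (k + 2)) (e j))
        - (if i + 1 = k + 2 then 1 else 0) *
          (inner ℝ (ξ (i + 2)) (e j) * inner ℝ (ξ (k + 1)) (e j)))
        + inner ℝ (mixedEndo φ ψ B i (horizontalProj ξ (e j)))
        (mixedEndo φ ψ B k (horizontalProj ξ (e j))) := by
    intro j
    rw [hT.skew_left h hψ _ (ξ i), hT.skew_left h hψ _ (ξ k), inner_neg_neg, hT.apply_reeb h hψ,
      hT.apply_reeb h hψ]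
    simp only [inner_sub_left, inner_sub_right, real_inner_smul_left, real_inner_smul_right, hz,
      hz', h.inner_reeb, add_left_inj]
    ring
  simp only [key]
  rw [Finset.sum_add_distrib, ← Finset.mul_sum, Finset.sum_sub_distrib, Finset.sum_sub_distrib,
    ← Finset.mul_sum, ← Finset.mul_sum, ← Finset.mul_sum, Finset.sum_add_distrib, tr, vert, vert,
    vert, vert]
  simp only [h.inner_reeb, add_left_inj]
  rcases fin_three_cases i with rfl | rfl | rfl <;> rcases fin_three_cases k with rfl | rfl | rfl <;>
  · simp
    try ring

/-- The total square of the torsion. -/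
theorem sum_sum_inner (h : QuaternionicRelations ξ φ)
    (hψ : IsCommutingFamily ξ φ ψ c) (hT : IsTorsionOf T ξ φ ψ a B)
    (e : OrthonormalBasis ι ℝ V) :
    ∑ k, ∑ j, (inner ℝ (T (e j) (e k)) (T (e j) (e k)) : ℝ)
      = 6 * (a - B.trace) ^ 2
        + 3 * (Fintype.card ι - 3) * ((∑ r, ∑ s, B r s ^ 2) + ∑ l, c l ^ 2) := by
  have : FiniteDimensional ℝ V := e.toBasis.finiteDimensional_of_finite
  have hd : (finrank ℝ V : ℝ) = Fintype.card ι := by rw [finrank_eq_card_basis e.toBasis]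
  set S : V → V → ℝ := fun x y => ∑ j, inner ℝ (T (e j) x) (T (e j) y) with hS
  have symm : ∀ x y, S x y = S y x := fun x y =>
    Finset.sum_congr rfl fun j _ => real_inner_comm _ _
  have add : ∀ x y z, S (x + y) z = S x z + S y z := fun x y z => by
    simp only [hS, map_add, inner_add_left, Finset.sum_add_distrib]
  have smul : ∀ (t : ℝ) x z, S (t • x) z = t * S x z := fun t x z => by
    simp only [hS, map_smul, real_inner_smul_left, Finset.mul_sum]
  have sum : ∀ (x : Fin 3 → V) z, S (∑ i, x i) z = ∑ i, S (x i) z := fun x z => by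
    simp only [Fin.sum_univ_three, add]
  -- the horizontal and the vertical space are orthogonal with respect to `S`
  have dec : ∀ x, S x x = S (horizontalProj ξ x) (horizontalProj ξ x)
      + ∑ i, ∑ k, (inner ℝ (ξ i) x * inner ℝ (ξ k) x) * S (ξ i) (ξ k) := by
    intro x
    have hmix : ∀ i, S (ξ i) (horizontalProj ξ x) = 0 := fun i => by
      rw [symm]
      exact hT.sum_inner_horizontal_reeb h hψ (fun i => h.inner_reeb_horizontalProj i x) i e
    have hx : x = horizontalProj ξ x + ∑ i, (inner ℝ (ξ i) x : ℝ) • ξ i := by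
      rw [horizontalProj_apply, sub_add_cancel]
    have addR : ∀ x y z, S z (x + y) = S z x + S z y := fun x y z => by
      rw [symm, add, symm x, symm y]
    have sumR : ∀ (x : Fin 3 → V) z, S z (∑ i, x i) = ∑ i, S z (x i) := fun x z => by
      simp only [Fin.sum_univ_three, addR]
    have smulR : ∀ (t : ℝ) x z, S z (t • x) = t * S z x := fun t x z => by
      rw [symm, smul, symm]
    have hmix' : ∀ i, S (horizontalProj ξ x) (ξ i) = 0 := fun i => by rw [symm, hmix]
    conv_lhs => rw [hx]
    simp only [add, addR, sum, sumR, smul, smulR, hmix, hmix', mul_zero, Finset.sum_const_zero,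
      add_zero, zero_add, mul_assoc]
  have hH : ∀ k, S (horizontalProj ξ (e k)) (horizontalProj ξ (e k))
      = 2 * ((∑ r, ∑ s, B r s ^ 2) + ∑ l, c l ^ 2) * inner ℝ (e k) (horizontalProj ξ (e k))
        + 4 * ∑ s, ∑ j, B j s * -inner ℝ (e k) (φ s (ψ j (e k))) := by
    intro k
    have hk : ∀ v, (∀ i, (inner ℝ (ξ i) v : ℝ) = 0) →
        (inner ℝ (horizontalProj ξ (e k)) v : ℝ) = inner ℝ (e k) v := fun v hv => by
      rw [horizontalProj_apply, inner_sub_left, sum_inner]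
      simp [real_inner_smul_left, hv]
    have h0 := fun i => h.inner_reeb_horizontalProj i (e k)
    refine (hT.sum_inner_horizontal h hψ h0 h0 e).trans ?_
    rw [hk _ h0]
    refine congrArg₂ _ rfl (congrArg _ (Finset.sum_congr rfl fun s _ =>
      Finset.sum_congr rfl fun j _ => congrArg _ ?_))
    rw [hψ.apply_horizontalProj, ← hk _ (h.inner_reeb_apply_eq_zero
      (fun i => hψ.horizontal j i (e k)) s), real_inner_comm _ (horizontalProj ξ (e k)), h.skew,
      neg_neg]
  have hV : ∀ i k, ∑ j, (inner ℝ (ξ i) (e j) * inner ℝ (ξ k) (e j) : ℝ)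
      = if i = k then 1 else 0 := by
    intro i k
    rw [← h.inner_reeb, ← e.sum_inner_mul_inner]
    exact Finset.sum_congr rfl fun j _ => by rw [real_inner_comm (ξ k)]
  have t1 : ∑ k, (inner ℝ (e k) (horizontalProj ξ (e k)) : ℝ) = Fintype.card ι - 3 := by
    rw [← hd, ← h.trace_horizontalProj, LinearMap.trace_eq_sum_inner _ e]
  have t2 : ∀ s j, ∑ k, (inner ℝ (e k) (φ s (ψ j (e k))) : ℝ) = 0 := fun s j => by
    have := hψ.trace_comp_eq_zero h s j
    rwa [LinearMap.trace_eq_sum_inner _ e] at this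
  have e1 : ∀ i, S (ξ i) (ξ i) = _ := fun i => hT.sum_inner_reeb h hψ i i e
  have e2 : ∀ k, S (e k) (e k) = _ := fun k => (dec (e k)).trans (congrArg (· + _) (hH k))
  change ∑ k, S (e k) (e k) = _
  have t3 : ∑ k, ∑ s, ∑ j, B j s * -(inner ℝ (e k) (φ s (ψ j (e k))) : ℝ) = 0 := by
    rw [Finset.sum_comm]
    refine Finset.sum_eq_zero fun s _ => ?_
    rw [Finset.sum_comm]
    refine Finset.sum_eq_zero fun j _ => ?_
    rw [← Finset.mul_sum, Finset.sum_neg_distrib, t2, neg_zero, mul_zero]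
  have t4 : ∑ k, ∑ i, ∑ m, (inner ℝ (ξ i) (e k) * inner ℝ (ξ m) (e k)) * S (ξ i) (ξ m)
      = ∑ i, S (ξ i) (ξ i) := by
    rw [Finset.sum_comm]
    refine Finset.sum_congr rfl fun i _ => ?_
    rw [Finset.sum_comm]
    simp only [← Finset.sum_mul, hV, ite_mul, one_mul, zero_mul, Finset.sum_ite_eq,
      Finset.mem_univ, if_true]
  rw [Finset.sum_congr rfl fun k _ => e2 k, Finset.sum_add_distrib, Finset.sum_add_distrib,
    ← Finset.mul_sum, ← Finset.mul_sum, t1, t3, t4, Finset.sum_congr rfl fun i _ => e1 i]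
  simp only [Fin.sum_univ_three, if_true]
  ring

end IsTorsionOf

end PointTorsion

/-! ### The curvature tensor of the Levi-Civita connection -/

section CurvatureTensor

variable {E : Type*} [NormedAddCommGroup E] [NormedSpace ℝ E] [FiniteDimensional ℝ E]
  {H : Type*} [TopologicalSpace H] {I : ModelWithCorners ℝ E H}
  {M : Type*} [TopologicalSpace M] [ChartedSpace H M] [IsManifold I ∞ M] [T2Space M]
  [RiemannianBundle (fun p : M => TangentSpace I p)]
  [IsContMDiffRiemannianBundle I ∞ E (fun p : M => TangentSpace I p)]
  {nabla : CovariantDerivative I E (TangentSpace I : M → Type _)}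
  {X Y Z W X' Y' Z' : Π p : M, TangentSpace I p}

namespace IsLeviCivita

theorem inner_curvature_pair_symm (h : IsLeviCivita nabla) (hX : IsSmoothField X)
    (hY : IsSmoothField Y) (hZ : IsSmoothField Z) (hW : IsSmoothField W) (p : M) :
    (inner ℝ (curvature nabla X Y Z p) (W p) : ℝ) = inner ℝ (curvature nabla Z W X p) (Y p) :=
  pair_symm_of_symmetries (α := {X : Π p : M, TangentSpace I p // IsSmoothField X})
    (r := fun X Y Z W => (inner ℝ (curvature nabla X.1 Y.1 Z.1 p) (W.1 p) : ℝ))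
    (fun X Y Z W => by rw [curvature_swap X.1 Y.1, inner_neg_left])
    (fun X Y Z W => h.inner_curvature_skew X.2 Y.2 Z.2 W.2 p)
    (fun X Y Z W => by
      rw [← inner_add_left, ← inner_add_left, h.curvature_bianchi X.2 Y.2 Z.2, inner_zero_left])
    ⟨X, hX⟩ ⟨Y, hY⟩ ⟨Z, hZ⟩ ⟨W, hW⟩

/-- The curvature is a tensor. The symmetries move every argument into the last slot of
`g(R(X, Y)Z, W)`, where tensoriality is obvious. -/
theorem curvature_congr (h : IsLeviCivita nabla) (hX : IsSmoothField X) (hY : IsSmoothField Y)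
    (hZ : IsSmoothField Z) (hX' : IsSmoothField X') (hY' : IsSmoothField Y')
    (hZ' : IsSmoothField Z') {p : M} (eX : X p = X' p) (eY : Y p = Y' p) (eZ : Z p = Z' p) :
    curvature nabla X Y Z p = curvature nabla X' Y' Z' p := by
  have cZ : ∀ {A B C C' : Π p : M, TangentSpace I p}, IsSmoothField A → IsSmoothField B →
      IsSmoothField C → IsSmoothField C' → C p = C' p →
      curvature nabla A B C p = curvature nabla A B C' p := by
    intro A B C C' hA hB hC hC' e
    refine ext_inner_right ℝ fun w => ?_
    obtain ⟨W, hW, rfl⟩ := exists_isSmoothField_eq w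
    rw [h.inner_curvature_skew hA hB hC hW, h.inner_curvature_skew hA hB hC' hW, e]
  have cX : ∀ {A A' B C : Π p : M, TangentSpace I p}, IsSmoothField A → IsSmoothField A' →
      IsSmoothField B → IsSmoothField C → A p = A' p →
      curvature nabla A B C p = curvature nabla A' B C p := by
    intro A A' B C hA hA' hB hC e
    refine ext_inner_right ℝ fun w => ?_
    obtain ⟨W, hW, rfl⟩ := exists_isSmoothField_eq w
    rw [h.inner_curvature_pair_symm hA hB hC hW, h.inner_curvature_pair_symm hA' hB hC hW,
      cZ hC hW hA hA' e]
  rw [cZ hX hY hZ hZ' eZ, cX hX hX' hY hZ' eX, curvature_swap X' Y, cX hY hY' hX' hZ' eY,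
    curvature_swap Y' X', neg_neg]

theorem curvatureAt_eq (h : IsLeviCivita nabla) (hX : IsSmoothField X) (hY : IsSmoothField Y)
    (hZ : IsSmoothField Z) (p : M) :
    curvatureAt nabla p (X p) (Y p) (Z p) = curvature nabla X Y Z p := by
  obtain ⟨X', hX', eX⟩ := exists_isSmoothField_eventuallyEq_extend (X p)
  obtain ⟨Y', hY', eY⟩ := exists_isSmoothField_eventuallyEq_extend (Y p)
  obtain ⟨Z', hZ', eZ⟩ := exists_isSmoothField_eventuallyEq_extend (Z p)
  rw [curvatureAt_eq_of_eventuallyEq h.isSmoothConnection hX' hY' hZ' eX eY eZ]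
  refine h.curvature_congr hX' hY' hZ' hX hY hZ ?_ ?_ ?_
  · rw [eX.self_of_nhds, FiberBundle.extend_apply_self]
  · rw [eY.self_of_nhds, FiberBundle.extend_apply_self]
  · rw [eZ.self_of_nhds, FiberBundle.extend_apply_self]

theorem isAlgebraicCurvature (h : IsLeviCivita nabla) (p : M) :
    IsAlgebraicCurvature (curvatureAt nabla p) where
  swap x y z := by
    obtain ⟨X, hX, rfl⟩ := exists_isSmoothField_eq x
    obtain ⟨Y, hY, rfl⟩ := exists_isSmoothField_eq y
    obtain ⟨Z, hZ, rfl⟩ := exists_isSmoothField_eq z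
    rw [h.curvatureAt_eq hX hY hZ, h.curvatureAt_eq hY hX hZ, curvature_swap]
  skew x y z w := by
    obtain ⟨X, hX, rfl⟩ := exists_isSmoothField_eq x
    obtain ⟨Y, hY, rfl⟩ := exists_isSmoothField_eq y
    obtain ⟨Z, hZ, rfl⟩ := exists_isSmoothField_eq z
    obtain ⟨W, hW, rfl⟩ := exists_isSmoothField_eq w
    rw [h.curvatureAt_eq hX hY hZ, h.curvatureAt_eq hX hY hW, h.inner_curvature_skew hX hY hZ hW]
  bianchi x y z := by
    obtain ⟨X, hX, rfl⟩ := exists_isSmoothField_eq x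
    obtain ⟨Y, hY, rfl⟩ := exists_isSmoothField_eq y
    obtain ⟨Z, hZ, rfl⟩ := exists_isSmoothField_eq z
    rw [h.curvatureAt_eq hX hY hZ, h.curvatureAt_eq hY hZ hX, h.curvatureAt_eq hZ hX hY,
      h.curvature_bianchi hX hY hZ]

end IsLeviCivita

end CurvatureTensor

/-! ### Sasakian and 3-Sasakian geometry -/

section Sasakian

variable {E : Type*} [NormedAddCommGroup E] [NormedSpace ℝ E] [FiniteDimensional ℝ E]
  {H : Type*} [TopologicalSpace H] {I : ModelWithCorners ℝ E H}
  {M : Type*} [TopologicalSpace M] [ChartedSpace H M] [IsManifold I ∞ M] [T2Space M]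
  [RiemannianBundle (fun p : M => TangentSpace I p)]
  [IsContMDiffRiemannianBundle I ∞ E (fun p : M => TangentSpace I p)]
  {nabla : CovariantDerivative I E (TangentSpace I : M → Type _)}
  {X Y Z W : Π p : M, TangentSpace I p}

theorem reebEndo_apply (ζ : Π p : M, TangentSpace I p) (p : M) (v : TangentSpace I p) :
    reebEndo nabla ζ p v = -nabla ζ p v := rfl

theorem nabla_eq_neg_reebEndo (ζ : Π p : M, TangentSpace I p) (p : M) (v : TangentSpace I p) :
    nabla ζ p v = -reebEndo nabla ζ p v := by rw [reebEndo_apply, neg_neg]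

/-- The derivative of a constant inner product vanishes. -/
theorem IsLeviCivita.inner_nabla_eq_of_const (hL : IsLeviCivita nabla)
    (hX : IsSmoothField X) (hY : IsSmoothField Y) (a : ℝ)
    (hc : ∀ q, (inner ℝ (X q) (Y q) : ℝ) = a) (p : M) (v : TangentSpace I p) :
    (inner ℝ (nabla X p v) (Y p) + inner ℝ (X p) (nabla Y p v) : ℝ) = 0 := by
  rw [← hL.mvfderiv_inner hX hY, funext hc, mvfderiv_const]
  rfl

namespace IsSasakian

variable {ζ : Π p : M, TangentSpace I p}

theorem isSmoothField_reebEndo (hL : IsLeviCivita nabla) (h : IsSasakian nabla ζ)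
    (hX : IsSmoothField X) : IsSmoothField fun q => reebEndo nabla ζ q (X q) :=
  (hL.isSmoothConnection X ζ hX h.smooth).neg

theorem reebEndo_skew (h : IsSasakian nabla ζ) (p : M) (v w : TangentSpace I p) :
    (inner ℝ (reebEndo nabla ζ p v) w : ℝ) = -inner ℝ v (reebEndo nabla ζ p w) := by
  rw [reebEndo_apply, reebEndo_apply, inner_neg_left, inner_neg_right]
  linarith [h.killing p v w]

theorem reebEndo_self (hL : IsLeviCivita nabla) (h : IsSasakian nabla ζ) (p : M) :
    reebEndo nabla ζ p (ζ p) = 0 := by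
  refine ext_inner_right ℝ fun w => ?_
  have := hL.inner_nabla_eq_of_const h.smooth h.smooth 1 h.unit p w
  rw [h.reebEndo_skew, reebEndo_apply, inner_neg_right, neg_neg, inner_zero_left]
  linarith [real_inner_comm (ζ p) (nabla ζ p w)]

theorem reebEndo_sq (hL : IsLeviCivita nabla) (h : IsSasakian nabla ζ) (p : M)
    (v : TangentSpace I p) :
    reebEndo nabla ζ p (reebEndo nabla ζ p v) = -v + (inner ℝ (ζ p) v : ℝ) • ζ p := by
  have := h.nabla_phi p ζ (h.smooth.differentiableAt p) v
  have e : (fun q => reebEndo nabla ζ q (ζ q)) = 0 := funext fun q => h.reebEndo_self hL q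
  rw [e, CovariantDerivative.zero, nabla_eq_neg_reebEndo ζ p v, map_neg, h.unit, one_smul] at this
  rw [real_inner_comm v]
  simp only [Pi.zero_apply, zero_apply, zero_sub, neg_neg] at this
  rw [this]
  abel

theorem nabla_reebEndo (h : IsSasakian nabla ζ) (hY : IsSmoothField Y) (p : M)
    (v : TangentSpace I p) :
    nabla (fun q => reebEndo nabla ζ q (Y q)) p v
      = reebEndo nabla ζ p (nabla Y p v)
        + ((inner ℝ v (Y p) : ℝ) • ζ p - (inner ℝ (ζ p) (Y p) : ℝ) • v) := by
  rw [← h.nabla_phi p Y (hY.differentiableAt p) v]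
  abel

/-- `R(X, Y)ξ = η(Y)X - η(X)Y`. -/
theorem curvature_reeb (hL : IsLeviCivita nabla) (h : IsSasakian nabla ζ)
    (hX : IsSmoothField X) (hY : IsSmoothField Y) (p : M) :
    curvature nabla X Y ζ p = sphereCurvature (X p) (Y p) (ζ p) := by
  have e : ∀ {A B : Π p : M, TangentSpace I p}, IsSmoothField A → IsSmoothField B →
      nabla (fun q => nabla ζ q (B q)) p (A p)
        = -(reebEndo nabla ζ p (nabla B p (A p))
          + ((inner ℝ (A p) (B p) : ℝ) • ζ p - (inner ℝ (ζ p) (B p) : ℝ) • A p)) := by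
    intro A B hA hB
    have h1 : (fun q => nabla ζ q (B q)) = -fun q => reebEndo nabla ζ q (B q) :=
      funext fun q => nabla_eq_neg_reebEndo ζ q (B q)
    rw [h1, nabla_neg (h.isSmoothField_reebEndo hL hB), neg_apply,
      h.nabla_reebEndo hB]
  rw [curvature, e hX hY, e hY hX, hL.mlieBracket_eq hX hY, nabla_eq_neg_reebEndo ζ p (_ - _),
    map_sub, sphereCurvature, real_inner_comm (X p) (Y p), real_inner_comm (ζ p) (Y p),
    real_inner_comm (ζ p) (X p)]
  abel

/-- `[R(X, Y), φ]` is the same as on the unit sphere. -/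
theorem curvature_reebEndo (hL : IsLeviCivita nabla) (h : IsSasakian nabla ζ)
    (hX : IsSmoothField X) (hY : IsSmoothField Y) (hZ : IsSmoothField Z) (p : M) :
    curvature nabla X Y (fun q => reebEndo nabla ζ q (Z q)) p
        - reebEndo nabla ζ p (curvature nabla X Y Z p)
      = sphereCurvature (X p) (Y p) (reebEndo nabla ζ p (Z p))
        - reebEndo nabla ζ p (sphereCurvature (X p) (Y p) (Z p)) := by
  have e : ∀ {A B : Π p : M, TangentSpace I p}, IsSmoothField A → IsSmoothField B →
      nabla (fun q => nabla (fun q => reebEndo nabla ζ q (Z q)) q (B q)) p (A p)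
        = (reebEndo nabla ζ p (nabla (fun q => nabla Z q (B q)) p (A p))
            + ((inner ℝ (A p) (nabla Z p (B p)) : ℝ) • ζ p
              - (inner ℝ (ζ p) (nabla Z p (B p)) : ℝ) • A p))
          + (((inner ℝ (B p) (Z p) : ℝ) • -reebEndo nabla ζ p (A p)
              + (inner ℝ (nabla B p (A p)) (Z p) + inner ℝ (B p) (nabla Z p (A p)) : ℝ) • ζ p)
            - ((inner ℝ (ζ p) (Z p) : ℝ) • nabla B p (A p)
              + (inner ℝ (-reebEndo nabla ζ p (A p)) (Z p)
                + inner ℝ (ζ p) (nabla Z p (A p)) : ℝ) • B p)) := by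
    intro A B hA hB
    have h1 : (fun q => nabla (fun q => reebEndo nabla ζ q (Z q)) q (B q))
        = (fun q => reebEndo nabla ζ q (nabla Z q (B q)))
          + ((fun q => (inner ℝ (B q) (Z q) : ℝ)) • ζ
            - (fun q => (inner ℝ (ζ q) (Z q) : ℝ)) • B) :=
      funext fun q => h.nabla_reebEndo hZ q (B q)
    have hBZ := hL.isSmoothConnection B Z hB hZ
    have s1 := h.smooth.smul (hB.inner hZ)
    have s2 := hB.smul (h.smooth.inner hZ)
    rw [h1, nabla_add (h.isSmoothField_reebEndo hL hBZ) (s1.sub s2), nabla_sub s1 s2,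
      add_apply, sub_apply, nabla_smul (hB.inner hZ) h.smooth,
      nabla_smul (h.smooth.inner hZ) hB, h.nabla_reebEndo hBZ, hL.mvfderiv_inner hB hZ,
      hL.mvfderiv_inner h.smooth hZ, nabla_eq_neg_reebEndo ζ p (A p)]
  rw [curvature, e hX hY, e hY hX, hL.mlieBracket_eq hX hY, h.nabla_reebEndo hZ, curvature,
    hL.mlieBracket_eq hX hY]
  simp only [sphereCurvature, map_sub, map_smul, inner_sub_left, inner_neg_left, h.reebEndo_skew,
    neg_neg]
  module

end IsSasakian

namespace IsThreeSasakian

variable {ξ : Fin 3 → Π p : M, TangentSpace I p}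

theorem inner_reeb (h : IsThreeSasakian nabla ξ) (i j : Fin 3) (p : M) :
    (inner ℝ (ξ i p) (ξ j p) : ℝ) = if i = j then 1 else 0 :=
  orthonormal_iff_ite.1 (h.orthonormal p) i j

theorem reebEndo_succ_apply (h : IsThreeSasakian nabla ξ) (i : Fin 3) (p : M) :
    reebEndo nabla (ξ (i + 1)) p (ξ i p) = -ξ (i + 2) p := by
  have hL := h.leviCivita
  have h1 := (hL.mlieBracket_eq (h.sasakian i).smooth (h.sasakian (i + 1)).smooth p).symm.trans
    (h.bracket i p)
  have hne : ¬ i = i + 1 := by simp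
  have h2 : reebEndo nabla (ξ i) p (ξ (i + 1) p) = -reebEndo nabla (ξ (i + 1)) p (ξ i p) := by
    refine ext_inner_right ℝ fun w => ?_
    have := hL.inner_nabla_eq_of_const (h.sasakian i).smooth (h.sasakian (i + 1)).smooth 0
      (fun q => by rw [h.inner_reeb, if_neg hne]) p w
    rw [(h.sasakian i).reebEndo_skew, inner_neg_left, (h.sasakian (i + 1)).reebEndo_skew,
      reebEndo_apply, reebEndo_apply, inner_neg_right, inner_neg_right, neg_neg, neg_neg,
      real_inner_comm (nabla (ξ i) p w)]
    linarith
  rw [nabla_eq_neg_reebEndo, nabla_eq_neg_reebEndo, h2] at h1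
  have h3 : (2 : ℝ) • reebEndo nabla (ξ (i + 1)) p (ξ i p) = (2 : ℝ) • -ξ (i + 2) p := by
    rw [smul_neg, ← h1]
    module
  exact smul_right_injective _ (two_ne_zero' ℝ) h3

/-- Differentiating `φ₂ ξ₁ = -ξ₃` gives the quaternionic relations. -/
theorem quaternionicRelations (h : IsThreeSasakian nabla ξ) (p : M) :
    QuaternionicRelations (fun i => ξ i p) fun i => reebEndo nabla (ξ i) p where
  orthonormal := h.orthonormal p
  skew i := (h.sasakian i).reebEndo_skew p
  sq i := (h.sasakian i).reebEndo_sq h.leviCivita p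
  mul i v := by
    have h1 := (h.sasakian (i + 1)).nabla_reebEndo (h.sasakian i).smooth p v
    have e : (fun q => reebEndo nabla (ξ (i + 1)) q (ξ i q)) = -ξ (i + 2) :=
      funext fun q => h.reebEndo_succ_apply i q
    have hne : ¬ i + 1 = i := by simp
    rw [e, nabla_neg (h.sasakian _).smooth, h.inner_reeb, if_neg hne, zero_smul, sub_zero,
      nabla_eq_neg_reebEndo (ξ i), map_neg, real_inner_comm] at h1
    rw [reebEndo_apply (ξ (i + 2)), neg_neg]
    rw [neg_apply] at h1
    rw [← sub_eq_iff_eq_add, ← neg_inj, h1]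
    abel

/-- A 3-Sasakian manifold is Einstein. -/
theorem ricci_eq (h : IsThreeSasakian nabla ξ) {p : M} {ι : Type*} [Fintype ι]
    (e : OrthonormalBasis ι ℝ (TangentSpace I p)) (y z : TangentSpace I p) :
    ricci nabla e y z = (Fintype.card ι - 1) * inner ℝ y z := by
  refine (h.quaternionicRelations p).ricci_eq (h.leviCivita.isAlgebraicCurvature p) ?_ ?_ e y z
  · intro i x y
    obtain ⟨X, hX, rfl⟩ := exists_isSmoothField_eq x
    obtain ⟨Y, hY, rfl⟩ := exists_isSmoothField_eq y
    rw [h.leviCivita.curvatureAt_eq hX hY (h.sasakian i).smooth,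
      (h.sasakian i).curvature_reeb h.leviCivita hX hY]
  · intro i x y z
    obtain ⟨X, hX, rfl⟩ := exists_isSmoothField_eq x
    obtain ⟨Y, hY, rfl⟩ := exists_isSmoothField_eq y
    obtain ⟨Z, hZ, rfl⟩ := exists_isSmoothField_eq z
    rw [h.leviCivita.curvatureAt_eq hX hY hZ, ← (h.sasakian i).curvature_reebEndo h.leviCivita
      hX hY hZ, ← h.leviCivita.curvatureAt_eq hX hY
        ((h.sasakian i).isSmoothField_reebEndo h.leviCivita hZ)]

end IsThreeSasakian

end Sasakian

/-! ### Metric connections with skew torsion -/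

section SkewTorsion

variable {E : Type*} [NormedAddCommGroup E] [NormedSpace ℝ E] [FiniteDimensional ℝ E]
  {H : Type*} [TopologicalSpace H] {I : ModelWithCorners ℝ E H}
  {M : Type*} [TopologicalSpace M] [ChartedSpace H M] [IsManifold I ∞ M] [T2Space M]
  [RiemannianBundle (fun p : M => TangentSpace I p)]
  [IsContMDiffRiemannianBundle I ∞ E (fun p : M => TangentSpace I p)]
  {nabla : CovariantDerivative I E (TangentSpace I : M → Type _)}
  {X Y Z W : Π p : M, TangentSpace I p}

/-- A smooth (1,2)-tensor field `T` such that `g(T(X, Y), Z)` is totally skew-symmetric. -/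
structure IsSmoothSkewTensor
    (T : Π p : M, TangentSpace I p →L[ℝ] TangentSpace I p →L[ℝ] TangentSpace I p) : Prop where
  smooth : ∀ {X Y : Π p : M, TangentSpace I p}, IsSmoothField X → IsSmoothField Y →
    IsSmoothField fun p => T p (X p) (Y p)
  skew_left : ∀ (p : M) (x y : TangentSpace I p), T p x y = -T p y x
  skew_right : ∀ (p : M) (x y z : TangentSpace I p),
    (inner ℝ (T p x y) z : ℝ) = -inner ℝ (T p x z) y

variable {T : Π p : M, TangentSpace I p →L[ℝ] TangentSpace I p →L[ℝ] TangentSpace I p}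

/-- The connection `∇ + ½ T`. -/
def addTorsion (nabla : CovariantDerivative I E (TangentSpace I : M → Type _))
    (T : Π p : M, TangentSpace I p →L[ℝ] TangentSpace I p →L[ℝ] TangentSpace I p) :
    CovariantDerivative I E (TangentSpace I : M → Type _) :=
  nabla.addOneForm fun p => (1 / 2 : ℝ) • (T p).flip

theorem addTorsion_apply (Z : Π p : M, TangentSpace I p) (p : M) (v : TangentSpace I p) :
    addTorsion nabla T Z p v = nabla Z p v + (1 / 2 : ℝ) • T p v (Z p) := rfl

namespace IsSmoothSkewTensor

theorem inner_self_left (h : IsSmoothSkewTensor T) (p : M) (x y : TangentSpace I p) :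
    (inner ℝ (T p x y) x : ℝ) = 0 := by
  have h1 := h.skew_right p x y x
  have h2 := h.skew_left p x x
  have h3 : T p x x = 0 := by
    refine (smul_eq_zero.1 (?_ : (2 : ℝ) • T p x x = 0)).resolve_left two_ne_zero
    rw [two_smul]
    nth_rw 1 [h2]
    exact neg_add_cancel _
  rw [h1, h3, inner_zero_left, neg_zero]

theorem isSmoothConnection (h : IsSmoothSkewTensor T) (hn : IsSmoothConnection nabla) :
    IsSmoothConnection (addTorsion nabla T) := fun X Y hX hY =>
  (hn X Y hX hY).add ((h.smooth hX hY).const_smul (1 / 2))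

theorem torsion_addTorsion (h : IsSmoothSkewTensor T) (hL : IsLeviCivita nabla) (p : M)
    (x y : TangentSpace I p) : (addTorsion nabla T).torsion p x y = T p x y := by
  have := FiniteDimensional.complete ℝ E
  obtain ⟨X, hX, rfl⟩ := exists_isSmoothField_eq x
  obtain ⟨Y, hY, rfl⟩ := exists_isSmoothField_eq y
  rw [CovariantDerivative.torsion_apply _ (hX.differentiableAt p) (hY.differentiableAt p),
    hL.mlieBracket_eq hX hY, addTorsion_apply, addTorsion_apply, h.skew_left p (Y p)]
  module

/-- The curvature of `∇ + ½ T` in terms of that of `∇`. -/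
theorem curvature_addTorsion (h : IsSmoothSkewTensor T) (hL : IsLeviCivita nabla)
    (hX : IsSmoothField X) (hY : IsSmoothField Y) (hZ : IsSmoothField Z) (p : M) :
    curvature (addTorsion nabla T) X Y Z p = curvature nabla X Y Z p
      + (1 / 2 : ℝ) • (nabla (fun q => T q (Y q) (Z q)) p (X p)
          - T p (nabla Y p (X p)) (Z p) - T p (Y p) (nabla Z p (X p)))
      - (1 / 2 : ℝ) • (nabla (fun q => T q (X q) (Z q)) p (Y p)
          - T p (nabla X p (Y p)) (Z p) - T p (X p) (nabla Z p (Y p)))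
      + (1 / 4 : ℝ) • (T p (X p) (T p (Y p) (Z p)) - T p (Y p) (T p (X p) (Z p))) := by
  have e : ∀ {A B : Π p : M, TangentSpace I p}, IsSmoothField A → IsSmoothField B →
      addTorsion nabla T (fun q => addTorsion nabla T Z q (B q)) p (A p)
        = nabla (fun q => nabla Z q (B q)) p (A p)
          + (1 / 2 : ℝ) • nabla (fun q => T q (B q) (Z q)) p (A p)
          + (1 / 2 : ℝ) • T p (A p) (nabla Z p (B p))
          + (1 / 4 : ℝ) • T p (A p) (T p (B p) (Z p)) := by
    intro A B hA hB
    have h1 : (fun q => addTorsion nabla T Z q (B q))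
        = (fun q => nabla Z q (B q)) + (1 / 2 : ℝ) • fun q => T q (B q) (Z q) := rfl
    have hs : nabla ((1 / 2 : ℝ) • fun q => T q (B q) (Z q)) p
        = (1 / 2 : ℝ) • nabla (fun q => T q (B q) (Z q)) p :=
      nabla.isCovariantDerivativeOnUniv.smul_const _ ((h.smooth hB hZ).differentiableAt p)
    rw [h1, addTorsion_apply, nabla_add (hL.isSmoothConnection B Z hB hZ)
      ((h.smooth hB hZ).const_smul _), hs]
    simp only [add_apply, smul_apply, Pi.add_apply, Pi.smul_apply, map_add,
      map_smul]
    module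
  rw [curvature, e hX hY, e hY hX, addTorsion_apply, hL.mlieBracket_eq hX hY, curvature,
    hL.mlieBracket_eq hX hY]
  simp only [map_sub, sub_apply]
  module

/-- Symmetrising in the last two slots removes the covariant derivative of the torsion. -/
theorem inner_curvatureAt_addTorsion (h : IsSmoothSkewTensor T) (hL : IsLeviCivita nabla) {p : M}
    (x y z : TangentSpace I p) :
    (inner ℝ (curvatureAt (addTorsion nabla T) p x y z) x : ℝ)
        + inner ℝ (curvatureAt (addTorsion nabla T) p x z y) x
      = inner ℝ (curvatureAt nabla p x y z) x + inner ℝ (curvatureAt nabla p x z y) x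
        - 1 / 2 * inner ℝ (T p x y) (T p x z) := by
  obtain ⟨X, hX, eX⟩ := exists_isSmoothField_eventuallyEq_extend x
  obtain ⟨Y, hY, eY⟩ := exists_isSmoothField_eventuallyEq_extend y
  obtain ⟨Z, hZ, eZ⟩ := exists_isSmoothField_eventuallyEq_extend z
  have hn := h.isSmoothConnection hL.isSmoothConnection
  rw [curvatureAt_eq_of_eventuallyEq hn hX hY hZ eX eY eZ,
    curvatureAt_eq_of_eventuallyEq hn hX hZ hY eX eZ eY,
    curvatureAt_eq_of_eventuallyEq hL.isSmoothConnection hX hY hZ eX eY eZ,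
    curvatureAt_eq_of_eventuallyEq hL.isSmoothConnection hX hZ hY eX eZ eY,
    h.curvature_addTorsion hL hX hY hZ, h.curvature_addTorsion hL hX hZ hY]
  obtain rfl : X p = x := by rw [eX.self_of_nhds, FiberBundle.extend_apply_self]
  obtain rfl : Y p = y := by rw [eY.self_of_nhds, FiberBundle.extend_apply_self]
  obtain rfl : Z p = z := by rw [eZ.self_of_nhds, FiberBundle.extend_apply_self]
  clear eX eY eZ
  have e1 : (fun q => T q (Z q) (Y q)) = -fun q => T q (Y q) (Z q) :=
    funext fun q => h.skew_left q _ _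
  rw [e1, nabla_neg (h.smooth hY hZ)]
  -- `g((∇_B T)(X, C), X) = 0`
  have e2 : ∀ {B C : Π q : M, TangentSpace I q}, IsSmoothField B → IsSmoothField C →
      (inner ℝ (nabla (fun q => T q (X q) (C q)) p (B p)) (X p) : ℝ)
        = inner ℝ (T p (nabla X p (B p)) (C p)) (X p) := by
    intro B C hB hC
    have := hL.inner_nabla_eq_of_const (h.smooth hX hC) hX 0
      (fun q => h.inner_self_left q _ _) p (B p)
    rw [h.skew_left p (nabla X p (B p)), inner_neg_left, h.skew_right, h.skew_left p (C p),
      inner_neg_left, neg_neg]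
    linarith
  have e3 : ∀ u v : TangentSpace I p,
      (inner ℝ (T p u (T p (X p) v)) (X p) : ℝ) = inner ℝ (T p (X p) u) (T p (X p) v) := by
    intro u v
    rw [h.skew_right, h.skew_left p u, inner_neg_left, neg_neg]
  simp only [inner_add_left, inner_sub_left, real_inner_smul_left, e2 hY hZ, e2 hZ hY, neg_apply,
    inner_neg_left, h.inner_self_left, e3, h.skew_left p (nabla Y p (X p)),
    h.skew_left p (nabla Z p (X p)), real_inner_comm (T p (X p) (Y p)) (T p (X p) (Z p))]
  ring

variable {ι : Type*} [Fintype ι]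

theorem torsionSquare_addTorsion (h : IsSmoothSkewTensor T) (hL : IsLeviCivita nabla) {p : M}
    (e : OrthonormalBasis ι ℝ (TangentSpace I p)) (x y : TangentSpace I p) :
    torsionSquare (addTorsion nabla T) e x y = ∑ j, inner ℝ (T p (e j) x) (T p (e j) y) := by
  simp only [torsionSquare, h.torsion_addTorsion hL]

/-- `Sym(Ric^∇) = Ric - ¼ S`. -/
theorem symRicci_addTorsion (h : IsSmoothSkewTensor T) (hL : IsLeviCivita nabla) {p : M}
    (e : OrthonormalBasis ι ℝ (TangentSpace I p)) (y z : TangentSpace I p) :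
    symRicci (addTorsion nabla T) e y z
      = symRicci nabla e y z - 1 / 4 * torsionSquare (addTorsion nabla T) e y z := by
  rw [h.torsionSquare_addTorsion hL, symRicci, symRicci, ricci, ricci, ricci, ricci,
    ← Finset.sum_add_distrib, ← Finset.sum_add_distrib,
    Finset.sum_congr rfl fun i _ => h.inner_curvatureAt_addTorsion hL (e i) y z,
    Finset.sum_sub_distrib, ← Finset.mul_sum]
  ring

end IsSmoothSkewTensor

theorem scalarCurvature_eq_sum {ι : Type*} [Fintype ι] {p : M}
    (e : OrthonormalBasis ι ℝ (TangentSpace I p)) :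
    scalarCurvature nabla e = ∑ j, symRicci nabla e (e j) (e j) := by
  rw [scalarCurvature, Finset.sum_comm]
  refine Finset.sum_congr rfl fun j _ => ?_
  rw [symRicci, add_self_div_two, ricci]

end SkewTorsion

/-! ### The connection with torsion `a Tᵒ + ∑ b_rs T^{rs} + ∑ c_l T^{l0}` -/

section PointFormula

variable {V : Type*} [NormedAddCommGroup V] [InnerProductSpace ℝ V]
  {ξ : Fin 3 → V} {φ ψ : Fin 3 → V →L[ℝ] V} {c : Fin 3 → ℝ}
  {T : V →L[ℝ] V →L[ℝ] V} {a : ℝ} {B : Matrix (Fin 3) (Fin 3) ℝ}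

theorem IsTorsionOf.apply_eq (h : QuaternionicRelations ξ φ) (hψ : IsCommutingFamily ξ φ ψ c)
    (hT : IsTorsionOf T ξ φ ψ a B) (X Y : V) :
    T X Y = ∑ i, ((a * (inner ℝ (ξ (i + 1)) X * inner ℝ (ξ (i + 2)) Y
          - inner ℝ (ξ (i + 2)) X * inner ℝ (ξ (i + 1)) Y)
            + inner ℝ X (mixedEndo φ ψ B i Y) : ℝ) • ξ i
        + (inner ℝ (ξ i) Y : ℝ) • mixedEndo φ ψ B i X
        - (inner ℝ (ξ i) X : ℝ) • mixedEndo φ ψ B i Y) := by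
  refine ext_inner_right ℝ fun Z => ?_
  have hω : ∀ r v w, (inner ℝ v (mixedEndo φ ψ B r w) : ℝ) = -inner ℝ (mixedEndo φ ψ B r v) w :=
    fun r v w => by rw [mixedEndo_skew h hψ, neg_neg]
  have e1 : (1 + 1 : Fin 3) = 2 := rfl
  have e2 : (1 + 2 : Fin 3) = 0 := rfl
  have e3 : (2 + 1 : Fin 3) = 0 := rfl
  have e4 : (2 + 2 : Fin 3) = 1 := rfl
  rw [hT]
  simp only [verticalForm, wedgeForm, Matrix.det_fin_three, Matrix.of_apply, Matrix.cons_val,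
    Fin.sum_univ_three, inner_add_left, inner_sub_left, real_inner_smul_left, zero_add, e1, e2, e3,
    e4, hω _ Y Z, real_inner_comm (mixedEndo φ ψ B _ X) Z]
  ring

end PointFormula

section SkewConnection

variable {E : Type*} [NormedAddCommGroup E] [NormedSpace ℝ E] [FiniteDimensional ℝ E]
  {H : Type*} [TopologicalSpace H] {I : ModelWithCorners ℝ E H}
  {M : Type*} [TopologicalSpace M] [ChartedSpace H M] [IsManifold I ∞ M] [T2Space M]
  [RiemannianBundle (fun p : M => TangentSpace I p)]
  [IsContMDiffRiemannianBundle I ∞ E (fun p : M => TangentSpace I p)]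
  {nabla : CovariantDerivative I E (TangentSpace I : M → Type _)}
  {ξ : Fin 3 → Π p : M, TangentSpace I p}
  {φ₀ : Π p : M, TangentSpace I p →L[ℝ] TangentSpace I p}
  {a : ℝ} {B : Matrix (Fin 3) (Fin 3) ℝ} {c : Fin 3 → ℝ}

theorem isTorsionOf_skewTensor (p : M) :
    IsTorsionOf (skewTensor nabla ξ φ₀ a B c p) (fun i => ξ i p)
      (fun i => reebEndo nabla (ξ i) p) (fun l => c l • φ₀ p) a B := by
  intro X Y Z
  simp only [skewTensor, add_apply, smul_apply, inner_add_left, real_inner_smul_left,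
    inner_verticalTorsion, inner_wedgeTorsion, wedgeForm, mixedEndo_apply,
    inner_add_right, real_inner_smul_right, Fin.sum_univ_three]
  ring

/-- `φ₀` is a smooth endomorphism field such that `c l • φ₀`, `l = 1, 2, 3`, have at every point
the algebraic properties on which the curvature formulas depend. -/
structure IsAdmissible (nabla : CovariantDerivative I E (TangentSpace I : M → Type _))
    (ξ : Fin 3 → Π p : M, TangentSpace I p)
    (φ₀ : Π p : M, TangentSpace I p →L[ℝ] TangentSpace I p) (c : Fin 3 → ℝ) : Prop where
  smooth : ∀ (l : Fin 3) {X : Π p : M, TangentSpace I p}, IsSmoothField X →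
    IsSmoothField fun p => (c l • φ₀ p) (X p)
  commutingFamily : ∀ p, IsCommutingFamily (fun i => ξ i p) (fun i => reebEndo nabla (ξ i) p)
    (fun l => c l • φ₀ p) c

theorem isAdmissible_zero : IsAdmissible nabla ξ φ₀ 0 where
  smooth l X hX := by
    have : (fun p => ((0 : Fin 3 → ℝ) l • φ₀ p) (X p)) = (0 : ℝ) • X := by
      funext p
      simp
    rw [this]
    exact hX.const_smul 0
  commutingFamily p :=
    { skew := by simp
      reeb := by simp
      comm := by simp
      mul := by simp }

namespace IsAdmissible

theorem isSmoothSkewTensor (hφ : IsAdmissible nabla ξ φ₀ c) (h : IsThreeSasakian nabla ξ) :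
    IsSmoothSkewTensor (skewTensor nabla ξ φ₀ a B c) where
  skew_left p x y := isTorsionOf_skewTensor p |>.skew_left (h.quaternionicRelations p)
    (hφ.commutingFamily p) x y
  skew_right p x y z := isTorsionOf_skewTensor p |>.skew_right (h.quaternionicRelations p)
    (hφ.commutingFamily p) x y z
  smooth {X Y} hX hY := by
    have hs := fun i => (h.sasakian i).smooth
    have hω : ∀ (i : Fin 3) {Z : Π p : M, TangentSpace I p}, IsSmoothField Z →
        IsSmoothField fun p => mixedEndo (fun i => reebEndo nabla (ξ i) p) (fun l => c l • φ₀ p) B i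
          (Z p) := by
      intro i Z hZ
      simp only [mixedEndo_apply]
      refine IsSmoothField.add ?_ (hφ.smooth i hZ)
      refine IsSmoothField.sum fun s _ => ?_
      exact ((h.sasakian s).isSmoothField_reebEndo h.leviCivita hZ).const_smul (B i s)
    have e : (fun p => skewTensor nabla ξ φ₀ a B c p (X p) (Y p)) = _ := funext fun p =>
      (isTorsionOf_skewTensor p).apply_eq (h.quaternionicRelations p) (hφ.commutingFamily p) (X p)
        (Y p)
    rw [e]
    refine IsSmoothField.sum fun i _ => ?_
    refine IsSmoothField.sub (IsSmoothField.add ?_ ?_) ?_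
    · refine IsSmoothField.smul ?_ (hs i)
      refine ContMDiff.add ?_ (hX.inner (hω i hY))
      refine ContMDiff.mul contMDiff_const ?_
      exact (((hs _).inner hX).mul ((hs _).inner hY)).sub (((hs _).inner hX).mul ((hs _).inner hY))
    · exact IsSmoothField.smul ((hs i).inner hY) (hω i hX)
    · exact IsSmoothField.smul ((hs i).inner hX) (hω i hY)

end IsAdmissible

theorem inner_reeb_of_mem_horizontal {p : M} {X : TangentSpace I p} (hX : X ∈ horizontal ξ p)
    (i : Fin 3) : (inner ℝ (ξ i p) X : ℝ) = 0 :=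
  (Submodule.mem_orthogonal _ _).1 hX _ (Submodule.subset_span ⟨i, rfl⟩)

variable {ι : Type*} [Fintype ι] {n : ℕ}

theorem torsionSquare_comm {p : M} (e : OrthonormalBasis ι ℝ (TangentSpace I p)) (x y : TangentSpace I p) :
    torsionSquare nabla e x y = torsionSquare nabla e y x :=
  Finset.sum_congr rfl fun _ _ => real_inner_comm _ _

namespace IsAdmissible

theorem torsionSquare_eq (hφ : IsAdmissible nabla ξ φ₀ c) (h : IsThreeSasakian nabla ξ) {p : M}
    (e : OrthonormalBasis ι ℝ (TangentSpace I p)) (x y : TangentSpace I p) :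
    torsionSquare (skewConnection nabla ξ φ₀ a B c) e x y
      = ∑ j, inner ℝ (skewTensor nabla ξ φ₀ a B c p (e j) x)
          (skewTensor nabla ξ φ₀ a B c p (e j) y) :=
  (hφ.isSmoothSkewTensor h).torsionSquare_addTorsion h.leviCivita e x y

theorem torsionSquare_horizontal_vertical (hφ : IsAdmissible nabla ξ φ₀ c)
    (h : IsThreeSasakian nabla ξ) {p : M} (e : OrthonormalBasis ι ℝ (TangentSpace I p))
    {X V : TangentSpace I p} (hX : X ∈ horizontal ξ p) (hV : V ∈ vertical ξ p) :
    torsionSquare (skewConnection nabla ξ φ₀ a B c) e X V = 0 := by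
  rw [hφ.torsionSquare_eq h]
  induction hV using Submodule.span_induction with
  | mem _ hV =>
    obtain ⟨i, rfl⟩ := hV
    exact (isTorsionOf_skewTensor p).sum_inner_horizontal_reeb (h.quaternionicRelations p)
      (hφ.commutingFamily p) (inner_reeb_of_mem_horizontal hX) i e
  | zero => simp
  | add V W _ _ hV hW =>
    simp only [map_add, inner_add_right, Finset.sum_add_distrib]
    rw [hV, hW, add_zero]
  | smul r V _ hV =>
    simp only [map_smul, real_inner_smul_right, ← Finset.mul_sum]
    rw [hV, mul_zero]

theorem torsionSquare_reeb (hφ : IsAdmissible nabla ξ φ₀ c) (h : IsThreeSasakian nabla ξ) {p : M}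
    (e : OrthonormalBasis ι ℝ (TangentSpace I p)) (hn : Fintype.card ι = 4 * n + 3) (i k : Fin 3) :
    torsionSquare (skewConnection nabla ξ φ₀ a B c) e (ξ i p) (ξ k p)
      = 2 * (if i = k then 1 else 0) * (a - B.trace) ^ 2
        + 4 * n * (∑ s, B i s * B k s) + 4 * n * c i * c k := by
  rw [hφ.torsionSquare_eq h, (isTorsionOf_skewTensor p).sum_inner_reeb (h.quaternionicRelations p)
    (hφ.commutingFamily p) i k e, hn]
  push_cast
  ring

theorem torsionSquare_horizontal (hφ : IsAdmissible nabla ξ φ₀ c) (h : IsThreeSasakian nabla ξ)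
    {p : M} (e : OrthonormalBasis ι ℝ (TangentSpace I p)) {X Y : TangentSpace I p}
    (hX : X ∈ horizontal ξ p) (hY : Y ∈ horizontal ξ p) :
    torsionSquare (skewConnection nabla ξ φ₀ a B c) e X Y
      = 2 * ((∑ r, ∑ s, B r s ^ 2) + ∑ l, c l ^ 2) * inner ℝ X Y
        + 4 * ∑ s, ∑ j, B j s * c j * inner ℝ (φ₀ p X) (reebEndo nabla (ξ s) p Y) := by
  rw [hφ.torsionSquare_eq h, (isTorsionOf_skewTensor p).sum_inner_horizontal
    (h.quaternionicRelations p) (hφ.commutingFamily p) (inner_reeb_of_mem_horizontal hX)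
    (inner_reeb_of_mem_horizontal hY) e]
  simp only [smul_apply, real_inner_smul_left, mul_assoc]

theorem symRicci_eq (hφ : IsAdmissible nabla ξ φ₀ c) (h : IsThreeSasakian nabla ξ) {p : M}
    (e : OrthonormalBasis ι ℝ (TangentSpace I p)) (hn : Fintype.card ι = 4 * n + 3)
    (x y : TangentSpace I p) :
    symRicci (skewConnection nabla ξ φ₀ a B c) e x y
      = (4 * n + 2) * inner ℝ x y
        - 1 / 4 * torsionSquare (skewConnection nabla ξ φ₀ a B c) e x y := by
  have := (hφ.isSmoothSkewTensor (a := a) (B := B) h).symRicci_addTorsion h.leviCivita e x y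
  rw [symRicci.eq_1 nabla, h.ricci_eq, h.ricci_eq, hn, real_inner_comm x y] at this
  refine this.trans ?_
  push_cast
  change _ - 1 / 4 * torsionSquare (skewConnection nabla ξ φ₀ a B c) e x y = _
  ring

theorem scalarCurvature_eq (hφ : IsAdmissible nabla ξ φ₀ c) (h : IsThreeSasakian nabla ξ) {p : M}
    (e : OrthonormalBasis ι ℝ (TangentSpace I p)) (hn : Fintype.card ι = 4 * n + 3) :
    scalarCurvature (skewConnection nabla ξ φ₀ a B c) e
      = (4 * n + 2) * (4 * n + 3) - 3 / 2 * (a - B.trace) ^ 2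
        - 3 * n * ((∑ r, ∑ s, B r s ^ 2) + ∑ l, c l ^ 2) := by
  have h1 := (isTorsionOf_skewTensor (nabla := nabla) (ξ := ξ) (φ₀ := φ₀) (a := a) (B := B)
    (c := c) p).sum_sum_inner (h.quaternionicRelations p) (hφ.commutingFamily p) e
  have h2 : ∀ k, (inner ℝ (e k) (e k) : ℝ) = 1 := fun k => by
    rw [real_inner_self_eq_norm_sq, e.orthonormal.1 k, one_pow]
  rw [scalarCurvature_eq_sum]
  simp only [hφ.symRicci_eq h e hn, hφ.torsionSquare_eq h, h2, Finset.sum_sub_distrib,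
    ← Finset.mul_sum]
  rw [h1]
  simp only [Finset.sum_const, Finset.card_univ, hn, nsmul_eq_mul]
  push_cast
  ring

end IsAdmissible

end SkewConnection

/-! ### Automorphisms of a 3-Sasakian structure -/

section Automorphisms

variable {E : Type*} [NormedAddCommGroup E] [NormedSpace ℝ E] [FiniteDimensional ℝ E]
  {H : Type*} [TopologicalSpace H] {I : ModelWithCorners ℝ E H}
  {M : Type*} [TopologicalSpace M] [ChartedSpace H M] [IsManifold I ∞ M]
  {f g : M → M}

theorem mfderiv_comp_of_leftInverse (hf : ContMDiff I I ∞ f) (hg : ContMDiff I I ∞ g)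
    (hgf : Function.LeftInverse g f) (p : M) :
    (mfderiv I I g (f p)).comp (mfderiv I I f p) = ContinuousLinearMap.id ℝ (TangentSpace I p) := by
  rw [← mfderiv_comp p ((hg _).mdifferentiableAt (by simp)) ((hf _).mdifferentiableAt (by simp)),
    hgf.comp_eq_id, mfderiv_id]

theorem isInvertible_mfderiv (hf : ContMDiff I I ∞ f) (hg : ContMDiff I I ∞ g)
    (hgf : Function.LeftInverse g f) (hfg : Function.RightInverse g f) (p : M) :
    (mfderiv I I f p).IsInvertible := by
  refine ContinuousLinearMap.IsInvertible.of_inverse (g := mfderiv I I g (f p)) ?_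
    (mfderiv_comp_of_leftInverse hf hg hgf p)
  have := mfderiv_comp_of_leftInverse hg hf hfg (f p)
  rwa [hgf p] at this

variable [T2Space M] [RiemannianBundle (fun p : M => TangentSpace I p)]
  [IsContMDiffRiemannianBundle I ∞ E (fun p : M => TangentSpace I p)]
  {nabla : CovariantDerivative I E (TangentSpace I : M → Type _)}
  {X Y ζ : Π p : M, TangentSpace I p}

/-- For a Killing field `ζ` with dual form `η`, `2 g(φ X, Y) = -dη(X, Y)`. -/
theorem IsSasakian.two_mul_inner_reebEndo (h : IsSasakian nabla ζ) (hL : IsLeviCivita nabla)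
    (hX : IsSmoothField X) (hY : IsSmoothField Y) (p : M) :
    2 * (inner ℝ (reebEndo nabla ζ p (X p)) (Y p) : ℝ)
      = mvfderiv I (fun q => (inner ℝ (ζ q) (X q) : ℝ)) p (Y p)
        - mvfderiv I (fun q => (inner ℝ (ζ q) (Y q) : ℝ)) p (X p)
        + inner ℝ (ζ p) (mlieBracket I X Y p) := by
  have h1 := h.killing p (X p) (Y p)
  rw [hL.mvfderiv_inner h.smooth hX, hL.mvfderiv_inner h.smooth hY, hL.mlieBracket_eq hX hY,
    reebEndo_apply, inner_neg_left, inner_sub_right]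
  rw [real_inner_comm (nabla ζ p (Y p)) (X p)] at h1
  linarith

/-- Isometries that preserve a Reeb vector field preserve the endomorphism field `φ`, since they
preserve `dη`. -/
theorem IsSasakian.mfderiv_reebEndo (h : IsSasakian nabla ζ) (hL : IsLeviCivita nabla)
    (hf : ContMDiff I I ∞ f) (hg : ContMDiff I I ∞ g)
    (hgf : Function.LeftInverse g f) (hfg : Function.RightInverse g f)
    (hiso : ∀ p (v w : TangentSpace I p),
      inner ℝ (mfderiv I I f p v) (mfderiv I I f p w) = (inner ℝ v w : ℝ))
    (hζ : ∀ p, mfderiv I I f p (ζ p) = ζ (f p)) (p : M) (v : TangentSpace I p) :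
    mfderiv I I f p (reebEndo nabla ζ p v) = reebEndo nabla ζ (f p) (mfderiv I I f p v) := by
  have := FiniteDimensional.complete ℝ E
  have : IsManifold I (minSmoothness ℝ 2) M := by
    rw [minSmoothness_of_isRCLikeNormedField]; infer_instance
  have hinv := isInvertible_mfderiv hf hg hgf hfg
  have hpull : ∀ (Z : Π p : M, TangentSpace I p) q, mfderiv I I f q (mpullback I I f Z q) = Z (f q) :=
    fun Z q => (hinv q).self_apply_inverse _
  have hsm : ∀ {Z : Π p : M, TangentSpace I p}, IsSmoothField Z →
      IsSmoothField (mpullback I I f Z) := fun hZ =>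
    ContMDiff.mpullback_vectorField hZ hf hinv (by exact le_rfl)
  have hin : ∀ Z : Π p : M, TangentSpace I p, (fun q => (inner ℝ (ζ q) (mpullback I I f Z q) : ℝ))
      = (fun q => (inner ℝ (ζ q) (Z q) : ℝ)) ∘ f := fun Z => funext fun q => by
    rw [← hiso, hζ, hpull, Function.comp_apply]
  have key : ∀ {X Y : Π p : M, TangentSpace I p}, IsSmoothField X → IsSmoothField Y →
      (inner ℝ (reebEndo nabla ζ p (mpullback I I f X p)) (mpullback I I f Y p) : ℝ)
        = inner ℝ (reebEndo nabla ζ (f p) (X (f p))) (Y (f p)) := by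
    intro X Y hX hY
    have hd : ∀ {Z W : Π p : M, TangentSpace I p}, IsSmoothField Z →
        mvfderiv I (fun q => (inner ℝ (ζ q) (mpullback I I f Z q) : ℝ)) p (mpullback I I f W p)
          = mvfderiv I (fun q => (inner ℝ (ζ q) (Z q) : ℝ)) (f p) (W (f p)) := by
      intro Z W hZ
      have h0 := mfderiv_comp p (((h.smooth.inner hZ) (f p)).mdifferentiableAt (by simp))
        ((hf p).mdifferentiableAt (by simp))
      rw [hin, ← hpull W p]
      exact congrArg (fun L => L (mpullback I I f W p)) h0
    have hb : (inner ℝ (ζ p) (mlieBracket I (mpullback I I f X) (mpullback I I f Y) p) : ℝ)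
        = inner ℝ (ζ (f p)) (mlieBracket I X Y (f p)) := by
      rw [← mpullback_mlieBracket (hX.differentiableAt _) (hY.differentiableAt _) (hf p)
        (by rw [minSmoothness_of_isRCLikeNormedField]; exact WithTop.coe_le_coe.2 (le_top : (2 : ℕ∞) ≤ ⊤)), ← hiso, hζ, hpull]
    have h1 := h.two_mul_inner_reebEndo hL (hsm hX) (hsm hY) p
    have h2 := h.two_mul_inner_reebEndo hL hX hY (f p)
    rw [hd hX, hd hY, hb] at h1
    linarith
  obtain ⟨X, hX, hXv⟩ := exists_isSmoothField_eq (mfderiv I I f p v)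
  refine ext_inner_right ℝ fun w => ?_
  obtain ⟨Y, hY, rfl⟩ := exists_isSmoothField_eq w
  have hv : mpullback I I f X p = v := by
    rw [mpullback_apply, hXv]
    exact (hinv p).inverse_apply_self v
  rw [← hXv, ← key hX hY, hv, ← hpull Y p, hiso]

end Automorphisms

/-! ### One-parameter subgroups of `SU(n+2)` transverse to the isotropy group -/

section Matrices

/-- The exponential of a trace-free skew-Hermitian matrix lies in the special unitary group. -/
theorem exp_mem_specialUnitaryGroup {m : Type*} [Fintype m] [DecidableEq m] {X : Matrix m m ℂ}
    (hX : X.conjTranspose = -X) (htr : X.trace = 0) :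
    NormedSpace.exp X ∈ Matrix.specialUnitaryGroup m ℂ := by
  rw [Matrix.mem_specialUnitaryGroup_iff, Matrix.mem_unitaryGroup_iff]
  constructor
  · rw [Matrix.star_eq_conjTranspose, ← Matrix.exp_conjTranspose, hX, Matrix.exp_neg]
    exact Matrix.mul_nonsing_inv _ ((Matrix.isUnit_iff_isUnit_det _).1 (Matrix.isUnit_exp X))
  -- `X = i A` with `A` Hermitian, hence unitarily diagonalisable
  · set A : Matrix m m ℂ := (-Complex.I) • X with hA
    have hAh : A.IsHermitian := by
      rw [Matrix.IsHermitian, hA, Matrix.conjTranspose_smul, hX]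
      simp
    have hXA : X = Complex.I • A := by
      rw [hA, smul_smul]
      simp
    set U : Matrix m m ℂ := hAh.eigenvectorUnitary.1 with hU
    set d : m → ℂ := fun i => (hAh.eigenvalues i : ℂ)
    have hUU : U * star U = 1 := Matrix.mem_unitaryGroup_iff.1 hAh.eigenvectorUnitary.2
    have hUi : U⁻¹ = star U := Matrix.inv_eq_right_inv hUU
    have hdet : U.det * (star U).det = 1 := by rw [← Matrix.det_mul, hUU, Matrix.det_one]
    have hspec : X = U * Matrix.diagonal (Complex.I • d) * U⁻¹ := by
      rw [hXA, Matrix.diagonal_smul, Matrix.mul_smul, Matrix.smul_mul, hUi]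
      congr 1
      have := hAh.spectral_theorem
      rw [Unitary.conjStarAlgAut_apply] at this
      exact this
    have htrd : ∑ i, (Complex.I • d) i = 0 := by
      have : (U * Matrix.diagonal (Complex.I • d) * U⁻¹).trace = 0 := by rw [← hspec, htr]
      rwa [Matrix.trace_mul_comm, ← Matrix.mul_assoc, hUi, mul_eq_one_comm.1 hUU,
        Matrix.one_mul, Matrix.trace_diagonal] at this
    have hUu : IsUnit U := IsUnit.of_mul_eq_one _ hUU
    rw [hspec, Matrix.exp_conj _ _ hUu, Matrix.exp_diagonal, Matrix.det_mul, Matrix.det_mul,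
      mul_right_comm, hUi, hdet, one_mul, Matrix.det_diagonal]
    simp only [Pi.coe_exp, ← Complex.exp_eq_exp_ℂ]
    rw [← Complex.exp_sum, htrd, Complex.exp_zero]

/-- Real coordinates on the complement of the isotropy algebra in `𝔰𝔲(n+2)`: the off-diagonal
block and an element of `𝔰𝔲(2)`. -/
abbrev ComplementCoord (n : ℕ) : Type := (Fin n → Fin 2 → ℂ) × ℝ × ℂ

theorem finrank_complementCoord (n : ℕ) : finrank ℝ (ComplementCoord n) = 4 * n + 3 := by
  simp [ComplementCoord, Module.finrank_prod, Module.finrank_pi_fintype]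
  ring

/-- The element of `𝔰𝔲(n+2)` with given coordinates in the complement of the isotropy algebra. -/
def complementMatrix (n : ℕ) :
    ComplementCoord n →ₗ[ℝ] Matrix (Fin n ⊕ Fin 2) (Fin n ⊕ Fin 2) ℂ where
  toFun x := Matrix.fromBlocks 0 (Matrix.of x.1) (-(Matrix.of x.1).conjTranspose)
    !![x.2.1 * Complex.I, x.2.2; -(starRingEnd ℂ) x.2.2, -(x.2.1 * Complex.I)]
  map_add' x y := by
    ext (i | i) (j | j)
    · simp
    · simp
    · simp [add_comm]
    · fin_cases i <;> fin_cases j <;> simp <;> ring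
  map_smul' r x := by
    ext (i | i) (j | j)
    · simp
    · simp
    · simp
    · fin_cases i <;> fin_cases j <;> simp [mul_assoc]

theorem conjTranspose_complementMatrix (n : ℕ) (x : ComplementCoord n) :
    (complementMatrix n x).conjTranspose = -complementMatrix n x := by
  ext (i | i) (j | j)
  · simp [complementMatrix]
  · simp [complementMatrix]
  · simp [complementMatrix]
  · fin_cases i <;> fin_cases j <;> simp [complementMatrix]

theorem trace_complementMatrix (n : ℕ) (x : ComplementCoord n) :
    (complementMatrix n x).trace = 0 := by
  simp [complementMatrix, Matrix.trace, Fintype.sum_sum_type]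

/-- The exponential of an element of the complement of the isotropy algebra. -/
def complementExp (n : ℕ) (x : ComplementCoord n) : SU n :=
  ⟨NormedSpace.exp (complementMatrix n x), exp_mem_specialUnitaryGroup
    (conjTranspose_complementMatrix n x) (trace_complementMatrix n x)⟩

theorem complementExp_zero (n : ℕ) : complementExp n 0 = 1 :=
  Subtype.ext (by simp [complementExp])

theorem complementExp_add_smul (n : ℕ) (x : ComplementCoord n) (s t : ℝ) :
    complementExp n ((s + t) • x) = complementExp n (s • x) * complementExp n (t • x) := by
  refine Subtype.ext ?_
  change NormedSpace.exp _ = NormedSpace.exp _ * NormedSpace.exp _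
  rw [add_smul, map_add, Matrix.exp_add_of_commute]
  rw [map_smul, map_smul]
  exact ((Commute.refl _).smul_left _).smul_right _

theorem complementExp_neg (n : ℕ) (x : ComplementCoord n) :
    complementExp n (-x) = (complementExp n x)⁻¹ := by
  rw [eq_inv_iff_mul_eq_one]
  have := complementExp_add_smul n x (-1) 1
  rw [neg_add_cancel, zero_smul, complementExp_zero, neg_one_smul, one_smul] at this
  exact this.symm

open scoped Matrix.Norms.Operator in
theorem contDiff_complementExp (n : ℕ) (i j : Fin n ⊕ Fin 2) :
    ContDiff ℝ ∞ fun x => (complementExp n x).1 i j := by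
  have h1 : ContDiff ℝ ∞
      (NormedSpace.exp : Matrix (Fin n ⊕ Fin 2) (Fin n ⊕ Fin 2) ℂ → Matrix _ _ ℂ) :=
    (fun x => (NormedSpace.exp_analytic (𝕂 := ℝ) x).contDiffAt : ∀ x, ContDiffAt ℝ ∞ _ x)
      |> contDiff_iff_contDiffAt.2
  have h2 : ContDiff ℝ ∞ (complementMatrix n) :=
    (LinearMap.toContinuousLinearMap (complementMatrix n)).contDiff
  have h3 : ContDiff ℝ ∞ (Matrix.entryLinearMap ℝ ℂ i j) :=
    (LinearMap.toContinuousLinearMap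
      (Matrix.entryLinearMap ℝ ℂ i j : Matrix (Fin n ⊕ Fin 2) (Fin n ⊕ Fin 2) ℂ →ₗ[ℝ] ℂ)).contDiff
  exact h3.comp (h1.comp h2)

open scoped Matrix.Norms.Operator in
/-- A linear equation satisfied by a one-parameter group of matrices is satisfied by its
generator. -/
theorem map_eq_zero_of_exp {m : Type*} [Fintype m] [DecidableEq m] {X : Matrix m m ℂ}
    (l : Matrix m m ℂ →ₗ[ℝ] ℂ) (h : ∀ t : ℝ, l (NormedSpace.exp (t • X)) = 0) : l X = 0 := by
  have h1 := hasDerivAt_exp_smul_const (𝕂 := ℝ) X 0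
  have h2 := (LinearMap.toContinuousLinearMap l).hasFDerivAt.comp_hasDerivAt (0 : ℝ) h1
  have h3 : HasDerivAt (fun _ : ℝ => (0 : ℂ)) (l X) 0 := by
    convert! h2 using 1
    · exact funext fun t => (h t).symm
    · rw [zero_smul, NormedSpace.exp_zero, one_mul]
      rfl
  exact h3.unique (hasDerivAt_const _ _)

/-- A one-parameter subgroup of the isotropy group with generator in the complement of the isotropy
algebra is trivial. -/
theorem eq_zero_of_complementExp_mem {n : ℕ} {x : ComplementCoord n}
    (h : ∀ t : ℝ, complementExp n (t • x) ∈ isotropySet n) : x = 0 := by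
  have hexp : ∀ t : ℝ, (complementExp n (t • x)).1 = NormedSpace.exp (t • complementMatrix n x) :=
    fun t => congrArg NormedSpace.exp (map_smul _ _ _)
  let ent : (i j : Fin n ⊕ Fin 2) → Matrix (Fin n ⊕ Fin 2) (Fin n ⊕ Fin 2) ℂ →ₗ[ℝ] ℂ :=
    fun i j => Matrix.entryLinearMap ℝ ℂ i j
  have h12 : ∀ i j, x.1 i j = 0 := fun i j => by
    refine map_eq_zero_of_exp (X := complementMatrix n x) (ent (.inl i) (.inr j)) fun t => ?_
    rw [← hexp]
    exact congrFun (congrFun (h t).1 i) j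
  have hw : x.2.2 = 0 := by
    refine map_eq_zero_of_exp (X := complementMatrix n x) (ent (.inr 0) (.inr 1)) fun t => ?_
    obtain ⟨-, -, l, hl⟩ := h t
    rw [← hexp]
    have := congrFun (congrFun hl 0) 1
    rwa [Matrix.smul_apply, Matrix.one_apply_ne (by decide), smul_zero] at this
  have hs : (x.2.1 * Complex.I) - -(x.2.1 * Complex.I) = 0 := by
    refine map_eq_zero_of_exp (X := complementMatrix n x)
      (ent (.inr 0) (.inr 0) - ent (.inr 1) (.inr 1)) fun t => ?_
    obtain ⟨-, -, l, hl⟩ := h t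
    rw [← hexp, LinearMap.sub_apply, sub_eq_zero]
    have h0 := congrFun (congrFun hl 0) 0
    have h1 := congrFun (congrFun hl 1) 1
    simp only [Matrix.smul_apply, Matrix.one_apply_eq] at h0 h1
    exact h0.trans h1.symm
  have hs' : x.2.1 = 0 := by
    rw [sub_neg_eq_add, ← two_mul] at hs
    simpa using hs
  refine Prod.ext (funext fun i => funext fun j => h12 i j) (Prod.ext hs' hw)

/-- The projection onto the off-diagonal block. -/
def offDiagonalPart (n : ℕ) : ComplementCoord n →L[ℝ] ComplementCoord n :=
  (ContinuousLinearMap.inl ℝ _ _).comp (ContinuousLinearMap.fst ℝ _ _)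

/-- The projection onto `𝔰𝔲(2)`. -/
def diagonalPart (n : ℕ) : ComplementCoord n →L[ℝ] ComplementCoord n :=
  (ContinuousLinearMap.inr ℝ _ _).comp (ContinuousLinearMap.snd ℝ _ _)

/-- The action of `ad h` on the complement of the isotropy algebra: multiplication of the
off-diagonal block by `i`. -/
def adCentral (n : ℕ) : ComplementCoord n →L[ℝ] ComplementCoord n :=
  (ContinuousLinearMap.inl ℝ _ _).comp
    (Complex.I • ContinuousLinearMap.fst ℝ (Fin n → Fin 2 → ℂ) (ℝ × ℂ))

/-- The action of `Ad (exp (t h))` on the complement of the isotropy algebra. -/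
def rotation (n : ℕ) (t : ℝ) : ComplementCoord n →L[ℝ] ComplementCoord n :=
  Real.cos t • offDiagonalPart n + Real.sin t • adCentral n + diagonalPart n

theorem offDiagonalPart_add_diagonalPart (n : ℕ) (x : ComplementCoord n) :
    offDiagonalPart n x + diagonalPart n x = x := by
  simp [offDiagonalPart, diagonalPart]

theorem adCentral_adCentral (n : ℕ) (x : ComplementCoord n) :
    adCentral n (adCentral n x) = -offDiagonalPart n x := by
  simp [offDiagonalPart, adCentral, smul_smul]

theorem adCentral_offDiagonalPart (n : ℕ) (x : ComplementCoord n) :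
    adCentral n (offDiagonalPart n x) = adCentral n x := by
  simp [offDiagonalPart, adCentral]

theorem rotation_fst (n : ℕ) (t : ℝ) (x : ComplementCoord n) (i : Fin n) (j : Fin 2) :
    (rotation n t x).1 i j = Complex.exp (t * Complex.I) * x.1 i j := by
  rw [Complex.exp_mul_I]
  simp [rotation, offDiagonalPart, adCentral, diagonalPart]
  ring

theorem rotation_snd (n : ℕ) (t : ℝ) (x : ComplementCoord n) : (rotation n t x).2 = x.2 := by
  simp [rotation, offDiagonalPart, adCentral, diagonalPart]

theorem rotation_pi (n : ℕ) :
    rotation n Real.pi = diagonalPart n - offDiagonalPart n := by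
  refine ContinuousLinearMap.ext fun x => ?_
  simp [rotation, sub_eq_neg_add]

theorem rotation_pi_div_two (n : ℕ) :
    rotation n (Real.pi / 2) = adCentral n + diagonalPart n := by
  refine ContinuousLinearMap.ext fun x => ?_
  simp [rotation]

theorem hasDerivAt_rotation (n : ℕ) : HasDerivAt (rotation n) (adCentral n) 0 := by
  have h1 := (Real.hasDerivAt_cos 0).smul_const (offDiagonalPart n)
  have h2 := (Real.hasDerivAt_sin 0).smul_const (adCentral n)
  convert! (h1.add h2).add_const (diagonalPart n) using 1
  refine ContinuousLinearMap.ext fun x => ?_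
  simp

theorem centralFlow_coe (n : ℕ) (t : ℝ) :
    (centralFlow n t).1 = Matrix.diagonal fun i => Complex.exp (t * centralEntry n i) :=
  exp_centralElement n t

theorem centralEntry_sub (n : ℕ) (i : Fin n) (j : Fin 2) :
    centralEntry n (.inl i) = Complex.I + centralEntry n (.inr j) := by
  have h0 : (2 + (n : ℂ)) ≠ 0 := by exact_mod_cast (by omega : 2 + n ≠ 0)
  simp only [centralEntry, Sum.elim_inl, Sum.elim_inr]
  field_simp
  ring

/-- `Ad (exp (t h))` acts on the complement of the isotropy algebra by `rotation n t`. -/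
theorem centralFlow_mul_complementExp (n : ℕ) (t : ℝ) (x : ComplementCoord n) :
    centralFlow n t * complementExp n x = complementExp n (rotation n t x) * centralFlow n t := by
  set D := (centralFlow n t).1 with hD
  have hu : IsUnit D := ⟨⟨D, (centralFlow n t)⁻¹.1,
    congrArg Subtype.val (mul_inv_cancel (centralFlow n t)),
    congrArg Subtype.val (inv_mul_cancel (centralFlow n t))⟩, rfl⟩
  have hdet : IsUnit D.det := (Matrix.isUnit_iff_isUnit_det _).1 hu
  have key : complementMatrix n (rotation n t x) * D = D * complementMatrix n x := by
    rw [hD, centralFlow_coe]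
    ext i j
    rw [Matrix.mul_diagonal, Matrix.diagonal_mul]
    have hexp : ∀ (i : Fin n) (j : Fin 2), Complex.exp (t * centralEntry n (.inl i))
        = Complex.exp (t * Complex.I) * Complex.exp (t * centralEntry n (.inr j)) := fun i j => by
      rw [← Complex.exp_add, ← mul_add, centralEntry_sub n i j]
    have hstar : (starRingEnd ℂ) (Complex.exp (t * Complex.I)) * Complex.exp (t * Complex.I) = 1 := by
      rw [← Complex.exp_conj, ← Complex.exp_add]
      simp
    rcases i with i | i <;> rcases j with j | j
    · simp [complementMatrix]
    · have : complementMatrix n (rotation n t x) (.inl i) (.inr j)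
          = Complex.exp (t * Complex.I) * complementMatrix n x (.inl i) (.inr j) :=
        rotation_fst n t x i j
      rw [this, hexp i j]
      ring
    · have : complementMatrix n (rotation n t x) (.inr i) (.inl j)
          = (starRingEnd ℂ) (Complex.exp (t * Complex.I)) * complementMatrix n x (.inr i) (.inl j) := by
        have h1 : ∀ y, complementMatrix n y (.inr i) (.inl j) = -(starRingEnd ℂ) (y.1 j i) :=
          fun y => rfl
        rw [h1, h1, rotation_fst, map_mul, mul_neg]
      rw [this, hexp j i]
      linear_combination (complementMatrix n x (.inr i) (.inl j)
        * Complex.exp (t * centralEntry n (.inr i))) * hstar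
    · have : complementMatrix n (rotation n t x) (.inr i) (.inr j)
          = complementMatrix n x (.inr i) (.inr j) := by
        simp [complementMatrix, rotation_snd]
      have hc : ∀ k : Fin 2, centralEntry n (.inr k) = centralEntry n (.inr 0) := fun k => rfl
      rw [this, hc i, hc j, mul_comm]
  refine Subtype.ext ?_
  change D * NormedSpace.exp (complementMatrix n x)
    = NormedSpace.exp (complementMatrix n (rotation n t x)) * D
  have hconj : complementMatrix n (rotation n t x) = D * complementMatrix n x * D⁻¹ := by
    rw [← key, Matrix.mul_nonsing_inv_cancel_right _ _ hdet]
  rw [hconj, Matrix.exp_conj _ _ hu, Matrix.nonsing_inv_mul_cancel_right _ _ hdet]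

theorem centralFlow_mem_isotropySet (n : ℕ) (t : ℝ) : centralFlow n t ∈ isotropySet n := by
  refine ⟨?_, ?_, Complex.exp (t * centralEntry n (.inr 0)), ?_⟩
  · rw [centralFlow_coe]
    ext i j
    simp [Matrix.toBlocks₁₂]
  · rw [centralFlow_coe]
    ext i j
    simp [Matrix.toBlocks₂₁]
  · rw [centralFlow_coe]
    ext i j
    have hc : ∀ k : Fin 2, centralEntry n (.inr k) = centralEntry n (.inr 0) := fun k => rfl
    by_cases hij : i = j
    · subst hij
      simp [Matrix.toBlocks₂₂, hc i]
    · simp [Matrix.toBlocks₂₂, hij]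

theorem commute_centralFlow {n : ℕ} {A : SU n} (hA : A ∈ isotropySet n) (t : ℝ) :
    A * centralFlow n t = centralFlow n t * A := by
  refine Subtype.ext ?_
  change A.1 * (centralFlow n t).1 = (centralFlow n t).1 * A.1
  rw [centralFlow_coe]
  ext i j
  rw [Matrix.mul_diagonal, Matrix.diagonal_mul, mul_comm]
  obtain ⟨h12, h21, -⟩ := hA
  rcases i with i | i <;> rcases j with j | j
  · rfl
  · have : A.1 (.inl i) (.inr j) = 0 := congrFun (congrFun h12 i) j
    rw [this, mul_zero, mul_zero]
  · have : A.1 (.inr i) (.inl j) = 0 := congrFun (congrFun h21 i) j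
    rw [this, mul_zero, mul_zero]
  · rfl

end Matrices

/-! ### The action of `SU(n+2)` near the base point -/

section Action

/-- A curve with vanishing derivative is constant. -/
theorem eq_of_hasMFDerivAt_zero {E : Type*} [NormedAddCommGroup E] [NormedSpace ℝ E]
    [FiniteDimensional ℝ E] {H : Type*} [TopologicalSpace H] {I : ModelWithCorners ℝ E H}
    {M : Type*} [TopologicalSpace M] [ChartedSpace H M] [IsManifold I ∞ M] [T2Space M]
    {γ : ℝ → M} (h : ∀ t, HasMFDerivAt 𝓘(ℝ, ℝ) I γ t 0) (s t : ℝ) : γ s = γ t := by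
  -- smooth bump functions separate points
  by_contra hne
  obtain ⟨f, hf⟩ : ∃ f : SmoothBumpFunction I (γ s), tsupport f ⊆ {γ t}ᶜ := by
    obtain ⟨f, hf, -⟩ := (SmoothBumpFunction.nhds_basis_support (I := I)
      (isOpen_compl_singleton.mem_nhds hne)).mem_iff.1 Filter.univ_mem
    exact ⟨f, hf⟩
  have hd : ∀ r, HasFDerivAt (f ∘ γ) (0 : ℝ →L[ℝ] ℝ) r := fun r => by
    have := ((f.contMDiff (γ r)).mdifferentiableAt (by simp)).hasMFDerivAt.comp r (h r)
    rw [ContinuousLinearMap.comp_zero] at this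
    exact this.hasFDerivAt
  have hc := is_const_of_fderiv_eq_zero (fun r => (hd r).differentiableAt)
    (fun r => (hd r).fderiv) s t
  have h0 : f (γ t) = 0 := by
    by_contra hft
    exact hf (subset_tsupport _ hft) rfl
  rw [Function.comp_apply, Function.comp_apply, h0, f.eq_one] at hc
  exact one_ne_zero hc

variable {n : ℕ} {E : Type*} [NormedAddCommGroup E] [NormedSpace ℝ E] [FiniteDimensional ℝ E]
  {H : Type*} [TopologicalSpace H] {I : ModelWithCorners ℝ E H}
  {M : Type*} [TopologicalSpace M] [ChartedSpace H M] [IsManifold I ∞ M]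
  [RiemannianBundle (fun p : M => TangentSpace I p)]
  {ξ : Fin 3 → Π p : M, TangentSpace I p}

namespace SUPresentation

variable (P : SUPresentation n ξ)

/-- The diffeomorphism of `M` given by an element of `SU(n+2)`. -/
def act (A : SU n) : M → M :=
  letI := P.action
  fun q => A • q

theorem act_one (q : M) : P.act 1 q = q :=
  letI := P.action
  one_smul (SU n) q

theorem act_mul (A B : SU n) (q : M) : P.act (A * B) q = P.act A (P.act B q) :=
  letI := P.action
  mul_smul A B q

theorem act_inv_act (A : SU n) : Function.LeftInverse (P.act A⁻¹) (P.act A) := fun q => by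
  rw [← act_mul, inv_mul_cancel, act_one]

theorem act_act_inv (A : SU n) : Function.RightInverse (P.act A⁻¹) (P.act A) := fun q => by
  rw [← act_mul, mul_inv_cancel, act_one]

theorem act_base {A : SU n} (hA : A ∈ isotropySet n) : P.act A P.base = P.base :=
  (P.isotropy A).2 hA

/-- The action is smooth along every smooth family of elements of `SU(n+2)`. -/
theorem contMDiff_act_family {V : Type*} [NormedAddCommGroup V] [NormedSpace ℝ V]
    [FiniteDimensional ℝ V] {f : V → SU n} (hf : ∀ i j, ContDiff ℝ ∞ fun t => (f t).1 i j) :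
    ContMDiff (𝓘(ℝ, V).prod I) I ∞ fun tp : V × M => P.act (f tp.1) tp.2 := by
  let e : V ≃L[ℝ] EuclideanSpace ℝ (Fin (finrank ℝ V)) :=
    ContinuousLinearEquiv.ofFinrankEq (by simp)
  have h1 := P.smooth _ (f ∘ e.symm) fun i j => (hf i j).comp e.symm.contDiff
  have h2 : ContMDiff (𝓘(ℝ, V).prod I) ((𝓡 (finrank ℝ V)).prod I) ∞
      fun tp : V × M => (e tp.1, tp.2) :=
    (e.contDiff.contMDiff.comp contMDiff_fst).prodMk contMDiff_snd
  refine (h1.comp h2).congr fun tp => ?_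
  simp [act]

theorem contMDiff_act (A : SU n) : ContMDiff I I ∞ (P.act A) := by
  have h1 := P.contMDiff_act_family (V := ℝ) (f := fun _ => A) fun i j => contDiff_const
  exact h1.comp ((contMDiff_const (c := (0 : ℝ))).prodMk contMDiff_id)

theorem mdifferentiableAt_act (A : SU n) (q : M) : MDifferentiableAt I I (P.act A) q :=
  (P.contMDiff_act A q).mdifferentiableAt (by simp)

theorem translation_mul (A B : SU n) (q : M) :
    P.translation (A * B) q = (P.translation A (P.act B q)).comp (P.translation B q) := by
  have h : P.act (A * B) = P.act A ∘ P.act B := funext fun q => P.act_mul A B q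
  have h1 := mfderiv_comp q (P.mdifferentiableAt_act A (P.act B q)) (P.mdifferentiableAt_act B q)
  rw [← h] at h1
  exact h1

theorem translation_one (q : M) : P.translation 1 q = ContinuousLinearMap.id ℝ E := by
  have h : P.act 1 = id := funext P.act_one
  have h1 : mfderiv I I (P.act 1) q = ContinuousLinearMap.id ℝ (TangentSpace I q) := by
    rw [h, mfderiv_id]
  exact h1

theorem translation_inv_comp (A : SU n) (q : M) :
    (P.translation A⁻¹ (P.act A q)).comp (P.translation A q) = ContinuousLinearMap.id ℝ E := by
  rw [← translation_mul, inv_mul_cancel, translation_one]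

theorem translation_comp_inv (A : SU n) (q : M) :
    (P.translation A q).comp (P.translation A⁻¹ (P.act A q)) = ContinuousLinearMap.id ℝ E := by
  have h := P.translation_mul A A⁻¹ (P.act A q)
  rw [P.act_inv_act A q, mul_inv_cancel, translation_one] at h
  exact h.symm

/-- The orbit map in the coordinates on the complement of the isotropy algebra. -/
def orbit (x : ComplementCoord n) : M := P.act (complementExp n x) P.base

theorem orbit_zero : P.orbit 0 = P.base := by
  rw [orbit, complementExp_zero, act_one]

theorem contMDiff_orbit : ContMDiff 𝓘(ℝ, ComplementCoord n) I ∞ P.orbit :=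
  (P.contMDiff_act_family (contDiff_complementExp n)).comp
    (contMDiff_id.prodMk (contMDiff_const (c := P.base)))

theorem act_centralFlow_orbit (t : ℝ) (x : ComplementCoord n) :
    P.act (centralFlow n t) (P.orbit x) = P.orbit (rotation n t x) := by
  rw [orbit, ← act_mul, centralFlow_mul_complementExp, act_mul,
    P.act_base (centralFlow_mem_isotropySet n t), orbit]

/-- The derivative of the orbit map at the origin. -/
def orbitDeriv : ComplementCoord n →L[ℝ] E :=
  mfderiv 𝓘(ℝ, ComplementCoord n) I P.orbit 0

theorem hasMFDerivAt_orbit :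
    HasMFDerivAt 𝓘(ℝ, ComplementCoord n) I P.orbit 0 P.orbitDeriv :=
  ((P.contMDiff_orbit 0).mdifferentiableAt (by simp)).hasMFDerivAt

theorem injective_orbitDeriv [T2Space M] : Function.Injective P.orbitDeriv := by
  refine (injective_iff_map_eq_zero _).2 fun x hx => ?_
  set γ : ℝ → M := fun t => P.orbit (t • x) with hγ
  have h0 : HasMFDerivAt 𝓘(ℝ, ℝ) I γ 0 0 := by
    have h1 : HasMFDerivAt 𝓘(ℝ, ℝ) 𝓘(ℝ, ComplementCoord n) (fun t : ℝ => t • x) 0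
        (ContinuousLinearMap.toSpanSingleton ℝ x) :=
      (ContinuousLinearMap.toSpanSingleton ℝ x).hasFDerivAt.hasMFDerivAt
    have h2 := P.hasMFDerivAt_orbit
    rw [← zero_smul ℝ x] at h2
    have h3 := h2.comp (0 : ℝ) h1
    convert! h3 using 1
    refine ContinuousLinearMap.ext fun (r : ℝ) => ?_
    change (0 : E) = P.orbitDeriv (r • x)
    rw [map_smul, hx, smul_zero]
  have hadd : ∀ s t, γ (s + t) = P.act (complementExp n (s • x)) (γ t) := fun s t => by
    rw [hγ]
    simp only [orbit]
    rw [complementExp_add_smul, act_mul]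
  have hd : ∀ t, HasMFDerivAt 𝓘(ℝ, ℝ) I γ t 0 := by
    intro t
    have h1 : HasMFDerivAt 𝓘(ℝ, ℝ) 𝓘(ℝ, ℝ) (fun s : ℝ => -t + s) t
        (ContinuousLinearMap.id ℝ ℝ) :=
      ((hasFDerivAt_id t).const_add (-t)).hasMFDerivAt
    rw [← neg_add_cancel t] at h0
    have h2 := h0.comp t h1
    have h3 := (P.mdifferentiableAt_act (complementExp n (t • x)) (γ (-t + t))).hasMFDerivAt.comp t h2
    have h4 : P.act (complementExp n (t • x)) ∘ γ ∘ (fun s : ℝ => -t + s) = γ := funext fun s => by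
      rw [Function.comp_apply, Function.comp_apply, ← hadd, add_neg_cancel_left]
    rw [h4] at h3
    exact h3.congr_mfderiv (ContinuousLinearMap.ext fun _ =>
      map_zero (mfderiv I I (P.act (complementExp n (t • x))) (γ (-t + t))))
  refine eq_zero_of_complementExp_mem fun t => (P.isotropy _).1 ?_
  have h1 : γ t = γ 0 := eq_of_hasMFDerivAt_zero hd t 0
  have h2 : γ 0 = P.base := by rw [hγ]; simp only [zero_smul, orbit_zero]
  exact h1.trans h2

/-- The derivative of the orbit map identifies the complement of the isotropy algebra with the
tangent space at the base point. -/
def orbitEquiv [T2Space M] (hE : finrank ℝ E = 4 * n + 3) : ComplementCoord n ≃L[ℝ] E :=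
  (LinearMap.linearEquivOfInjective (P.orbitDeriv : ComplementCoord n →ₗ[ℝ] E)
    P.injective_orbitDeriv (by rw [finrank_complementCoord, hE])).toContinuousLinearEquiv

theorem orbitEquiv_apply [T2Space M] (hE : finrank ℝ E = 4 * n + 3) (x : ComplementCoord n) :
    P.orbitEquiv hE x = P.orbitDeriv x := rfl

theorem translation_centralFlow (t : ℝ) (x : ComplementCoord n) :
    P.translation (centralFlow n t) P.base (P.orbitDeriv x) = P.orbitDeriv (rotation n t x) := by
  have h1 := (P.mdifferentiableAt_act (centralFlow n t) (P.orbit 0)).hasMFDerivAt.comp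
    (0 : ComplementCoord n) P.hasMFDerivAt_orbit
  have h2 := P.hasMFDerivAt_orbit
  rw [← map_zero (rotation n t)] at h2
  have h3 := h2.comp (0 : ComplementCoord n) (rotation n t).hasFDerivAt.hasMFDerivAt
  have h4 : P.act (centralFlow n t) ∘ P.orbit = P.orbit ∘ rotation n t :=
    funext fun x => P.act_centralFlow_orbit t x
  rw [h4] at h1
  have h5 := hasMFDerivAt_unique h1 h3
  have h6 : P.translation (centralFlow n t) (P.orbit 0) (P.orbitDeriv x)
      = P.orbitDeriv (rotation n t x) := congrArg (fun L : ComplementCoord n →L[ℝ] E => L x) h5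
  rwa [orbit_zero] at h6

variable [T2Space M]

theorem translation_centralFlow_eq (hE : finrank ℝ E = 4 * n + 3) (t : ℝ) :
    P.translation (centralFlow n t) P.base
      = P.orbitDeriv.comp ((rotation n t).comp
          ((P.orbitEquiv hE).symm : E →L[ℝ] ComplementCoord n)) := by
  refine ContinuousLinearMap.ext fun v => ?_
  obtain ⟨x, rfl⟩ := (P.orbitEquiv hE).surjective v
  rw [orbitEquiv_apply, translation_centralFlow]
  simp [← P.orbitEquiv_apply hE]

theorem phiBase_eq (hE : finrank ℝ E = 4 * n + 3) :
    P.phiBase = P.orbitDeriv.comp ((adCentral n).comp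
      ((P.orbitEquiv hE).symm : E →L[ℝ] ComplementCoord n)) := by
  have h := ((hasDerivAt_rotation n).clm_comp (hasDerivAt_const 0
    ((P.orbitEquiv hE).symm : E →L[ℝ] ComplementCoord n)))
  have h1 := (hasDerivAt_const (0 : ℝ) P.orbitDeriv).clm_comp h
  simp only [ContinuousLinearMap.zero_comp, ContinuousLinearMap.comp_zero, zero_add, add_zero]
    at h1
  rw [phiBase, funext (P.translation_centralFlow_eq hE)]
  exact h1.deriv

theorem phiBase_orbitDeriv (hE : finrank ℝ E = 4 * n + 3) (x : ComplementCoord n) :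
    P.phiBase (P.orbitDeriv x) = P.orbitDeriv (adCentral n x) := by
  rw [P.phiBase_eq hE, ← P.orbitEquiv_apply hE]
  simp

end SUPresentation

end Action

/-! ### The horizontal complex structure `φ₀` -/

section HorizontalComplexStructure

variable {V V' : Type*} [NormedAddCommGroup V] [InnerProductSpace ℝ V]
  [NormedAddCommGroup V'] [InnerProductSpace ℝ V']

/-- An orthogonal complex structure `J` of the horizontal space, extended by zero to the Reeb
vectors, which commutes with every `φ i`. -/
structure IsHorizontalComplexStructure (ξ : Fin 3 → V) (φ : Fin 3 → V →L[ℝ] V) (J : V →L[ℝ] V) :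
    Prop where
  skew : ∀ v w, (inner ℝ (J v) w : ℝ) = -inner ℝ v (J w)
  reeb : ∀ i, J (ξ i) = 0
  comm : ∀ i v, J (φ i v) = φ i (J v)
  sq : ∀ v, J (J v) = -horizontalProj ξ v

namespace IsHorizontalComplexStructure

variable {ξ : Fin 3 → V} {φ : Fin 3 → V →L[ℝ] V} {J : V →L[ℝ] V}

theorem isCommutingFamily (h : IsHorizontalComplexStructure ξ φ J) (c : Fin 3 → ℝ) :
    IsCommutingFamily ξ φ (fun l => c l • J) c where
  skew l v w := by
    rw [smul_apply, smul_apply, real_inner_smul_left, real_inner_smul_right, h.skew, mul_neg]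
  reeb l i := by rw [smul_apply, h.reeb, smul_zero]
  comm l i v := by rw [smul_apply, smul_apply, h.comm, map_smul]
  mul k l v := by
    rw [smul_apply, smul_apply, map_smul, h.sq, smul_smul, smul_neg, neg_smul]

/-- Transport along a linear isometry. -/
theorem conj (h : IsHorizontalComplexStructure ξ φ J) {L : V →L[ℝ] V'} {L' : V' →L[ℝ] V}
    (hL : ∀ v w, (inner ℝ (L v) (L w) : ℝ) = inner ℝ v w) (hLL' : ∀ v, L (L' v) = v)
    (hL'L : ∀ v, L' (L v) = v) {ξ' : Fin 3 → V'} {φ' : Fin 3 → V' →L[ℝ] V'}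
    (hξ : ∀ i, L (ξ i) = ξ' i) (hφ : ∀ i v, L (φ i v) = φ' i (L v)) :
    IsHorizontalComplexStructure ξ' φ' (L.comp (J.comp L')) where
  skew v w := by
    have h1 := h.skew (L' v) (L' w)
    rw [← hL, ← hL (L' v), hLL', hLL'] at h1
    exact h1
  reeb i := by
    rw [← hξ]
    simp [hL'L, h.reeb]
  comm i v := by
    have h1 : L' (φ' i v) = φ i (L' v) := by
      rw [← hL'L (φ i (L' v)), hφ, hLL']
    simp only [ContinuousLinearMap.comp_apply, h1, h.comm, hφ]
  sq v := by
    have h1 : ∀ i, (inner ℝ (ξ' i) v : ℝ) = inner ℝ (ξ i) (L' v) := fun i => by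
      rw [← hL, hξ, hLL']
    simp only [ContinuousLinearMap.comp_apply, hL'L, h.sq, horizontalProj_apply, map_neg, map_sub,
      map_sum, map_smul, hLL', hξ, h1]

end IsHorizontalComplexStructure

variable {n : ℕ} {D : ComplementCoord n ≃ₗ[ℝ] V}

section Rotation

theorem inner_offDiagonalPart_diagonalPart
    (hrot : ∀ t x y, (inner ℝ (D (rotation n t x)) (D (rotation n t y)) : ℝ)
      = inner ℝ (D x) (D y)) (x y : ComplementCoord n) :
    (inner ℝ (D (offDiagonalPart n x)) (D (diagonalPart n y)) : ℝ) = 0 := by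
  have h1 := hrot Real.pi (offDiagonalPart n x) (diagonalPart n y)
  have e1 : rotation n Real.pi (offDiagonalPart n x) = -offDiagonalPart n x := by
    simp [rotation_pi, offDiagonalPart, diagonalPart]
  have e2 : rotation n Real.pi (diagonalPart n y) = diagonalPart n y := by
    simp [rotation_pi, offDiagonalPart, diagonalPart]
  rw [e1, e2, map_neg, inner_neg_left] at h1
  linarith

theorem inner_adCentral_adCentral
    (hrot : ∀ t x y, (inner ℝ (D (rotation n t x)) (D (rotation n t y)) : ℝ)
      = inner ℝ (D x) (D y)) (x y : ComplementCoord n) :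
    (inner ℝ (D (adCentral n x)) (D (adCentral n y)) : ℝ)
      = inner ℝ (D (offDiagonalPart n x)) (D (offDiagonalPart n y)) := by
  have h1 := hrot (Real.pi / 2) (offDiagonalPart n x) (offDiagonalPart n y)
  have e1 : ∀ x, rotation n (Real.pi / 2) (offDiagonalPart n x) = adCentral n x := fun x => by
    simp [rotation_pi_div_two, offDiagonalPart, diagonalPart, adCentral]
  rwa [e1, e1] at h1

theorem inner_adCentral_left
    (hrot : ∀ t x y, (inner ℝ (D (rotation n t x)) (D (rotation n t y)) : ℝ)
      = inner ℝ (D x) (D y)) (x y : ComplementCoord n) :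
    (inner ℝ (D (adCentral n x)) (D y) : ℝ) = -inner ℝ (D x) (D (adCentral n y)) := by
  have hoff : ∀ x, offDiagonalPart n (adCentral n x) = adCentral n x := fun x => by
    simp [offDiagonalPart, adCentral]
  have h1 : ∀ x y, (inner ℝ (D (adCentral n x)) (D y) : ℝ)
      = inner ℝ (D (adCentral n x)) (D (offDiagonalPart n y)) := fun x y => by
    conv_lhs => rw [← offDiagonalPart_add_diagonalPart n y, map_add, inner_add_right, ← hoff x,
      inner_offDiagonalPart_diagonalPart hrot, add_zero, hoff]
  have h2 : offDiagonalPart n y = -adCentral n (adCentral n y) := by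
    rw [adCentral_adCentral, neg_neg]
  rw [h1, h2, map_neg, inner_neg_right, inner_adCentral_adCentral hrot, hoff,
    real_inner_comm (D (adCentral n y)) (D x), h1 y x, real_inner_comm]

end Rotation

section Reeb

variable {ξ : Fin 3 → V} {φ : Fin 3 → V →L[ℝ] V}

theorem offDiagonalPart_symm_reeb
    (hfix : ∀ t i, D (rotation n t (D.symm (ξ i))) = ξ i) (i : Fin 3) :
    offDiagonalPart n (D.symm (ξ i)) = 0 := by
  set u := D.symm (ξ i) with hu
  have h1 : rotation n Real.pi u = u := by
    rw [← D.injective.eq_iff, hfix, hu, D.apply_symm_apply]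
  have h2 := offDiagonalPart_add_diagonalPart n u
  rw [rotation_pi, sub_apply, sub_eq_iff_eq_add] at h1
  nth_rw 2 [← h2] at h1
  refine (smul_eq_zero.1 (?_ : (2 : ℝ) • offDiagonalPart n u = 0)).resolve_left two_ne_zero
  rw [two_smul]
  have h3 : offDiagonalPart n u + diagonalPart n u + offDiagonalPart n u
      = (offDiagonalPart n u + offDiagonalPart n u) + diagonalPart n u := by abel
  rw [h3] at h1
  exact (left_eq_add.1 (h1.trans (add_comm _ _)))

/-- The three Reeb vectors are fixed by the rotations, hence span the image of `𝔰𝔲(2)`. -/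
theorem map_diagonalPart_mem_span (hξ : Orthonormal ℝ ξ)
    (hfix : ∀ t i, D (rotation n t (D.symm (ξ i))) = ξ i) (x : ComplementCoord n) :
    D (diagonalPart n x) ∈ Submodule.span ℝ (Set.range ξ) := by
  set F : (ℝ × ℂ) →ₗ[ℝ] V := (D : ComplementCoord n →ₗ[ℝ] V) ∘ₗ LinearMap.inr ℝ _ _ with hF
  have hle : Submodule.span ℝ (Set.range ξ) ≤ LinearMap.range F := by
    refine Submodule.span_le.2 ?_
    rintro _ ⟨i, rfl⟩
    refine ⟨(D.symm (ξ i)).2, ?_⟩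
    have h1 := offDiagonalPart_add_diagonalPart n (D.symm (ξ i))
    rw [offDiagonalPart_symm_reeb hfix, zero_add] at h1
    change D (diagonalPart n (D.symm (ξ i))) = ξ i
    rw [h1, D.apply_symm_apply]
  have hrank : finrank ℝ (LinearMap.range F) ≤ finrank ℝ (Submodule.span ℝ (Set.range ξ)) := by
    rw [finrank_span_eq_card hξ.linearIndependent]
    refine (LinearMap.finrank_range_le F).trans ?_
    simp [Module.finrank_prod]
  rw [Submodule.eq_of_le_of_finrank_le hle hrank]
  exact ⟨x.2, rfl⟩

theorem horizontalProj_map (h : QuaternionicRelations ξ φ)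
    (hrot : ∀ t x y, (inner ℝ (D (rotation n t x)) (D (rotation n t y)) : ℝ)
      = inner ℝ (D x) (D y))
    (hfix : ∀ t i, D (rotation n t (D.symm (ξ i))) = ξ i) (x : ComplementCoord n) :
    horizontalProj ξ (D x) = D (offDiagonalPart n x) := by
  have h1 : horizontalProj ξ (D (diagonalPart n x)) = 0 := by
    have hle : Submodule.span ℝ (Set.range ξ) ≤ LinearMap.ker (horizontalProj ξ) := by
      refine Submodule.span_le.2 ?_
      rintro _ ⟨i, rfl⟩
      exact h.horizontalProj_reeb i
    exact hle (map_diagonalPart_mem_span h.orthonormal hfix x)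
  have h2 : ∀ i, (inner ℝ (ξ i) (D (offDiagonalPart n x)) : ℝ) = 0 := fun i => by
    have h3 := offDiagonalPart_add_diagonalPart n (D.symm (ξ i))
    rw [offDiagonalPart_symm_reeb hfix, zero_add] at h3
    rw [← D.apply_symm_apply (ξ i), ← h3, real_inner_comm,
      inner_offDiagonalPart_diagonalPart hrot]
  conv_lhs => rw [← offDiagonalPart_add_diagonalPart n x, map_add, map_add, h1, add_zero,
    horizontalProj_eq_self h2]

end Reeb

end HorizontalComplexStructure

section Action

variable {n : ℕ} {E : Type*} [NormedAddCommGroup E] [NormedSpace ℝ E] [FiniteDimensional ℝ E]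
  {H : Type*} [TopologicalSpace H] {I : ModelWithCorners ℝ E H}
  {M : Type*} [TopologicalSpace M] [ChartedSpace H M] [IsManifold I ∞ M] [T2Space M]
  [RiemannianBundle (fun p : M => TangentSpace I p)]
  [IsContMDiffRiemannianBundle I ∞ E (fun p : M => TangentSpace I p)]
  {nabla : CovariantDerivative I E (TangentSpace I : M → Type _)}
  {ξ : Fin 3 → Π p : M, TangentSpace I p}

namespace SUPresentation

variable (P : SUPresentation n ξ)

theorem inner_translation {A : SU n} {p q : M} (hA : P.act A p = q) (v w : TangentSpace I p) :
    (inner ℝ (E := TangentSpace I q) (P.translation A p v) (P.translation A p w) : ℝ)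
      = inner ℝ v w := by
  subst hA
  exact (P.preserves A).isometry p v w

theorem translation_reeb {A : SU n} {p q : M} (hA : P.act A p = q) (i : Fin 3) :
    P.translation A p (ξ i p) = ξ i q := by
  subst hA
  exact (P.preserves A).reeb i p

theorem translation_reebEndo (h : IsThreeSasakian nabla ξ) {A : SU n} {p q : M}
    (hA : P.act A p = q) (i : Fin 3) (v : TangentSpace I p) :
    P.translation A p (reebEndo nabla (ξ i) p v)
      = reebEndo nabla (ξ i) q (P.translation A p v : TangentSpace I q) := by
  subst hA
  exact (h.sasakian i).mfderiv_reebEndo h.leviCivita (P.contMDiff_act A) (P.contMDiff_act A⁻¹)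
    (P.act_inv_act A) (P.act_act_inv A) (P.preserves A).isometry ((P.preserves A).reeb i) p v

theorem phiBase_eq_translation (hE : finrank ℝ E = 4 * n + 3) (v : E) :
    P.phiBase v = P.translation (centralFlow n (Real.pi / 2)) P.base v
      - (1 / 2 : ℝ) • (v + P.translation (centralFlow n Real.pi) P.base v) := by
  obtain ⟨x, rfl⟩ := (P.orbitEquiv hE).surjective v
  rw [orbitEquiv_apply, P.phiBase_orbitDeriv hE, P.translation_centralFlow,
    P.translation_centralFlow, ← map_add, ← map_smul, ← map_sub]
  congr 1
  have h1 := offDiagonalPart_add_diagonalPart n x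
  rw [rotation_pi, rotation_pi_div_two, add_apply, sub_apply]
  have h2 : x + (diagonalPart n x - offDiagonalPart n x) = (2 : ℝ) • diagonalPart n x := by
    nth_rw 1 [← h1]
    module
  rw [h2]
  module

theorem isHorizontalComplexStructure_phiBase (h : IsThreeSasakian nabla ξ)
    (hE : finrank ℝ E = 4 * n + 3) :
    IsHorizontalComplexStructure (V := TangentSpace I P.base) (fun i => ξ i P.base)
      (fun i => reebEndo nabla (ξ i) P.base) P.phiBase := by
  let D : ComplementCoord n ≃ₗ[ℝ] TangentSpace I P.base := (P.orbitEquiv hE).toLinearEquiv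
  have hbase : ∀ t, P.act (centralFlow n t) P.base = P.base := fun t =>
    P.act_base (centralFlow_mem_isotropySet n t)
  have hD : ∀ t x, P.translation (centralFlow n t) P.base (D x) = D (rotation n t x) :=
    P.translation_centralFlow
  have hrot : ∀ t x y, (inner ℝ (D (rotation n t x)) (D (rotation n t y)) : ℝ)
      = inner ℝ (D x) (D y) := fun t x y => by
    rw [← hD, ← hD]
    exact P.inner_translation (hbase t) (D x) (D y)
  have hfix : ∀ t i, D (rotation n t (D.symm (ξ i P.base))) = ξ i P.base := fun t i => by
    rw [← hD, D.apply_symm_apply]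
    exact P.translation_reeb (hbase t) i
  have hphi : ∀ x, P.phiBase (D x) = D (adCentral n x) := P.phiBase_orbitDeriv hE
  refine ⟨fun v w => ?_, fun i => ?_, fun i v => ?_, fun v => ?_⟩
  · obtain ⟨x, rfl⟩ := D.surjective v
    obtain ⟨y, rfl⟩ := D.surjective w
    have := inner_adCentral_left hrot x y
    rw [← hphi, ← hphi] at this
    exact this
  · have h1 := hphi (D.symm (ξ i P.base))
    rw [D.apply_symm_apply, ← adCentral_offDiagonalPart, offDiagonalPart_symm_reeb hfix, map_zero,
      map_zero] at h1
    exact h1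
  · have h1 : ∀ t, P.translation (centralFlow n t) P.base (reebEndo nabla (ξ i) P.base v)
        = reebEndo nabla (ξ i) P.base (P.translation (centralFlow n t) P.base v) := fun t =>
      P.translation_reebEndo h (hbase t) i v
    have h2 := P.phiBase_eq_translation hE
    refine (h2 _).trans ?_
    rw [h1, h1]
    refine Eq.trans ?_ (congrArg (reebEndo nabla (ξ i) P.base) (h2 v)).symm
    exact ((reebEndo nabla (ξ i) P.base).map_sub _ _ |>.trans
      (congrArg _ (((reebEndo nabla (ξ i) P.base).map_smul _ _).trans
        (congrArg _ ((reebEndo nabla (ξ i) P.base).map_add _ _))))).symm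
  · obtain ⟨x, rfl⟩ := D.surjective v
    refine (congrArg P.phiBase (hphi x)).trans ((hphi _).trans ?_)
    rw [adCentral_adCentral, map_neg, horizontalProj_map (h.quaternionicRelations P.base) hrot hfix]

/-- The isotropy representation commutes with `φ₀`, since `h` is central in the isotropy algebra. -/
theorem translation_phiBase (hE : finrank ℝ E = 4 * n + 3) {k : SU n} (hk : k ∈ isotropySet n)
    (v : E) :
    P.translation k P.base (P.phiBase v) = P.phiBase (P.translation k P.base v) := by
  have h1 : ∀ t v, P.translation k P.base (P.translation (centralFlow n t) P.base v)
      = P.translation (centralFlow n t) P.base (P.translation k P.base v) := fun t v => by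
    have e1 := P.translation_mul k (centralFlow n t) P.base
    have e2 := P.translation_mul (centralFlow n t) k P.base
    rw [P.act_base (centralFlow_mem_isotropySet n t), commute_centralFlow hk] at e1
    rw [P.act_base hk] at e2
    exact congrArg (fun L => L v) (e1.symm.trans e2)
  rw [P.phiBase_eq_translation hE, P.phiBase_eq_translation hE, map_sub, map_smul, map_add, h1, h1]

/-- The value of `φ₀` at `A o` may be computed with any `A`. -/
theorem phiZero_act_base (hE : finrank ℝ E = 4 * n + 3) {A : SU n} {p : M}
    (hA : P.act A P.base = p) (v : E) :
    (P.phiZero p : E →L[ℝ] E) v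
      = P.translation A P.base (P.phiBase (P.translation A⁻¹ p v)) := by
  obtain ⟨B, hB, hphi⟩ : ∃ B, P.act B P.base = p ∧ (P.phiZero p : E →L[ℝ] E) v
      = P.translation B P.base (P.phiBase (P.translation B⁻¹ p v)) :=
    ⟨_, (P.transitive p).choose_spec, rfl⟩
  have hAp : P.act A⁻¹ p = P.base := by rw [← hA, P.act_inv_act A]
  set k := A⁻¹ * B with hk
  have hkb : P.act k P.base = P.base := by rw [hk, act_mul, hB, hAp]
  have hki : k ∈ isotropySet n := (P.isotropy k).1 hkb
  have hBk : B = A * k := by rw [hk, mul_inv_cancel_left]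
  have h1 := P.translation_mul A k P.base
  have h2 := P.translation_mul k⁻¹ A⁻¹ p
  rw [hkb, ← hBk] at h1
  rw [hAp, ← mul_inv_rev, ← hBk] at h2
  have h3 := P.translation_comp_inv k P.base
  rw [hkb] at h3
  rw [hphi, h1, h2, ContinuousLinearMap.comp_apply, ContinuousLinearMap.comp_apply,
    P.translation_phiBase hE hki]
  exact congrArg (fun w => P.translation A P.base (P.phiBase w))
    (congrArg (fun L : E →L[ℝ] E => L (P.translation A⁻¹ p v)) h3)

theorem isHorizontalComplexStructure_phiZero (h : IsThreeSasakian nabla ξ)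
    (hE : finrank ℝ E = 4 * n + 3) (p : M) :
    IsHorizontalComplexStructure (fun i => ξ i p) (fun i => reebEndo nabla (ξ i) p)
      (P.phiZero p) := by
  obtain ⟨A, hA⟩ : ∃ A, P.act A P.base = p := P.transitive p
  have h1 := P.translation_comp_inv A P.base
  have h2 := P.translation_inv_comp A P.base
  rw [hA] at h1 h2
  have h3 := (P.isHorizontalComplexStructure_phiBase h hE).conj (V' := TangentSpace I p)
    (L := P.translation A P.base) (L' := P.translation A⁻¹ p)
    (ξ' := fun i => ξ i p) (φ' := fun i => reebEndo nabla (ξ i) p)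
    (P.inner_translation hA) (fun v => congrArg (fun L : E →L[ℝ] E => L v) h1)
    (fun v => congrArg (fun L : E →L[ℝ] E => L v) h2) (P.translation_reeb hA)
    (P.translation_reebEndo h hA)
  convert! h3 using 1
  exact ContinuousLinearMap.ext fun v => P.phiZero_act_base hE hA v

end SUPresentation

end Action

/-! ### Smoothness of `φ₀` -/

section Smoothness

variable {E : Type*} [NormedAddCommGroup E] [NormedSpace ℝ E] [FiniteDimensional ℝ E]
  {H : Type*} [TopologicalSpace H] {I : ModelWithCorners ℝ E H}
  {M : Type*} [TopologicalSpace M] [ChartedSpace H M] [IsManifold I ∞ M]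

/-- The inverse function theorem for a map from a vector space to a manifold. -/
theorem exists_contMDiffAt_rightInverse {V : Type*} [NormedAddCommGroup V] [NormedSpace ℝ V]
    [CompleteSpace V] {F : V → M} {a : V} (hF : ContMDiffAt 𝓘(ℝ, V) I ∞ F a) {F' : V →L[ℝ] E}
    (hF' : HasMFDerivAt 𝓘(ℝ, V) I F a F') (hinv : F'.IsInvertible) :
    ∃ σ : M → V, ContMDiffAt I 𝓘(ℝ, V) ∞ σ (F a) ∧ σ (F a) = a ∧
      ∀ᶠ q in 𝓝 (F a), F (σ q) = q := by
  set e := extChartAt I (F a) with he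
  have hsrc : F a ∈ e.source := mem_extChartAt_source (F a)
  have he1 : ContMDiffAt I 𝓘(ℝ, E) ∞ e (F a) := contMDiffAt_extChartAt
  have hG : ContDiffAt ℝ ∞ (e ∘ F) a := (he1.comp a hF).contDiffAt
  obtain ⟨G', hG'⟩ : ∃ G' : V ≃L[ℝ] E, HasFDerivAt (e ∘ F) (G' : V →L[ℝ] E) a := by
    have h1 := ((he1.mdifferentiableAt (by simp)).hasMFDerivAt.comp a hF').hasFDerivAt
    obtain ⟨C, hC⟩ : ∃ C : E ≃L[ℝ] E, (C : E →L[ℝ] E) = mfderiv I 𝓘(ℝ, E) e (F a) :=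
      isInvertible_mfderiv_extChartAt hsrc
    obtain ⟨C', rfl⟩ := hinv
    refine ⟨C'.trans C, h1.congr_fderiv (ContinuousLinearMap.ext fun x => ?_)⟩
    exact (congrArg (fun L : E →L[ℝ] E => L (C' x)) hC).symm
  have hn : (∞ : ℕ∞ω) ≠ 0 := by simp
  set τ := hG.localInverse hG' hn with hτ
  have hτ0 : τ (e (F a)) = a := hG.localInverse_apply_image hG' hn
  have hτ1 : ContMDiffAt I 𝓘(ℝ, V) ∞ (τ ∘ e) (F a) :=
    (hG.to_localInverse hG' hn).contMDiffAt.comp (F a) he1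
  have hτ2 : ∀ᶠ y in 𝓝 (e (F a)), e (F (τ y)) = y :=
    (hG.hasStrictFDerivAt' hG' hn).eventually_right_inverse
  refine ⟨τ ∘ e, hτ1, hτ0, ?_⟩
  have hc : Filter.Tendsto (fun q => F (τ (e q))) (𝓝 (F a)) (𝓝 (F a)) := by
    have h1 : ContinuousAt F (τ (e (F a))) := by rw [hτ0]; exact hF.continuousAt
    have h2 := ContinuousAt.comp (f := τ ∘ e) (x := F a) h1 hτ1.continuousAt
    have h3 : (F ∘ τ ∘ e) (F a) = F a := congrArg F hτ0
    rw [ContinuousAt, h3] at h2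
    exact h2
  have hs : e.source ∈ 𝓝 (F a) := extChartAt_source_mem_nhds (F a)
  filter_upwards [he1.continuousAt.eventually hτ2, hc hs, hs] with q h1 h2 h3
  exact e.injOn h2 h3 h1

/-- Derivatives in one variable of a smooth map of two variables act smoothly on vectors. -/
theorem contMDiffAt_mfderiv_family {f : M → M → M} {b : M → M}
    {v : Π q, TangentSpace I (b q)} {p : M}
    (hf : ContMDiffAt (I.prod I) I ∞ (Function.uncurry f) (p, b p))
    (hv : ContMDiffAt I I.tangent ∞ (fun q => (⟨b q, v q⟩ : TangentBundle I M)) p) :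
    ContMDiffAt I I.tangent ∞
      (fun q => (⟨f q (b q), mfderiv I I (f q) (b q) (v q)⟩ : TangentBundle I M)) p := by
  have hb : ContMDiffAt I I ∞ b p :=
    ContMDiffAt.comp (f := fun q => (⟨b q, v q⟩ : TangentBundle I M)) p
      (Bundle.contMDiffAt_proj (TangentSpace I)) hv
  have hb' : ContMDiffAt I (I.prod I) ∞ (fun q => (q, b q)) p := contMDiffAt_id.prodMk hb
  exact ContMDiffAt.clm_apply_of_inCoordinates
    (ContMDiffAt.mfderiv (n := ∞) (m := ∞) f b hf hb (by exact le_rfl)) hv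
    (ContMDiffAt.comp (g := Function.uncurry f) p hf hb')

end Smoothness

section Action

variable {n : ℕ} {E : Type*} [NormedAddCommGroup E] [NormedSpace ℝ E] [FiniteDimensional ℝ E]
  {H : Type*} [TopologicalSpace H] {I : ModelWithCorners ℝ E H}
  {M : Type*} [TopologicalSpace M] [ChartedSpace H M] [IsManifold I ∞ M] [T2Space M]
  [RiemannianBundle (fun p : M => TangentSpace I p)]
  [IsContMDiffRiemannianBundle I ∞ E (fun p : M => TangentSpace I p)]
  {nabla : CovariantDerivative I E (TangentSpace I : M → Type _)}
  {ξ : Fin 3 → Π p : M, TangentSpace I p}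

namespace SUPresentation

variable (P : SUPresentation n ξ)

/-- The orbit map has local sections. -/
theorem exists_section (hE : finrank ℝ E = 4 * n + 3) (p : M) :
    ∃ (A : SU n) (σ : M → ComplementCoord n),
      ContMDiffAt I 𝓘(ℝ, ComplementCoord n) ∞ σ p ∧ σ p = 0 ∧ P.act A P.base = p ∧
      ∀ᶠ q in 𝓝 p, P.act (A * complementExp n (σ q)) P.base = q := by
  obtain ⟨A, hA⟩ : ∃ A, P.act A P.base = p := P.transitive p
  have h0 : P.act A (P.orbit 0) = p := by rw [orbit_zero, hA]
  have hF : ContMDiffAt 𝓘(ℝ, ComplementCoord n) I ∞ (P.act A ∘ P.orbit) 0 :=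
    ((P.contMDiff_act A).comp P.contMDiff_orbit) 0
  have hF' := (P.mdifferentiableAt_act A (P.orbit 0)).hasMFDerivAt.comp
    (0 : ComplementCoord n) P.hasMFDerivAt_orbit
  have h1 : (mfderiv I I (P.act A) (P.orbit 0)).IsInvertible :=
    isInvertible_mfderiv (P.contMDiff_act A) (P.contMDiff_act A⁻¹) (P.act_inv_act A)
      (P.act_act_inv A) _
  have h2 : P.orbitDeriv.IsInvertible := ⟨P.orbitEquiv hE, rfl⟩
  obtain ⟨σ, hσ, hσ0, hσe⟩ := exists_contMDiffAt_rightInverse hF hF'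
    (ContinuousLinearMap.IsInvertible.comp (M₂ := E) (M₃ := E) h1 h2)
  rw [Function.comp_apply, h0] at hσ hσ0 hσe
  refine ⟨A, σ, hσ, hσ0, hA, ?_⟩
  filter_upwards [hσe] with q hq
  rw [act_mul]
  exact hq

theorem isSmoothField_phiZero (hE : finrank ℝ E = 4 * n + 3) {X : Π p : M, TangentSpace I p}
    (hX : IsSmoothField X) : IsSmoothField fun p => P.phiZero p (X p) := by
  intro p
  obtain ⟨A, σ, hσ, hσ0, hA, hσe⟩ := P.exists_section hE p
  set g : M → SU n := fun q => A * complementExp n (σ q) with hg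
  have hσ2 : ∀ r, ContMDiffAt (I.prod I) (𝓘(ℝ, ComplementCoord n).prod I) ∞
      (fun x : M × M => (σ x.1, x.2)) (p, r) := fun r =>
    (ContMDiffAt.comp (p, r) hσ contMDiffAt_fst).prodMk contMDiffAt_snd
  have hf2 : ∀ r, ContMDiffAt (I.prod I) I ∞
      (Function.uncurry fun q y => P.act (g q) y) (p, r) := fun r => by
    have h1 := ((P.contMDiff_act A).comp
      (P.contMDiff_act_family (contDiff_complementExp n))).contMDiffAt.comp (p, r) (hσ2 r)
    refine h1.congr_of_eventuallyEq (Filter.Eventually.of_forall fun x => ?_)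
    exact P.act_mul _ _ _
  have hf1 : ∀ r, ContMDiffAt (I.prod I) I ∞
      (Function.uncurry fun q y => P.act (g q)⁻¹ y) (p, r) := fun r => by
    have hneg : ∀ i j, ContDiff ℝ ∞ fun x => (complementExp n (-x)).1 i j := fun i j =>
      (contDiff_complementExp n i j).comp contDiff_neg
    have h1 : ContMDiffAt (I.prod I) (𝓘(ℝ, ComplementCoord n).prod I) ∞
        (fun x : M × M => (σ x.1, P.act A⁻¹ x.2)) (p, r) :=
      (ContMDiffAt.comp (p, r) hσ contMDiffAt_fst).prodMk
        ((P.contMDiff_act A⁻¹).contMDiffAt.comp (p, r) contMDiffAt_snd)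
    have h2 := (P.contMDiff_act_family hneg).contMDiffAt.comp (p, r) h1
    refine h2.congr_of_eventuallyEq (Filter.Eventually.of_forall fun x => ?_)
    change P.act (g x.1)⁻¹ x.2 = P.act (complementExp n (-σ x.1)) (P.act A⁻¹ x.2)
    rw [← act_mul, complementExp_neg, hg, mul_inv_rev]
  have hback : ∀ᶠ q in 𝓝 p, P.act (g q)⁻¹ q = P.base := hσe.mono fun q hq => by
    have e := P.act_inv_act (g q) P.base
    rwa [show P.act (g q) P.base = q from hq] at e
  -- translate `X` to the base point, apply `φ₀` there, and translate back
  have h1 := contMDiffAt_mfderiv_family (b := id) (v := X) (hf1 p) (hX p)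
  have h2 : ContMDiffAt I I.tangent ∞
      (fun q => (⟨P.base, P.translation (g q)⁻¹ q (X q)⟩ : TangentBundle I M)) p := by
    refine h1.congr_of_eventuallyEq (hback.mono fun q hq => ?_)
    change (⟨P.base, P.translation (g q)⁻¹ q (X q)⟩ : TangentBundle I M)
      = ⟨P.act (g q)⁻¹ q, P.translation (g q)⁻¹ q (X q)⟩
    rw [hq]
  have h3 : ContMDiffAt I I.tangent ∞ (fun q =>
      (⟨P.base, P.phiBase (P.translation (g q)⁻¹ q (X q))⟩ : TangentBundle I M)) p :=
    ContMDiffAt.clm_apply_of_inCoordinates (E₁ := (TangentSpace I : M → Type _))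
      (E₂ := (TangentSpace I : M → Type _)) (b₁ := fun _ => P.base) (b₂ := fun _ => P.base)
      (ϕ := fun _ => P.phiBase) contMDiffAt_const h2 contMDiffAt_const
  have h4 := contMDiffAt_mfderiv_family (b := fun _ => P.base) (hf2 P.base) h3
  refine h4.congr_of_eventuallyEq (hσe.mono fun q hq => ?_)
  have h5 := P.phiZero_act_base hE hq (X q)
  change (⟨q, P.phiZero q (X q)⟩ : TangentBundle I M) = ⟨P.act (g q) P.base,
    P.translation (g q) P.base (P.phiBase (P.translation (g q)⁻¹ q (X q)))⟩
  rw [← h5, hq]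

theorem isAdmissible (h : IsThreeSasakian nabla ξ) (hE : finrank ℝ E = 4 * n + 3)
    (c : Fin 3 → ℝ) : IsAdmissible nabla ξ P.phiZero c where
  smooth l _ hX := (P.isSmoothField_phiZero hE hX).const_smul (c l)
  commutingFamily p := (P.isHorizontalComplexStructure_phiZero h hE p).isCommutingFamily c

end SUPresentation

end Action

end ThreeSasakian

end

theorem proposition5p3 (n : ℕ) (hn : 1 ≤ n)
    {M : Type*} [TopologicalSpace M] [T2Space M] [SecondCountableTopology M]
    [ChartedSpace (EuclideanSpace ℝ (Fin (4 * n + 3))) M]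
    [IsManifold (𝓡 (4 * n + 3)) ∞ M]
    [RiemannianBundle (fun p : M => TangentSpace (𝓡 (4 * n + 3)) p)]
    [IsContMDiffRiemannianBundle (𝓡 (4 * n + 3)) ∞ (EuclideanSpace ℝ (Fin (4 * n + 3)))
      (fun p : M => TangentSpace (𝓡 (4 * n + 3)) p)]
    -- the Levi-Civita connection and the 3-Sasakian structure of `M`
    (nablaG : CovariantDerivative (𝓡 (4 * n + 3)) (EuclideanSpace ℝ (Fin (4 * n + 3)))
      (TangentSpace (𝓡 (4 * n + 3)) : M → Type _))
    (ξ : Fin 3 → Π p : M, TangentSpace (𝓡 (4 * n + 3)) p)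
    (hξ : ThreeSasakian.IsThreeSasakian nablaG ξ)
    (hhom : ThreeSasakian.IsHomogeneous ξ)
    -- the parameters of the connection; `c = 0` unless `M = SU(n+2)/S(U(n) × U(1))`
    (a : ℝ) (B : Matrix (Fin 3) (Fin 3) ℝ) (c : Fin 3 → ℝ)
    (φ₀ : Π p : M, TangentSpace (𝓡 (4 * n + 3)) p →L[ℝ] TangentSpace (𝓡 (4 * n + 3)) p)
    (hc : c = 0 ∨ ∃ P : ThreeSasakian.SUPresentation n ξ, φ₀ = P.phiZero)
    (nabla : CovariantDerivative (𝓡 (4 * n + 3)) (EuclideanSpace ℝ (Fin (4 * n + 3)))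
      (TangentSpace (𝓡 (4 * n + 3)) : M → Type _))
    (hnabla : nabla = ThreeSasakian.skewConnection nablaG ξ φ₀ a B c)
    -- a point and an orthonormal basis of the tangent space there
    (p : M) (e : OrthonormalBasis (Fin (4 * n + 3)) ℝ (TangentSpace (𝓡 (4 * n + 3)) p)) :
    -- the tensor `S`
    ((∀ X ∈ ThreeSasakian.horizontal ξ p, ∀ V ∈ ThreeSasakian.vertical ξ p,
        ThreeSasakian.torsionSquare nabla e X V = 0 ∧
        ThreeSasakian.torsionSquare nabla e V X = 0) ∧
      (∀ i k, ThreeSasakian.torsionSquare nabla e (ξ i p) (ξ k p)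
        = 2 * (if i = k then 1 else 0) * (a - B.trace) ^ 2
          + 4 * n * (∑ s, B i s * B k s) + 4 * n * c i * c k) ∧
      (∀ X ∈ ThreeSasakian.horizontal ξ p, ∀ Y ∈ ThreeSasakian.horizontal ξ p,
        ThreeSasakian.torsionSquare nabla e X Y
          = 2 * ((∑ r, ∑ s, B r s ^ 2) + ∑ l, c l ^ 2) * inner ℝ X Y
            + 4 * ∑ s, ∑ j, B j s * c j *
              inner ℝ (φ₀ p X) (ThreeSasakian.reebEndo nablaG (ξ s) p Y))) ∧
    -- the symmetric part of the Ricci tensor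
    ((∀ X ∈ ThreeSasakian.horizontal ξ p, ∀ V ∈ ThreeSasakian.vertical ξ p,
        ThreeSasakian.symRicci nabla e X V = 0 ∧ ThreeSasakian.symRicci nabla e V X = 0) ∧
      (∀ i k, ThreeSasakian.symRicci nabla e (ξ i p) (ξ k p)
        = (4 * n + 2 - 1 / 2 * (a - B.trace) ^ 2) * (if i = k then 1 else 0)
          - n * (∑ s, B i s * B k s) - n * c i * c k) ∧
      (∀ X ∈ ThreeSasakian.horizontal ξ p, ∀ Y ∈ ThreeSasakian.horizontal ξ p,
        ThreeSasakian.symRicci nabla e X Y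
          = (4 * n + 2 - ((∑ r, ∑ s, B r s ^ 2) + ∑ l, c l ^ 2) / 2) * inner ℝ X Y
            - ∑ s, ∑ j, B j s * c j *
              inner ℝ (φ₀ p X) (ThreeSasakian.reebEndo nablaG (ξ s) p Y))) ∧
    -- the scalar curvature
    ThreeSasakian.scalarCurvature nabla e
      = (4 * n + 2) * (4 * n + 3) - 3 / 2 * (a - B.trace) ^ 2
        - 3 * n * ((∑ r, ∑ s, B r s ^ 2) + ∑ l, c l ^ 2) := by
  have hφ : ThreeSasakian.IsAdmissible nablaG ξ φ₀ c := by
    rcases hc with rfl | ⟨P, rfl⟩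
    · exact ThreeSasakian.isAdmissible_zero
    · exact P.isAdmissible hξ (by simp) c
  have hcard : Fintype.card (Fin (4 * n + 3)) = 4 * n + 3 := Fintype.card_fin _
  subst hnabla
  refine ⟨⟨fun X hX V hV => ?_, hφ.torsionSquare_reeb hξ e hcard, fun X hX Y hY =>
    hφ.torsionSquare_horizontal hξ e hX hY⟩, ⟨fun X hX V hV => ?_, fun i k => ?_,
    fun X hX Y hY => ?_⟩, hφ.scalarCurvature_eq hξ e hcard⟩
  · have h0 := hφ.torsionSquare_horizontal_vertical (a := a) (B := B) hξ e hX hV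
    exact ⟨h0, (ThreeSasakian.torsionSquare_comm e V X).trans h0⟩
  · have h0 := hφ.torsionSquare_horizontal_vertical (a := a) (B := B) hξ e hX hV
    have hXV : inner ℝ V X = (0 : ℝ) := (Submodule.mem_orthogonal _ _).1 hX V hV
    rw [hφ.symRicci_eq hξ e hcard, hφ.symRicci_eq hξ e hcard, ThreeSasakian.torsionSquare_comm e V X,
      h0, real_inner_comm V X, hXV]
    simp
  · rw [hφ.symRicci_eq hξ e hcard, hφ.torsionSquare_reeb hξ e hcard, hξ.inner_reeb]
    ring
  · rw [hφ.symRicci_eq hξ e hcard, hφ.torsionSquare_horizontal hξ e hX hY]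
    ring
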